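/- Let $d\ge 1$ and $n\ge 0$ be integers, let $p_1,\dots,p_n$ be distinct points of the oriented $2$-sphere $\mathbb S^2=\mathbb C\cup\{\infty\}$, and let $d_1,\dots,d_n$ be positive integers. Let $X$ be a closed (compact, Hausdorff) connected surface that is a $d$-fold cyclically branched cover of the punctured sphere $\mathbb S^2\setminus\{p_1,\dots,p_n\}$ with branching indices $(d_1,\dots,d_n)$. That is, there are a continuous surjection $\pi:X\to\mathbb S^2$ and a homeomorphism $\sigma:X\to X$ such that (a) the fibres of $\pi$ are the orbits of the cyclic group generated by $\sigma$, so that $\mathbb S^2=X/\langle\sigma\rangle$; (b) over $\mathbb S^2\setminus\{p_1,\dots,p_n\}$ the map $\pi$ is a covering map, and every $\sigma$-orbit there has exactly $d$ points; (c) near each point over some $p_i$ the map $\pi$ has the form $z\mapsto z^k$ for some $k\ge1$, in a suitable chart of $X$ and the standard complex coordinate of the sphere at $p_i$; (d) for each $i$, every lift to $X$ of a sufficiently small positively oriented circle around $p_i$, run through once, starting at a point $x$, ends at $\sigma^{d_i}(x)$. Then $$\operatorname{genus}(X)=\frac{d(n-2)}{2}+1-\frac12\sum_{i=1}^n\gcd(d,d_i).$$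 In particular, if $\gcd(d,d_i)=1$ for all $i$, then $\operatorname{genus}(X)=\left(\frac n2-1\right)(d-1)$. Here the genus $g$ of a closed connected orientable surface is half the rank of its first homology group $H_1(X)=\pi_1(X)^{\mathrm{ab}}$; in particular that rank is finite and even. -/

import Mathlib

/-- The standard complex coordinate of the Riemann sphere `OnePoint ℂ = ℂ ∪ {∞}` at the point `a`,
as a parametrisation `w ↦ sphereParam a w` with `sphereParam a 0 = a`:
it is `w ↦ a + w` when `a` is finite and `w ↦ 1 / w` when `a = ∞`. -/
noncomputable def sphereParam (a : OnePoint ℂ) (w : ℂ) : OnePoint ℂ :=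
  a.elim (if w = 0 then OnePoint.infty else ((w⁻¹ : ℂ) : OnePoint ℂ))
    (fun z => ((z + w : ℂ) : OnePoint ℂ))

/-- The positively oriented (counterclockwise) circle of coordinate radius `r` around the point `a`
of the Riemann sphere, run through once for `t ∈ [0, 1]`. -/
noncomputable def positiveCircle (a : OnePoint ℂ) (r : ℝ) (t : unitInterval) : OnePoint ℂ :=
  sphereParam a ((r : ℂ) * Complex.exp (2 * (Real.pi : ℂ) * Complex.I * ((t : ℝ) : ℂ)))

/-- `CyclicBranchedCover d p b X` is the structure on `X` of a `d`-fold cyclically branched cover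
of the sphere punctured at the points `p i`, with branching indices `b i`. -/
structure CyclicBranchedCover (d : ℕ) {n : ℕ} (p : Fin n → OnePoint ℂ) (b : Fin n → ℕ)
    (X : Type*) [TopologicalSpace X] where
  /-- the branched covering map -/
  proj : X → OnePoint ℂ
  /-- the generator of the cyclic group of deck transformations (sheet `j` goes to sheet `j + 1`) -/
  deck : X ≃ₜ X
  continuous_proj : Continuous proj
  surjective_proj : Function.Surjective proj
  /-- the sphere is the quotient of `X` by the cyclic group: the fibres are the orbits -/
  proj_eq_iff : ∀ x y, proj x = proj y ↔ ∃ k : ℕ, deck^[k] x = y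
  /-- over the punctured sphere the cyclic group has order `d` and acts freely -/
  deck_free : ∀ x, proj x ∉ Set.range p → ∀ k : ℕ, deck^[k] x = x ↔ d ∣ k
  /-- over the punctured sphere, `proj` is an (unbranched) covering map -/
  isCoveringMapOn : IsCoveringMapOn proj (Set.range p)ᶜ
  /-- over a puncture, `proj` is `z ↦ z ^ k`, for some `k ≥ 1`, in a suitable chart `φ` of `X` and
  the standard coordinate of the sphere -/
  local_form : ∀ x, proj x ∈ Set.range p → ∃ k : ℕ, 0 < k ∧ ∃ φ : OpenPartialHomeomorph X ℂ,
    x ∈ φ.source ∧ φ x = 0 ∧ ∀ y ∈ φ.source, proj y = sphereParam (proj x) (φ y ^ k)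
  /-- every lift of a small positively oriented circle around `p i`
  leads from sheet `j` to sheet `j + b i` -/
  monodromy : ∀ i, ∀ᶠ r : ℝ in nhdsWithin 0 (Set.Ioi 0), ∀ γ : C(unitInterval, X),
    (∀ t, proj (γ t) = positiveCircle (p i) r t) → γ 1 = deck^[b i] (γ 0)

/-- The first homology group of a path connected space `X`, as the abelianisation of its
fundamental group (at a base point `x`), written additively. -/
abbrev FirstHomology (X : Type*) [TopologicalSpace X] (x : X) : Type _ :=
  Additive (Abelianization (FundamentalGroup X x))

/-- The genus of a closed connected orientable surface `X` is `g` when its first Betti number, the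
rank of its first homology group, is `2 g`. The rank is a cardinal, so that it is
in particular finite here. -/
def HasGenus (X : Type*) [TopologicalSpace X] (g : ℕ) : Prop :=
  PathConnectedSpace X ∧ ∀ x : X, Module.rank ℤ (FirstHomology X x) = ((2 * g : ℕ) : Cardinal)

/-! This is the Riemann–Hurwitz formula: `X` is cut into simply connected pieces lying over pieces
of the sphere, its first Betti number is read off from the numbers of pieces, and the points over
each `p i` are counted by monodromy.

Enlarge the branch set to a finite set containing `0` and `∞`, and multiply by a complex number so
that its `N` finite points have distinct real parts. The plane cut along the upward vertical rays
from these points is simply connected, so `X` splits over it into `d` sheets. A thin band around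
each ray lifts to `d` bands, and every point of `X` over a vertex has a disc neighbourhood. This
`SlitCover` plays the role of a cell decomposition with `d` faces, `N * d` edges and `F` vertices,
where `F` is the number of points over the enlarged set.

The rational Čech cohomology of such a cover in degree one is the dual of the first homology
(`finrank_homology_hom`). Homomorphisms on homology extend to additive functions of homotopy classes
of paths, these have primitives on simply connected sets, and conversely local primitives with
locally constant differences glue, by monodromy in a covering space. For a slit cover a normalised
cocycle is given by its values on the bands and by two functions on the edges having equal
increments along two permutations, which describe the crossing of a slit near its lower end and near
`∞`. As `X` is connected, the two permutations act transitively together; this makes the space of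
cocycles of dimension `2 * N * d + 1`, and the Betti number is `N * d + 2 - d - F`.

The Betti number is even by a count modulo 2. If `d` is odd, all fibres have odd size. If `d` is
even, the fibre over a finite vertex has the parity of the jump of the sheets across its slit, and
the fibre over `∞` has the parity of the sum of the jumps.

Finally the fibre over `p i` is a single orbit of the deck transformation, with `gcd d (b i)` points
(`minimalPeriod_eq_gcd`). All other fibres have `d` points, and the auxiliary vertices cancel from
the formula. -/

open Topology unitInterval

/-! ### Gluing local potentials to cocycles on paths -/

/-- An `A`-valued cocycle on the homotopy classes of paths of `X`. -/
def IsPathCocycle {X A : Type*} [TopologicalSpace X] [AddCommGroup A]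
    (Φ : ∀ x y : X, Path.Homotopic.Quotient x y → A) : Prop :=
  ∀ x y z (p : Path.Homotopic.Quotient x y) (q : Path.Homotopic.Quotient y z),
    Φ x z (p.trans q) = Φ x y p + Φ y z q

/-- `u` is a family of functions on the members of the cover `U`, whose differences are
locally constant. -/
def IsLocalPotential {ι X A : Type*} [TopologicalSpace X] [AddCommGroup A]
    (U : ι → Set X) (u : ι → X → A) : Prop :=
  ∀ i j, ∀ x ∈ U i ∩ U j, ∀ᶠ y in 𝓝 x, u i y - u j y = u i x - u j x

/-- The function `F` along the path `γ` differs from each `u i` by locally constant functions. -/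
def IsPrimitiveAlong {ι X A : Type*} [TopologicalSpace X] [AddCommGroup A]
    (U : ι → Set X) (u : ι → X → A) (γ : I → X) (F : I → A) : Prop :=
  ∀ i t, γ t ∈ U i → ∀ᶠ s in 𝓝 t, F s - u i (γ s) = F t - u i (γ t)

section Gluing

variable {ι X A : Type*} [TopologicalSpace X] [AddCommGroup A] {U : ι → Set X} {u : ι → X → A}

omit [AddCommGroup A] in
theorem eq_of_eventually_eq {F : I → A} (h : ∀ t, ∀ᶠ s in 𝓝 t, F s = F t) (s t : I) : F s = F t :=
  ((IsLocallyConstant.iff_eventually_eq F).2 h).apply_eq_of_preconnectedSpace s t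

theorem IsPrimitiveAlong.sub_eq (hc : ∀ x, ∃ i, x ∈ U i) {γ : I → X} {F G : I → A}
    (hF : IsPrimitiveAlong U u γ F) (hG : IsPrimitiveAlong U u γ G) (s t : I) :
    F s - F t = G s - G t := by
  have key : ∀ t, ∀ᶠ s in 𝓝 t, F s - G s = F t - G t := by
    intro t
    obtain ⟨i, hi⟩ := hc (γ t)
    filter_upwards [hF i t hi, hG i t hi] with s h1 h2
    have : F s - G s = (F s - u i (γ s)) - (G s - u i (γ s)) := by abel
    rw [this, h1, h2]; abel
  have := eq_of_eventually_eq (F := fun s => F s - G s) key s t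
  rw [sub_eq_sub_iff_add_eq_add] at this ⊢
  rw [this, add_comm]

theorem IsLocalPotential.isPrimitiveAlong (hu : IsLocalPotential U u) {γ : I → X}
    (hγ : Continuous γ) {i : ι} (hi : ∀ t, γ t ∈ U i) :
    IsPrimitiveAlong U u γ (fun t => u i (γ t)) :=
  fun j t hj => (hγ.tendsto t).eventually (hu i j (γ t) ⟨hi t, hj⟩)

/-- The bundle of primitives of a local potential. -/
noncomputable def potentialCore [TopologicalSpace A] [DiscreteTopology A]
    (hU : ∀ i, IsOpen (U i)) (hc : ∀ x, ∃ i, x ∈ U i) (hu : IsLocalPotential U u) :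
    FiberBundleCore ι X A where
  baseSet := U
  isOpen_baseSet := hU
  indexAt x := (hc x).choose
  mem_baseSet_at x := (hc x).choose_spec
  coordChange i j x v := v + (u j x - u i x)
  coordChange_self i x _ v := by simp
  continuousOn_coordChange i j := by
    rintro ⟨x, v⟩ ⟨hx, -⟩
    refine ContinuousAt.continuousWithinAt ?_
    have : (fun p : X × A => p.2 + (u j p.1 - u i p.1)) =ᶠ[𝓝 (x, v)]
        fun p => p.2 + (u j x - u i x) := by
      filter_upwards [continuousAt_fst.eventually (hu j i x ⟨hx.2, hx.1⟩)] with p hp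
      rw [hp]
    exact ContinuousAt.congr (by fun_prop) this.symm
  coordChange_comp i j k x _ v := by abel

/-- Local primitives form a bundle with discrete fibre `A`, which is a covering space. Continuing a
primitive along a path is monodromy in it, so the increment depends only on the homotopy class. It
does not depend on the initial primitive either, as two primitives along a path differ by a
constant; additivity follows. -/
theorem IsLocalPotential.exists_isPathCocycle (hU : ∀ i, IsOpen (U i)) (hc : ∀ x, ∃ i, x ∈ U i)
    (hu : IsLocalPotential U u) :
    ∃ Φ : ∀ x y : X, Path.Homotopic.Quotient x y → A, IsPathCocycle Φ ∧
      ∀ i x y (γ : Path x y), (∀ t, γ t ∈ U i) → Φ x y (.mk γ) = u i y - u i x := by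
  classical
  let _ : TopologicalSpace A := ⊥
  have : DiscreteTopology A := ⟨rfl⟩
  set Z := potentialCore hU hc hu with hZ
  have cov : IsCoveringMap Z.proj := FiberBundle.isCoveringMap (F := A) (E := Z.Fiber)
  -- Coordinate changes add `u j - u i`, so `W` equals `u i` minus the `i`-th fibre coordinate for
  -- every `i`. Along a continuous path that coordinate is locally constant.
  let W : Z.TotalSpace → A := fun e => u (Z.indexAt e.1) e.1 - (show A from e.2)
  have prim : ∀ Γ : C(I, Z.TotalSpace), IsPrimitiveAlong U u (fun t => Z.proj (Γ t))
      (fun t => W (Γ t)) := by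
    intro Γ i t ht
    have hsrc : Γ t ∈ (Z.localTriv i).source := (Z.mem_localTriv_source i _).2 ht
    have hcont : ContinuousAt (fun s => (Z.localTriv i (Γ s)).2) t :=
      ContinuousAt.comp (f := Γ) (g := fun e => (Z.localTriv i e).2)
        (continuousAt_snd.comp ((Z.localTriv i).continuousAt hsrc)) Γ.continuous.continuousAt
    have hev : ∀ᶠ s in 𝓝 t, (Z.localTriv i (Γ s)).2 = (Z.localTriv i (Γ t)).2 :=
      hcont.eventually (p := fun a => a = (Z.localTriv i (Γ t)).2)
        (by rw [nhds_discrete]; exact Filter.eventually_pure.2 rfl)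
    have hval : ∀ s, W (Γ s) - u i (Z.proj (Γ s)) = -(Z.localTriv i (Γ s)).2 := by
      intro s
      change u (Z.indexAt (Γ s).1) (Γ s).1 - (show A from (Γ s).2) - u i (Γ s).1 =
        -((show A from (Γ s).2) + (u i (Γ s).1 - u (Z.indexAt (Γ s).1) (Γ s).1))
      abel
    filter_upwards [hev] with s hs
    rw [hval, hval, hs]
  have indep : ∀ x y (p : Path.Homotopic.Quotient x y) (e e' : Z.proj ⁻¹' {x}),
      W (cov.monodromy p e) - W e = W (cov.monodromy p e') - W e' := by
    intro x y p e e'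
    induction p using Path.Homotopic.Quotient.ind with
    | mk γ =>
      have h0 : ∀ e : Z.proj ⁻¹' {x}, (γ : C(I, X)) 0 = Z.proj e.1 :=
        fun e => by rw [e.2]; exact γ.source
      have h1 := fun e => prim (cov.liftPath γ e.1 (h0 e))
      have h2 : ∀ e, (fun t => Z.proj (cov.liftPath γ e.1 (h0 e) t)) = γ :=
        fun e => cov.liftPath_lifts γ e.1 (h0 e)
      have h3 := IsPrimitiveAlong.sub_eq hc (h2 e ▸ h1 e) (h2 e' ▸ h1 e') 1 0
      simp only [cov.liftPath_zero] at h3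
      exact h3
  let b : ∀ x : X, Z.proj ⁻¹' {x} := fun x => ⟨⟨x, (0 : A)⟩, rfl⟩
  refine ⟨fun x y p => W (cov.monodromy p (b x)) - W (b x), ?_, ?_⟩
  · intro x y z p q
    simp only [cov.monodromy_trans_apply]
    rw [indep y z q (b y) (cov.monodromy p (b x))]
    abel
  · intro i x y γ hγ
    have h0 : (γ : C(I, X)) 0 = Z.proj (b x).1 := γ.source
    have h1 := prim (cov.liftPath γ (b x).1 h0)
    have h2 : (fun t => Z.proj (cov.liftPath γ (b x).1 h0 t)) = γ :=
      cov.liftPath_lifts γ (b x).1 h0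
    rw [h2] at h1
    have h3 := IsPrimitiveAlong.sub_eq hc h1 (hu.isPrimitiveAlong γ.continuous hγ) 1 0
    simp only [cov.liftPath_zero, γ.source, γ.target] at h3
    exact h3

end Gluing

/-! ### Locality and local primitives of cocycles on paths -/

section Cocycles

variable {X A : Type*} [TopologicalSpace X] [AddCommGroup A]
  {Φ Ψ : ∀ x y : X, Path.Homotopic.Quotient x y → A}

theorem IsPathCocycle.map_refl (h : IsPathCocycle Φ) (x : X) : Φ x x (.refl x) = 0 := by
  have := h x x x (.refl x) (.refl x)
  rw [Path.Homotopic.Quotient.trans_refl] at this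
  simpa using this

theorem IsPathCocycle.sub (h : IsPathCocycle Φ) (h' : IsPathCocycle Ψ) :
    IsPathCocycle (fun x y p => Φ x y p - Ψ x y p) := by
  intro x y z p q
  simp only [h x y z p q, h' x y z p q]; abel

theorem IsPathCocycle.add (h : IsPathCocycle Φ) (h' : IsPathCocycle Ψ) :
    IsPathCocycle (fun x y p => Φ x y p + Ψ x y p) := by
  intro x y z p q
  simp only [h x y z p q, h' x y z p q]; abel

theorem isPathCocycle_coboundary (h : X → A) : IsPathCocycle (fun x y _ => h y - h x) := by
  intro x y z p q
  simp

/-- A cocycle that vanishes on the paths inside the members of an open cover is zero. -/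
theorem IsPathCocycle.eq_zero {ι : Type*} {U : ι → Set X} (hU : ∀ i, IsOpen (U i))
    (hc : ∀ x, ∃ i, x ∈ U i) (h : IsPathCocycle Φ)
    (h0 : ∀ i x y (γ : Path x y), (∀ t, γ t ∈ U i) → Φ x y (.mk γ) = 0) (x y : X)
    (p : Path.Homotopic.Quotient x y) : Φ x y p = 0 := by
  induction p using Path.Homotopic.Quotient.ind with
  | mk γ =>
    -- The value on the initial piece of the path is locally constant in its end point, because a
    -- short further piece stays in one member of the cover.
    have key : ∀ t, ∀ᶠ s in 𝓝 t, Φ _ _ (.mk (γ.subpath 0 s)) = Φ _ _ (.mk (γ.subpath 0 t)) := by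
      intro t
      obtain ⟨i, hi⟩ := hc (γ t)
      have hnhds : γ ⁻¹' U i ∈ 𝓝 t := γ.continuous.continuousAt.preimage_mem_nhds
        ((hU i).mem_nhds hi)
      obtain ⟨ε, hε, hb⟩ := Metric.mem_nhds_iff.1 hnhds
      filter_upwards [Metric.ball_mem_nhds t hε] with s hs
      have htr : Path.Homotopic.Quotient.mk (γ.subpath 0 s) =
          Path.Homotopic.Quotient.trans (.mk (γ.subpath 0 t)) (.mk (γ.subpath t s)) :=
        (Quotient.sound (s := Path.Homotopic.setoid _ _)
            (show Path.Homotopic _ _ from ⟨Path.Homotopy.subpathTransSubpath γ 0 t s⟩)).symm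
      rw [htr, h, h0 i _ _ (γ.subpath t s), add_zero]
      intro r
      have : γ.subpath t s r ∈ Set.range (γ.subpath t s) := ⟨r, rfl⟩
      rw [Path.range_subpath] at this
      obtain ⟨r', hr', he⟩ := this
      rw [← he]
      refine hb (lt_of_le_of_lt (b := dist s t) ?_ hs)
      rw [dist_comm r' t, dist_comm s t]
      exact Real.dist_left_le_of_mem_uIcc (x := t) (y := r') (z := s) (by
        rcases Set.mem_uIcc.1 hr' with h | h
        exacts [Set.mem_uIcc.2 (Or.inl h), Set.mem_uIcc.2 (Or.inr h)])
    have h1 := eq_of_eventually_eq key 1 0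
    rw [Path.subpath_self, Path.subpath_zero_one] at h1
    rw [show Φ (γ 0) (γ 0) (.mk (Path.refl (γ 0))) = 0 from h.map_refl (γ 0)] at h1
    have h2 : ∀ (a b : X) (ha : a = x) (hb : b = y),
        Φ a b (.mk (γ.cast ha hb)) = Φ x y (.mk γ) := by
      rintro a b rfl rfl; rfl
    rw [h2] at h1
    exact h1

/-- Integrate from a base point of `U`: any two paths in `U` with the same ends are homotopic.
Outside `U` the primitive has the irrelevant value `0`. -/
theorem IsPathCocycle.exists_primitive {U : Set X} (hU : IsSimplyConnected U)
    (h : IsPathCocycle Φ) :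
    ∃ v : X → A, ∀ x y (γ : Path x y), (∀ t, γ t ∈ U) → Φ x y (.mk γ) = v y - v x := by
  classical
  have := hU.simplyConnectedSpace
  obtain ⟨b⟩ : Nonempty U := hU.nonempty.to_subtype
  let ι : C(U, X) := ⟨Subtype.val, continuous_subtype_val⟩
  let v : X → A := fun y => if hy : y ∈ U then
    Φ b y ((Path.Homotopic.Quotient.mk (PathConnectedSpace.somePath b ⟨y, hy⟩)).map ι)
    else 0
  refine ⟨v, fun x y γ hγ => ?_⟩
  have hx : x ∈ U := by simpa using hγ 0
  have hy : y ∈ U := by simpa using hγ 1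
  let γ' : Path (⟨x, hx⟩ : U) ⟨y, hy⟩ :=
    ⟨⟨fun t => ⟨γ t, hγ t⟩, by fun_prop⟩, by simp, by simp⟩
  have e1 : ((.mk γ) : Path.Homotopic.Quotient x y) =
      (Path.Homotopic.Quotient.mk γ').map ι := rfl
  simp only [v, dif_pos hx, dif_pos hy]
  rw [eq_sub_iff_add_eq', e1]
  have e2 := h b x y ((Path.Homotopic.Quotient.mk (PathConnectedSpace.somePath b ⟨x, hx⟩)).map ι)
    ((Path.Homotopic.Quotient.mk γ').map ι)
  rw [← e2]
  congr 1
  rw [← Path.Homotopic.Quotient.mk_map, ← Path.Homotopic.Quotient.mk_map,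
    ← Path.Homotopic.Quotient.mk_trans, ← Path.map_trans, Path.Homotopic.Quotient.mk_map]
  congr 1
  exact Subsingleton.elim _ _

end Cocycles

/-! ### Cocycles on paths and homomorphisms on homology -/

section Periods

variable {X : Type*} [TopologicalSpace X] {Φ Ψ : ∀ x y : X, Path.Homotopic.Quotient x y → ℚ}

/-- The periods of a cocycle, as a function on the first homology group. -/
noncomputable def IsPathCocycle.periods (h : IsPathCocycle Φ) (x : X) :
    FirstHomology X x →ₗ[ℤ] ℚ :=
  (MonoidHom.toAdditiveLeft (Abelianization.lift
    ({ toFun := fun p => Multiplicative.ofAdd (Φ x x p)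
       map_one' := by
        rw [FundamentalGroup.one_def]
        exact congrArg _ (h.map_refl x)
       -- Multiplication in the fundamental group concatenates in the reverse order, which is
       -- harmless in a commutative target.
       map_mul' := fun p q => by
        rw [FundamentalGroup.mul_def, h, ← ofAdd_add, add_comm] } :
      FundamentalGroup X x →* Multiplicative ℚ))).toIntLinearMap

/-- The homology class of a loop. -/
noncomputable def loopClass {x : X} (p : Path.Homotopic.Quotient x x) : FirstHomology X x :=
  Additive.ofMul (Abelianization.of (show FundamentalGroup X x from p))

theorem IsPathCocycle.periods_loopClass (h : IsPathCocycle Φ) {x : X}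
    (p : Path.Homotopic.Quotient x x) : h.periods x (loopClass p) = Φ x x p := rfl

theorem homology_hom_ext {x : X} {f g : FirstHomology X x →ₗ[ℤ] ℚ}
    (h : ∀ p : Path.Homotopic.Quotient x x, f (loopClass p) = g (loopClass p)) : f = g := by
  ext c
  obtain ⟨c, rfl⟩ := Additive.ofMul.surjective c
  obtain ⟨p, rfl⟩ := QuotientGroup.mk_surjective c
  exact h p

theorem loopClass_trans {x : X} (p q : Path.Homotopic.Quotient x x) :
    loopClass (p.trans q) = loopClass p + loopClass q := by
  have : (show FundamentalGroup X x from p.trans q) =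
      (show FundamentalGroup X x from q) * (show FundamentalGroup X x from p) := rfl
  simp only [loopClass, this, map_mul, ofMul_mul]
  rw [add_comm]

/-- Every homomorphism on homology consists of the periods of a cocycle. -/
theorem exists_cocycle_of_hom [PathConnectedSpace X] {x : X} (f : FirstHomology X x →ₗ[ℤ] ℚ) :
    ∃ Φ : ∀ x y : X, Path.Homotopic.Quotient x y → ℚ, ∃ h : IsPathCocycle Φ,
      h.periods x = f := by
  classical
  -- A path is closed up to a loop at `x` by means of fixed connecting paths from `x` to its ends.
  let α : ∀ y, Path.Homotopic.Quotient x y := fun y => .mk (PathConnectedSpace.somePath x y)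
  let Φ : ∀ x y : X, Path.Homotopic.Quotient x y → ℚ := fun y z p =>
    f (loopClass (((α y).trans p).trans (α z).symm))
  have h : IsPathCocycle Φ := by
    intro a b c p q
    simp only [Φ]
    rw [← map_add, ← loopClass_trans]
    congr 2
    rw [Path.Homotopic.Quotient.trans_assoc, Path.Homotopic.Quotient.trans_assoc,
      Path.Homotopic.Quotient.trans_assoc, Path.Homotopic.Quotient.trans_assoc,
      Path.Homotopic.Quotient.trans_assoc]
    congr 2
    rw [← Path.Homotopic.Quotient.trans_assoc (α b).symm,
      Path.Homotopic.Quotient.symm_trans, Path.Homotopic.Quotient.refl_trans]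
  refine ⟨Φ, h, homology_hom_ext fun p => ?_⟩
  rw [h.periods_loopClass]
  simp only [Φ]
  rw [loopClass_trans, loopClass_trans]
  -- The connecting path from `x` to `x` need not be constant, but its class cancels against that of
  -- its inverse.
  have : loopClass ((α x).trans (α x).symm) = (0 : FirstHomology X x) := by
    rw [Path.Homotopic.Quotient.trans_symm]; rfl
  rw [loopClass_trans] at this
  rw [add_right_comm, this, zero_add]

/-- Integrating from `x` along chosen paths gives the primitive; closing a path up to a loop at `x`
shows that the choice does not matter. -/
theorem IsPathCocycle.exists_eq_of_periods_eq_zero [PathConnectedSpace X] (h : IsPathCocycle Φ)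
    {x : X} (h0 : h.periods x = 0) :
    ∃ v : X → ℚ, ∀ y z p, Φ y z p = v z - v y := by
  let α : ∀ y, Path.Homotopic.Quotient x y := fun y => .mk (PathConnectedSpace.somePath x y)
  refine ⟨fun y => Φ x y (α y), fun y z p => ?_⟩
  have h1 : Φ x x (((α y).trans p).trans (α z).symm) = 0 := by
    rw [← h.periods_loopClass, h0]; rfl
  have h2 : Φ x x ((α z).trans (α z).symm) = 0 := by
    rw [Path.Homotopic.Quotient.trans_symm, h.map_refl]
  rw [h, h] at h1
  rw [h] at h2
  linarith

end Periods

/-! ### Čech cohomology of covers by simply connected sets -/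

section Cech

variable {ι X : Type*} [TopologicalSpace X]

/-- The Čech cocycles of a cover with values in `ℚ`, represented by families of functions
`u i` on `U i` with locally constant differences, normalised by `u (sel x) x = 0`. -/
def cechCocycles (U : ι → Set X) (sel : X → ι) : Submodule ℚ (ι → X → ℚ) where
  carrier := {u | IsLocalPotential U u ∧ (∀ i x, x ∉ U i → u i x = 0) ∧ ∀ x, u (sel x) x = 0}
  add_mem' := by
    rintro u v ⟨h1, h2, h3⟩ ⟨k1, k2, k3⟩
    refine ⟨fun i j x hx => ?_, fun i x hx => by simp [h2 i x hx, k2 i x hx],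
      fun x => by simp [h3, k3]⟩
    filter_upwards [h1 i j x hx, k1 i j x hx] with y hy hy'
    simp only [Pi.add_apply]
    linarith
  zero_mem' := ⟨fun i j x _ => by simp, by simp, by simp⟩
  smul_mem' := by
    rintro c u ⟨h1, h2, h3⟩
    refine ⟨fun i j x hx => ?_, fun i x hx => by simp [h2 i x hx], fun x => by simp [h3]⟩
    filter_upwards [h1 i j x hx] with y hy
    simp only [Pi.smul_apply, smul_eq_mul, ← mul_sub, hy]

variable {U : ι → Set X} {sel : X → ι}

open Classical in
/-- The Čech coboundary of a family of constants. -/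
noncomputable def cechCoboundary (U : ι → Set X) (hU : ∀ i, IsOpen (U i)) (sel : X → ι) :
    (ι → ℚ) →ₗ[ℚ] cechCocycles U sel where
  toFun κ := ⟨fun i x => if x ∈ U i then κ i - κ (sel x) else 0, by
    refine ⟨fun i j x hx => ?_, fun i x hx => if_neg hx, fun x => by simp⟩
    filter_upwards [((hU i).inter (hU j)).mem_nhds hx] with y hy
    rw [if_pos hx.1, if_pos hx.2, if_pos hy.1, if_pos hy.2]; ring⟩
  map_add' κ κ' := by
    ext i x
    by_cases hx : x ∈ U i <;> simp [hx]; ring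
  map_smul' c κ := by
    ext i x
    by_cases hx : x ∈ U i <;> simp [hx]; ring

variable (hU : ∀ i, IsOpen (U i)) (hsel : ∀ x, x ∈ U (sel x))

/-- The cocycle on paths glued from a Čech cocycle. -/
noncomputable def gluedCocycle (hU : ∀ i, IsOpen (U i)) (hsel : ∀ x, x ∈ U (sel x))
    (u : cechCocycles U sel) : ∀ x y : X, Path.Homotopic.Quotient x y → ℚ :=
  (u.2.1.exists_isPathCocycle hU (fun x => ⟨sel x, hsel x⟩)).choose

theorem gluedCocycle_isPathCocycle (u : cechCocycles U sel) :
    IsPathCocycle (gluedCocycle hU hsel u) :=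
  (u.2.1.exists_isPathCocycle hU (fun x => ⟨sel x, hsel x⟩)).choose_spec.1

theorem gluedCocycle_apply (u : cechCocycles U sel) {i : ι} {x y : X} (γ : Path x y)
    (h : ∀ t, γ t ∈ U i) : gluedCocycle hU hsel u x y (.mk γ) = u.1 i y - u.1 i x :=
  (u.2.1.exists_isPathCocycle hU (fun x => ⟨sel x, hsel x⟩)).choose_spec.2 i x y γ h

/-- By locality a cocycle is determined by its values on the paths inside members of the cover. This
makes the chosen gluing linear in `u` and identifies it in all later computations. -/
theorem eq_gluedCocycle (u : cechCocycles U sel)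
    {Φ : ∀ x y : X, Path.Homotopic.Quotient x y → ℚ} (h : IsPathCocycle Φ)
    (hΦ : ∀ i x y (γ : Path x y), (∀ t, γ t ∈ U i) → Φ x y (.mk γ) = u.1 i y - u.1 i x)
    (x y : X) (p : Path.Homotopic.Quotient x y) : Φ x y p = gluedCocycle hU hsel u x y p :=
  sub_eq_zero.1 <| (h.sub (gluedCocycle_isPathCocycle hU hsel u)).eq_zero hU
    (fun x => ⟨sel x, hsel x⟩) (fun i x y γ hγ => by
      have h1 := hΦ i x y γ hγ
      have h2 := gluedCocycle_apply hU hsel u γ hγ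
      change Φ x y (.mk γ) - gluedCocycle hU hsel u x y (.mk γ) = 0
      rw [h1, h2, sub_self]) x y p

/-- The periods of a Čech cocycle. -/
noncomputable def cechPeriods (x : X) :
    cechCocycles U sel →ₗ[ℚ] (FirstHomology X x →ₗ[ℤ] ℚ) where
  toFun u := (gluedCocycle_isPathCocycle hU hsel u).periods x
  map_add' u v := homology_hom_ext fun p => by
    refine (eq_gluedCocycle hU hsel (u + v) ((gluedCocycle_isPathCocycle hU hsel u).add
      (gluedCocycle_isPathCocycle hU hsel v)) (fun i x y γ hγ => ?_) x x p).symm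
    rw [gluedCocycle_apply hU hsel u γ hγ, gluedCocycle_apply hU hsel v γ hγ]
    simp only [Submodule.coe_add, Pi.add_apply]; ring
  map_smul' c u := homology_hom_ext fun p => by
    refine (eq_gluedCocycle hU hsel (c • u)
      (Φ := fun x y p => c * gluedCocycle hU hsel u x y p) (fun x y z p q => ?_)
      (fun i x y γ hγ => ?_) x x p).symm
    · simp only [gluedCocycle_isPathCocycle hU hsel u x y z p q]; ring
    · rw [gluedCocycle_apply hU hsel u γ hγ]
      simp only [Submodule.coe_smul, Pi.smul_apply, smul_eq_mul]; ring

/-- A homomorphism consists of the periods of a cocycle, which has a primitive on each simply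
connected member. Differences of primitives are locally constant, since nearby points are joined
inside the intersection. Normalising the primitives changes the cocycle by a coboundary, which has
no periods. -/
theorem cechPeriods_surjective [PathConnectedSpace X] [LocallyPathConnectedSpace X]
    (hs : ∀ i, IsSimplyConnected (U i)) (x : X) :
    Function.Surjective (cechPeriods hU hsel x) := by
  classical
  intro f
  obtain ⟨Φ, h, rfl⟩ := exists_cocycle_of_hom f
  choose v hv using fun i => h.exists_primitive (hs i)
  let u : ι → X → ℚ := fun i x => if x ∈ U i then v i x - v (sel x) x else 0
  have hu : u ∈ cechCocycles U sel := by
    refine ⟨fun i j x hx => ?_, fun i x hx => if_neg hx, fun x => by simp [u]⟩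
    obtain ⟨V, ⟨hVx, hVc⟩, hVs⟩ := (LocallyPathConnectedSpace.path_connected_basis x).mem_iff.1
      (((hU i).inter (hU j)).mem_nhds hx)
    filter_upwards [hVx] with y hy
    obtain ⟨γ, hγ⟩ := hVc.joinedIn _ (mem_of_mem_nhds hVx) _ hy
    have h1 := hv i x y γ fun t => (hVs (hγ t)).1
    have h2 := hv j x y γ fun t => (hVs (hγ t)).2
    simp only [u]
    rw [if_pos hx.1, if_pos hx.2, if_pos (hVs hy).1, if_pos (hVs hy).2]
    linarith
  refine ⟨⟨u, hu⟩, homology_hom_ext fun p => ?_⟩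
  have := eq_gluedCocycle hU hsel ⟨u, hu⟩
    (h.sub (isPathCocycle_coboundary fun x => v (sel x) x)) (fun i x y γ hγ => ?_) x x p
  · change gluedCocycle hU hsel ⟨u, hu⟩ x x p = Φ x x p
    rw [← this]; simp
  · have hx : x ∈ U i := by simpa using hγ 0
    have hy : y ∈ U i := by simpa using hγ 1
    simp only [u]
    rw [if_pos hx, if_pos hy, show Φ x y (.mk γ) = v i y - v i x from hv i x y γ hγ]
    ring

/-- If all periods vanish, there is a global primitive `v`, and `u i - v` is constant on the path
connected set `U i`. These constants have `u` as their coboundary: the normalisation `u (sel y) y =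
0` identifies `-v y` with the constant of `sel y`. -/
theorem ker_cechPeriods [PathConnectedSpace X]
    (hs : ∀ i, IsPathConnected (U i)) (x : X) :
    LinearMap.ker (cechPeriods hU hsel x) = LinearMap.range (cechCoboundary U hU sel) := by
  apply le_antisymm
  · intro u hu
    obtain ⟨v, hv⟩ := (gluedCocycle_isPathCocycle hU hsel u).exists_eq_of_periods_eq_zero
      (x := x) hu
    have key : ∀ i, ∀ y ∈ U i, ∀ z ∈ U i, u.1 i y - v y = u.1 i z - v z := by
      intro i y hy z hz
      obtain ⟨γ, hγ⟩ := (hs i).joinedIn _ hy _ hz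
      have h1 := gluedCocycle_apply hU hsel u γ hγ
      rw [hv] at h1
      linarith
    refine ⟨fun i => u.1 i (hs i).nonempty.some - v (hs i).nonempty.some, ?_⟩
    ext i y
    simp only [cechCoboundary, LinearMap.coe_mk, AddHom.coe_mk]
    by_cases hy : y ∈ U i
    · rw [if_pos hy, key i _ (hs i).nonempty.some_mem y hy,
        key (sel y) _ (hs (sel y)).nonempty.some_mem y (hsel y), u.2.2.2 y]
      ring
    · rw [if_neg hy, u.2.2.1 i y hy]
  · rintro _ ⟨κ, rfl⟩
    refine homology_hom_ext fun p => ?_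
    have := eq_gluedCocycle hU hsel (cechCoboundary U hU sel κ)
      (isPathCocycle_coboundary fun x => - κ (sel x)) (fun i x y γ hγ => ?_) x x p
    · change gluedCocycle hU hsel (cechCoboundary U hU sel κ) x x p = 0
      rw [← this]; simp
    · have hx : x ∈ U i := by simpa using hγ 0
      have hy : y ∈ U i := by simpa using hγ 1
      simp only [cechCoboundary, LinearMap.coe_mk, AddHom.coe_mk]
      rw [if_pos hx, if_pos hy]
      ring

/-- For `κ` in the kernel, `x ↦ κ (sel x)` is locally constant on a connected space, and each `κ i`
is one of its values. -/
theorem mem_ker_cechCoboundary [ConnectedSpace X] (hne : ∀ i, (U i).Nonempty)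
    (hsel : ∀ x, x ∈ U (sel x)) {κ : ι → ℚ} :
    κ ∈ LinearMap.ker (cechCoboundary U hU sel) ↔ ∃ c, κ = fun _ => c := by
  constructor
  · intro h
    have h1 : ∀ i, ∀ x ∈ U i, κ i = κ (sel x) := by
      intro i x hx
      have := congrFun (congrFun (congrArg Subtype.val h) i) x
      simp only [cechCoboundary, LinearMap.coe_mk, AddHom.coe_mk, if_pos hx] at this
      exact sub_eq_zero.1 this
    have h2 : IsLocallyConstant (fun x => κ (sel x)) := by
      refine (IsLocallyConstant.iff_eventually_eq _).2 fun x => ?_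
      filter_upwards [(hU (sel x)).mem_nhds (hsel x)] with y hy
      exact (h1 _ y hy).symm
    obtain ⟨x₀⟩ : Nonempty X := inferInstance
    refine ⟨κ (sel x₀), funext fun i => ?_⟩
    obtain ⟨x, hx⟩ := hne i
    rw [h1 i x hx]
    exact h2.apply_eq_of_preconnectedSpace x x₀
  · rintro ⟨c, rfl⟩
    ext i x
    simp [cechCoboundary]

/-- Čech computation of the dual of the first rational homology. -/
theorem finrank_homology_hom [Fintype ι] (hU : ∀ i, IsOpen (U i))
    (hsel : ∀ x, x ∈ U (sel x)) [ConnectedSpace X] [PathConnectedSpace X]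
    [LocallyPathConnectedSpace X] (hs : ∀ i, IsSimplyConnected (U i))
    [FiniteDimensional ℚ (cechCocycles U sel)] (x : X) :
    FiniteDimensional ℚ (FirstHomology X x →ₗ[ℤ] ℚ) ∧
      Module.finrank ℚ (FirstHomology X x →ₗ[ℤ] ℚ) + Fintype.card ι =
        Module.finrank ℚ (cechCocycles U sel) + 1 := by
  -- The dimension count is that of the exact sequence `0 → ℚ → (ι → ℚ) → cechCocycles U sel →
  -- Hom(H₁, ℚ) → 0`.
  have hsurj := cechPeriods_surjective hU hsel hs x
  have h1 := LinearMap.finrank_range_add_finrank_ker (cechPeriods hU hsel x)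
  have h2 := LinearMap.finrank_range_add_finrank_ker (cechCoboundary U hU sel)
  rw [ker_cechPeriods hU hsel (fun i => (hs i).isPathConnected) x, LinearMap.range_eq_top.2 hsurj,
    finrank_top] at h1
  have h3 : Module.finrank ℚ (LinearMap.ker (cechCoboundary U hU sel)) = 1 := by
    have hne : Nonempty ι := by
      obtain ⟨x₀⟩ : Nonempty X := inferInstance
      exact ⟨sel x₀⟩
    have : LinearMap.ker (cechCoboundary U hU sel) = Submodule.span ℚ {fun _ => (1 : ℚ)} := by
      ext κ
      rw [mem_ker_cechCoboundary hU (fun i => (hs i).nonempty) hsel, Submodule.mem_span_singleton]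
      constructor
      · rintro ⟨c, rfl⟩
        exact ⟨c, by ext; simp⟩
      · rintro ⟨c, rfl⟩
        exact ⟨c, by ext; simp⟩
    rw [this]
    exact finrank_span_singleton (fun h => one_ne_zero (congrFun h hne.some))
  rw [h3, Module.finrank_fintype_fun_eq_card] at h2
  exact ⟨Module.Finite.of_surjective _ hsurj, by omega⟩

end Cech

/-- The homomorphisms to `ℚ` form the dual of `ℚ ⊗ H`. If the dual is finite dimensional then so is
`ℚ ⊗ H`, with the same dimension, and base change preserves the rank; `H` need not be known to be
finitely generated. -/
theorem rank_int_eq_of_finrank_hom {H : Type*} [AddCommGroup H]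
    [FiniteDimensional ℚ (H →ₗ[ℤ] ℚ)] :
    Module.rank ℤ H = (Module.finrank ℚ (H →ₗ[ℤ] ℚ) : Cardinal) := by
  have e : (H →ₗ[ℤ] ℚ) ≃ₗ[ℚ] Module.Dual ℚ (TensorProduct ℤ ℚ H) :=
    LinearMap.liftBaseChangeEquiv ℚ
  have : FiniteDimensional ℚ (Module.Dual ℚ (TensorProduct ℤ ℚ H)) := Module.Finite.equiv e
  have : FiniteDimensional ℚ (TensorProduct ℤ ℚ H) := (Module.finite_dual_iff ℚ).1 this
  rw [← IsBaseChange.rank_eq (TensorProduct.isBaseChange ℤ H ℚ), e.finrank_eq, Subspace.dual_finrank_eq,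
    Module.finrank_eq_rank]

/-! ### Functions with equal increments along two permutations -/

section LinearAlgebra

variable {E : Type*}

/-- Pairs of functions with the same increments along the permutations `e₁` and `e₂`. -/
def equalIncrements (e₁ e₂ : Equiv.Perm E) : Submodule ℚ ((E → ℚ) × (E → ℚ)) where
  carrier := {v | ∀ e, v.1 e - v.1 (e₁ e) = v.2 e - v.2 (e₂ e)}
  add_mem' := by
    intro v w hv hw e
    have h1 := hv e
    have h2 := hw e
    simp only [Prod.fst_add, Prod.snd_add, Pi.add_apply]
    linarith
  zero_mem' := by intro e; simp
  smul_mem' := by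
    intro c v hv e
    have h1 := hv e
    simp only [Prod.smul_fst, Prod.smul_snd, Pi.smul_apply, smul_eq_mul, ← mul_sub, h1]

/-- The space is the kernel of a map `L` from dimension `2 * |E|` to dimension `|E|`. A functional
that kills the image of `L` is a weight function invariant under both permutations, hence a multiple
of the sum of coordinates. So `L` has rank `|E| - 1`. -/
theorem finrank_equalIncrements [Fintype E] [Nonempty E] (e₁ e₂ : Equiv.Perm E)
    (h : ∀ f : E → ℚ, (∀ e, f (e₁ e) = f e) → (∀ e, f (e₂ e) = f e) → ∀ e e', f e = f e') :
    Module.finrank ℚ (equalIncrements e₁ e₂) = Fintype.card E + 1 := by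
  classical
  let L : ((E → ℚ) × (E → ℚ)) →ₗ[ℚ] (E → ℚ) :=
    { toFun := fun v e => v.1 e - v.1 (e₁ e) - (v.2 e - v.2 (e₂ e))
      map_add' := by
        intro v w; ext e; simp only [Prod.fst_add, Prod.snd_add, Pi.add_apply]; ring
      map_smul' := by
        intro c v; ext e
        simp only [Prod.smul_fst, Prod.smul_snd, Pi.smul_apply, smul_eq_mul, RingHom.id_apply]
        ring }
  have hker : LinearMap.ker L = equalIncrements e₁ e₂ := by
    ext v
    constructor
    · intro hv e
      exact sub_eq_zero.1 (congrFun hv e)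
    · intro hv
      ext e
      exact sub_eq_zero.2 (hv e)
  let S : Module.Dual ℚ (E → ℚ) := ∑ e, LinearMap.proj e
  have hS : ∀ f, S f = ∑ e, f e := fun f => by simp [S]
  have hdual : LinearMap.ker L.dualMap = Submodule.span ℚ {S} := by
    ext φ
    rw [Submodule.mem_span_singleton]
    constructor
    · intro hφ
      have h0 : ∀ v, φ (L v) = 0 := fun v => LinearMap.congr_fun hφ v
      let f : E → ℚ := fun e => φ (Pi.single e 1)
      have h1 : ∀ e, f (e₁ e) = f e := by
        intro e
        have : L (Pi.single (e₁ e) 1, 0) = Pi.single (e₁ e) 1 - Pi.single e 1 := by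
          ext e'
          simp [L, Pi.single_apply]
        have h2 := h0 (Pi.single (e₁ e) 1, 0)
        rw [this, map_sub] at h2
        exact sub_eq_zero.1 h2
      have h2 : ∀ e, f (e₂ e) = f e := by
        intro e
        have : L (0, Pi.single (e₂ e) 1) = Pi.single e 1 - Pi.single (e₂ e) 1 := by
          ext e'
          simp [L, Pi.single_apply]
        have h2 := h0 (0, Pi.single (e₂ e) 1)
        rw [this, map_sub] at h2
        exact (sub_eq_zero.1 h2).symm
      obtain ⟨e₀⟩ : Nonempty E := inferInstance
      refine ⟨f e₀, LinearMap.pi_ext' fun e => LinearMap.ext_ring ?_⟩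
      have h3 := h f h1 h2 e e₀
      simp only [LinearMap.comp_apply, LinearMap.smul_apply, hS, LinearMap.single_apply]
      simp [← h3, f]
    · rintro ⟨c, rfl⟩
      refine LinearMap.ext fun v => ?_
      have : S (L v) = 0 := by
        rw [hS]
        simp only [L, LinearMap.coe_mk, AddHom.coe_mk, Finset.sum_sub_distrib]
        rw [Equiv.sum_comp e₁ v.1, Equiv.sum_comp e₂ v.2]; ring
      change c * S (L v) = 0
      rw [this, mul_zero]
  have h1 := LinearMap.finrank_range_add_finrank_ker L
  have h2 := LinearMap.finrank_range_add_finrank_ker L.dualMap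
  have hSne : S ≠ 0 := by
    intro h0
    have := hS (fun _ => 1)
    rw [h0] at this
    simp at this
    exact Fintype.card_ne_zero (by exact_mod_cast this.symm)
  rw [hdual, finrank_span_singleton hSne, LinearMap.finrank_range_dualMap_eq_finrank_range,
    Subspace.dual_finrank_eq, Module.finrank_fintype_fun_eq_card] at h2
  rw [hker, Module.finrank_prod, Module.finrank_fintype_fun_eq_card] at h1
  omega

end LinearAlgebra

/-! ### Slit covers and their Čech cocycles -/

/-- A cover of a surface by disjoint open `sheet`s, disjoint open `band`s (each crossing from one
sheet to another along a slit) and disjoint open `disc`s around the ends of the slits. -/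
structure SlitCover (X K E F : Type*) [TopologicalSpace X] where
  sheet : K → Set X
  band : E → Set X
  disc : F → Set X
  left : E → Set X
  right : E → Set X
  inner : E → Set X
  outer : E → Set X
  bandInner : E → Set X
  bandOuter : E → Set X
  permIn : Equiv.Perm E
  permOut : Equiv.Perm E
  isOpen_sheet : ∀ k, IsOpen (sheet k)
  isOpen_band : ∀ e, IsOpen (band e)
  isOpen_disc : ∀ y, IsOpen (disc y)
  isOpen_left : ∀ e, IsOpen (left e)
  isOpen_right : ∀ e, IsOpen (right e)
  isOpen_inner : ∀ e, IsOpen (inner e)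
  isOpen_outer : ∀ e, IsOpen (outer e)
  isOpen_bandInner : ∀ e, IsOpen (bandInner e)
  isOpen_bandOuter : ∀ e, IsOpen (bandOuter e)
  isPreconnected_left : ∀ e, IsPreconnected (left e)
  isPreconnected_right : ∀ e, IsPreconnected (right e)
  isPreconnected_inner : ∀ e, IsPreconnected (inner e)
  isPreconnected_outer : ∀ e, IsPreconnected (outer e)
  isPreconnected_bandInner : ∀ e, IsPreconnected (bandInner e)
  isPreconnected_bandOuter : ∀ e, IsPreconnected (bandOuter e)
  sheet_unique : ∀ {k k' x}, x ∈ sheet k → x ∈ sheet k' → k = k'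
  band_unique : ∀ {e e' x}, x ∈ band e → x ∈ band e' → e = e'
  disc_unique : ∀ {y y' x}, x ∈ disc y → x ∈ disc y' → y = y'
  inner_unique : ∀ {e e' x}, x ∈ inner e → x ∈ inner e' → e = e'
  outer_unique : ∀ {e e' x}, x ∈ outer e → x ∈ outer e' → e = e'
  left_right : ∀ {e x}, x ∈ left e → x ∉ right e
  inner_outer : ∀ {e e' x}, x ∈ inner e → x ∉ outer e'
  bandInner_bandOuter : ∀ {e x}, x ∈ bandInner e → x ∉ bandOuter e
  left_subset_band : ∀ e, left e ⊆ band e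
  right_subset_band : ∀ e, right e ⊆ band e
  left_subset_sheet : ∀ e, ∃ k, left e ⊆ sheet k
  right_subset_sheet : ∀ e, ∃ k, right e ⊆ sheet k
  band_inter_sheet : ∀ {e k x}, x ∈ band e → x ∈ sheet k → x ∈ left e ∨ x ∈ right e
  inner_subset_sheet : ∀ e, ∃ k, inner e ⊆ sheet k
  outer_subset_sheet : ∀ e, ∃ k, outer e ⊆ sheet k
  inner_subset_disc : ∀ e, ∃ y, inner e ⊆ disc y
  outer_subset_disc : ∀ e, ∃ y, outer e ⊆ disc y
  sheet_inter_disc : ∀ {k y x}, x ∈ sheet k → x ∈ disc y → ∃ e, x ∈ inner e ∨ x ∈ outer e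
  bandInner_subset_band : ∀ e, bandInner e ⊆ band e
  bandOuter_subset_band : ∀ e, bandOuter e ⊆ band e
  bandInner_subset_disc : ∀ e, ∃ y, bandInner e ⊆ disc y
  bandOuter_subset_disc : ∀ e, ∃ y, bandOuter e ⊆ disc y
  band_inter_disc : ∀ {e y x}, x ∈ band e → x ∈ disc y → x ∈ bandInner e ∨ x ∈ bandOuter e
  -- The index set of the bands also labels the pieces of sheets in the discs. Crossing the slit of
  -- `e` from left to right leads from the piece `e` to the piece `permIn e` near the lower end, and
  -- to `permOut e` near infinity.
  bandInner_left : ∀ e, bandInner e ∩ left e ⊆ inner e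
  bandInner_right : ∀ e, bandInner e ∩ right e ⊆ inner (permIn e)
  bandOuter_left : ∀ e, bandOuter e ∩ left e ⊆ outer e
  bandOuter_right : ∀ e, bandOuter e ∩ right e ⊆ outer (permOut e)
  bandInner_left_nonempty : ∀ e, (bandInner e ∩ left e).Nonempty
  bandInner_right_nonempty : ∀ e, (bandInner e ∩ right e).Nonempty
  bandOuter_left_nonempty : ∀ e, (bandOuter e ∩ left e).Nonempty
  bandOuter_right_nonempty : ∀ e, (bandOuter e ∩ right e).Nonempty
  exists_mem : ∀ x, (∃ k, x ∈ sheet k) ∨ (∃ e, x ∈ band e) ∨ ∃ y, x ∈ disc y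

theorem IsPreconnected.eq_of_eventually_eq {X Y : Type*} [TopologicalSpace X] {s : Set X}
    (hs : IsPreconnected s) {f : X → Y} (h : ∀ x ∈ s, ∀ᶠ y in 𝓝 x, f y = f x) {x y : X}
    (hx : x ∈ s) (hy : y ∈ s) : f x = f y := by
  have := isPreconnected_iff_preconnectedSpace.1 hs
  have hl : IsLocallyConstant (fun z : s => f z) :=
    (IsLocallyConstant.iff_eventually_eq _).2 fun z =>
      continuous_subtype_val.continuousAt.eventually (h z z.2)
  exact hl.apply_eq_of_preconnectedSpace ⟨x, hx⟩ ⟨y, hy⟩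

namespace SlitCover

variable {X K E F : Type*} [TopologicalSpace X] (T : SlitCover X K E F)

/-- The sheets, bands and discs as one family. -/
def cover : K ⊕ E ⊕ F → Set X := Sum.elim T.sheet (Sum.elim T.band T.disc)

open Classical in
/-- The preferred member of the cover at a point: a sheet, if possible, or else a band. -/
noncomputable def sel (x : X) : K ⊕ E ⊕ F :=
  if h : ∃ k, x ∈ T.sheet k then .inl h.choose
  else if h' : ∃ e, x ∈ T.band e then .inr (.inl h'.choose)
  else .inr (.inr (((T.exists_mem x).resolve_left h).resolve_left h').choose)

theorem sel_sheet {k : K} {x : X} (h : x ∈ T.sheet k) : T.sel x = .inl k := by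
  have h' : ∃ k, x ∈ T.sheet k := ⟨k, h⟩
  rw [sel, dif_pos h', T.sheet_unique h'.choose_spec h]

theorem sel_band {e : E} {x : X} (h : x ∈ T.band e) (hx : ∀ k, x ∉ T.sheet k) :
    T.sel x = .inr (.inl e) := by
  have h' : ∃ e, x ∈ T.band e := ⟨e, h⟩
  rw [sel, dif_neg (by simpa using hx), dif_pos h', T.band_unique h'.choose_spec h]

theorem sel_disc {y : F} {x : X} (h : x ∈ T.disc y) (hx : ∀ k, x ∉ T.sheet k)
    (hx' : ∀ e, x ∉ T.band e) : T.sel x = .inr (.inr y) := by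
  have h1 : ¬ ∃ k, x ∈ T.sheet k := by simpa using hx
  have h2 : ¬ ∃ e, x ∈ T.band e := by simpa using hx'
  rw [sel, dif_neg h1, dif_neg h2, T.disc_unique
    (((T.exists_mem x).resolve_left h1).resolve_left h2).choose_spec h]

theorem isOpen_cover (i : K ⊕ E ⊕ F) : IsOpen (T.cover i) := by
  rcases i with k | e | y
  exacts [T.isOpen_sheet k, T.isOpen_band e, T.isOpen_disc y]

theorem mem_cover_sel (x : X) : x ∈ T.cover (T.sel x) := by
  by_cases h : ∃ k, x ∈ T.sheet k
  · obtain ⟨k, hk⟩ := h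
    rw [T.sel_sheet hk]; exact hk
  · by_cases h' : ∃ e, x ∈ T.band e
    · obtain ⟨e, he⟩ := h'
      rw [T.sel_band he (by simpa using h)]; exact he
    · obtain ⟨y, hy⟩ := ((T.exists_mem x).resolve_left h).resolve_left h'
      rw [T.sel_disc hy (by simpa using h) (by simpa using h')]; exact hy

section Determined

variable {T} {u : K ⊕ E ⊕ F → X → ℚ} (hu : u ∈ cechCocycles T.cover T.sel)
include hu

/-- As `sel` prefers sheets, the normalisation kills the sheet components. The other components are
therefore locally constant wherever they meet a sheet. -/
theorem cocycle_sheet (k : K) (x : X) : u (.inl k) x = 0 := by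
  by_cases h : x ∈ T.sheet k
  · rw [← T.sel_sheet h]; exact hu.2.2 x
  · exact hu.2.1 _ x h

theorem cocycle_const_of_subset_sheet {s : Set X} (hs : IsPreconnected s) {k : K}
    (hk : s ⊆ T.sheet k) {i : K ⊕ E ⊕ F} (hi : s ⊆ T.cover i) {x y : X} (hx : x ∈ s)
    (hy : y ∈ s) : u i x = u i y := by
  refine hs.eq_of_eventually_eq (fun z hz => ?_) hx hy
  filter_upwards [hu.1 i (.inl k) z ⟨hi hz, hk hz⟩] with y hy
  simpa [cocycle_sheet hu] using hy

theorem cocycle_band_sub_disc {s : Set X} (hs : IsPreconnected s) {e : E} {y : F}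
    (he : s ⊆ T.band e) (hy : s ⊆ T.disc y) {x x' : X} (hx : x ∈ s) (hx' : x' ∈ s) :
    u (.inr (.inl e)) x - u (.inr (.inr y)) x = u (.inr (.inl e)) x' - u (.inr (.inr y)) x' :=
  hs.eq_of_eventually_eq (f := fun x => u (.inr (.inl e)) x - u (.inr (.inr y)) x)
    (fun z hz => hu.1 _ _ z ⟨he hz, hy hz⟩) hx hx'

end Determined

theorem inner_nonempty (e : E) : (T.inner e).Nonempty :=
  (T.bandInner_left_nonempty e).mono (T.bandInner_left e)

theorem outer_nonempty (e : E) : (T.outer e).Nonempty :=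
  (T.bandOuter_left_nonempty e).mono (T.bandOuter_left e)

theorem left_nonempty (e : E) : (T.left e).Nonempty :=
  (T.bandInner_left_nonempty e).mono Set.inter_subset_right

/-- The value of a cocycle on the left half of a band. -/
noncomputable def leftValue (u : K ⊕ E ⊕ F → X → ℚ) (e : E) : ℚ :=
  u (.inr (.inl e)) (T.left_nonempty e).some

/-- The value of a cocycle on the part of a sheet in the disc at the lower end of a slit. -/
noncomputable def innerValue (u : K ⊕ E ⊕ F → X → ℚ) (e : E) : ℚ :=
  u (.inr (.inr (T.inner_subset_disc e).choose)) (T.inner_nonempty e).some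

/-- The value of a cocycle on the part of a sheet in a disc at infinity. -/
noncomputable def outerValue (u : K ⊕ E ⊕ F → X → ℚ) (e : E) : ℚ :=
  u (.inr (.inr (T.outer_subset_disc e).choose)) (T.outer_nonempty e).some

section Values

variable {T} {u : K ⊕ E ⊕ F → X → ℚ} (hu : u ∈ cechCocycles T.cover T.sel)
include hu

theorem cocycle_left {e : E} {x : X} (hx : x ∈ T.left e) :
    u (.inr (.inl e)) x = T.leftValue u e := by
  obtain ⟨k, hk⟩ := T.left_subset_sheet e
  exact cocycle_const_of_subset_sheet hu (T.isPreconnected_left e) hk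
    (i := .inr (.inl e)) (T.left_subset_band e) hx
    (T.left_nonempty e).some_mem

theorem cocycle_inner {e : E} {x : X} (hx : x ∈ T.inner e) {y : F} (hy : x ∈ T.disc y) :
    u (.inr (.inr y)) x = T.innerValue u e := by
  obtain ⟨k, hk⟩ := T.inner_subset_sheet e
  have h := (T.inner_subset_disc e).choose_spec
  rw [T.disc_unique hy (h hx)]
  exact cocycle_const_of_subset_sheet hu (T.isPreconnected_inner e) hk
    (i := .inr (.inr _)) h hx
    (T.inner_nonempty e).some_mem

theorem cocycle_outer {e : E} {x : X} (hx : x ∈ T.outer e) {y : F} (hy : x ∈ T.disc y) :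
    u (.inr (.inr y)) x = T.outerValue u e := by
  obtain ⟨k, hk⟩ := T.outer_subset_sheet e
  have h := (T.outer_subset_disc e).choose_spec
  rw [T.disc_unique hy (h hx)]
  exact cocycle_const_of_subset_sheet hu (T.isPreconnected_outer e) hk
    (i := .inr (.inr _)) h hx
    (T.outer_nonempty e).some_mem

theorem cocycle_bandInner {e : E} {x : X} (hx : x ∈ T.bandInner e) {y : F} (hy : x ∈ T.disc y) :
    u (.inr (.inl e)) x - u (.inr (.inr y)) x = T.leftValue u e - T.innerValue u e := by
  obtain ⟨z, hz⟩ := T.bandInner_subset_disc e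
  obtain ⟨x', hx', hl⟩ := T.bandInner_left_nonempty e
  rw [T.disc_unique hy (hz hx), cocycle_band_sub_disc hu (T.isPreconnected_bandInner e)
    (T.bandInner_subset_band e) hz hx hx', cocycle_left hu hl,
    cocycle_inner hu (T.bandInner_left e ⟨hx', hl⟩) (hz hx')]

theorem cocycle_bandOuter {e : E} {x : X} (hx : x ∈ T.bandOuter e) {y : F} (hy : x ∈ T.disc y) :
    u (.inr (.inl e)) x - u (.inr (.inr y)) x = T.leftValue u e - T.outerValue u e := by
  obtain ⟨z, hz⟩ := T.bandOuter_subset_disc e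
  obtain ⟨x', hx', hl⟩ := T.bandOuter_left_nonempty e
  rw [T.disc_unique hy (hz hx), cocycle_band_sub_disc hu (T.isPreconnected_bandOuter e)
    (T.bandOuter_subset_band e) hz hx hx', cocycle_left hu hl,
    cocycle_outer hu (T.bandOuter_left e ⟨hx', hl⟩) (hz hx')]

/-- The right half of a band is reached from the left half through the disc at the lower end: the
difference of the band and disc components is constant on `bandInner e`, whose right part lies in
the piece `permIn e`. -/
theorem cocycle_right {e : E} {x : X} (hx : x ∈ T.right e) :
    u (.inr (.inl e)) x =
      T.leftValue u e - T.innerValue u e + T.innerValue u (T.permIn e) := by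
  obtain ⟨k, hk⟩ := T.right_subset_sheet e
  obtain ⟨x', hx', hr⟩ := T.bandInner_right_nonempty e
  obtain ⟨z, hz⟩ := T.bandInner_subset_disc e
  rw [cocycle_const_of_subset_sheet hu (T.isPreconnected_right e) hk
    (i := .inr (.inl e)) (T.right_subset_band e) hx hr,
    ← cocycle_bandInner hu hx' (hz hx'),
    ← cocycle_inner hu (T.bandInner_right e ⟨hx', hr⟩) (hz hx')]
  ring

/-- The right half can also be reached through a disc at infinity. That both ways give the same
value is the relation between the increments. -/
theorem values_mem : (T.innerValue u, T.outerValue u) ∈ equalIncrements T.permIn T.permOut := by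
  intro e
  obtain ⟨x', hx', hr⟩ := T.bandOuter_right_nonempty e
  obtain ⟨z, hz⟩ := T.bandOuter_subset_disc e
  have h1 := cocycle_bandOuter hu hx' (hz hx')
  rw [cocycle_right hu hr, cocycle_outer hu (T.bandOuter_right e ⟨hx', hr⟩) (hz hx')] at h1
  simp only
  linarith

/-- On the sheets all components are expressed by the three families of values. Off the sheets the
band component is normalised to zero, which determines the disc component on a band; off the bands
too, the disc component is normalised to zero. -/
theorem cocycle_eq_zero (h1 : T.leftValue u = 0) (h2 : T.innerValue u = 0)
    (h3 : T.outerValue u = 0) : u = 0 := by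
  have hb : ∀ e x, u (.inr (.inl e)) x = 0 := by
    intro e x
    by_cases hx : x ∈ T.band e
    · by_cases hs : ∃ k, x ∈ T.sheet k
      · obtain ⟨k, hk⟩ := hs
        rcases T.band_inter_sheet hx hk with h | h
        · rw [cocycle_left hu h, h1]; rfl
        · rw [cocycle_right hu h, h1, h2]; simp
      · rw [← T.sel_band hx (by simpa using hs)]; exact hu.2.2 x
    · exact hu.2.1 _ x hx
  ext i x
  rcases i with k | e | y
  · exact cocycle_sheet hu k x
  · exact hb e x
  · by_cases hx : x ∈ T.disc y
    · by_cases hs : ∃ k, x ∈ T.sheet k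
      · obtain ⟨k, hk⟩ := hs
        obtain ⟨e, h | h⟩ := T.sheet_inter_disc hk hx
        · rw [cocycle_inner hu h hx, h2]; rfl
        · rw [cocycle_outer hu h hx, h3]; rfl
      · by_cases hb' : ∃ e, x ∈ T.band e
        · obtain ⟨e, he⟩ := hb'
          rcases T.band_inter_disc he hx with h | h
          · have := cocycle_bandInner hu h hx
            rw [hb, h1, h2] at this
            simpa using this
          · have := cocycle_bandOuter hu h hx
            rw [hb, h1, h3] at this
            simpa using this
        · rw [← T.sel_disc hx (by simpa using hs) (by simpa using hb')]; exact hu.2.2 x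
    · exact hu.2.1 _ x hx

end Values

/-! ### Construction of a cocycle with prescribed values -/

section Realisation

variable (a b w : E → ℚ)

open Classical in
/-- The function on the bands of the cocycle with given values. -/
noncomputable def bandFunction (e : E) (x : X) : ℚ :=
  if x ∈ T.left e then a e else if x ∈ T.right e then a e - b e + b (T.permIn e) else 0

open Classical in
/-- The function on the discs of the cocycle with given values. -/
noncomputable def discFunction (x : X) : ℚ :=
  if h : ∃ e, x ∈ T.inner e then b h.choose
  else if h : ∃ e, x ∈ T.outer e then w h.choose
  -- Only points on the slits are left here. The band component vanishes there, so the constant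
  -- difference `a - b` or `a - w` of band and disc dictates the value. What remains beyond is
  -- normalised to zero.
  else if h : ∃ e, x ∈ T.bandInner e then b h.choose - a h.choose
  else if h : ∃ e, x ∈ T.bandOuter e then w h.choose - a h.choose
  else 0

open Classical in
/-- The cocycle with given values. -/
noncomputable def cocycleOfValues (i : K ⊕ E ⊕ F) (x : X) : ℚ :=
  if x ∈ T.cover i then
    Sum.elim (fun _ => 0) (Sum.elim (fun e => T.bandFunction a b e x)
      (fun _ => T.discFunction a b w x)) i
  else 0

variable {a b w}

theorem discFunction_inner {e : E} {x : X} (h : x ∈ T.inner e) : T.discFunction a b w x = b e := by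
  have h' : ∃ e, x ∈ T.inner e := ⟨e, h⟩
  rw [discFunction, dif_pos h', T.inner_unique h'.choose_spec h]

theorem discFunction_outer {e : E} {x : X} (h : x ∈ T.outer e) : T.discFunction a b w x = w e := by
  have h1 : ¬ ∃ e, x ∈ T.inner e := fun ⟨e', he'⟩ => T.inner_outer he' h
  have h' : ∃ e, x ∈ T.outer e := ⟨e, h⟩
  rw [discFunction, dif_neg h1, dif_pos h', T.outer_unique h'.choose_spec h]

theorem discFunction_bandInner {e : E} {x : X} (h : x ∈ T.bandInner e)
    (hx : ∀ k, x ∉ T.sheet k) : T.discFunction a b w x = b e - a e := by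
  have h1 : ¬ ∃ e, x ∈ T.inner e := fun ⟨e', he'⟩ =>
    hx _ ((T.inner_subset_sheet e').choose_spec he')
  have h2 : ¬ ∃ e, x ∈ T.outer e := fun ⟨e', he'⟩ =>
    hx _ ((T.outer_subset_sheet e').choose_spec he')
  have h' : ∃ e, x ∈ T.bandInner e := ⟨e, h⟩
  rw [discFunction, dif_neg h1, dif_neg h2, dif_pos h', T.band_unique
    (T.bandInner_subset_band _ h'.choose_spec) (T.bandInner_subset_band _ h)]

theorem discFunction_bandOuter {e : E} {x : X} (h : x ∈ T.bandOuter e)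
    (hx : ∀ k, x ∉ T.sheet k) : T.discFunction a b w x = w e - a e := by
  have h1 : ¬ ∃ e, x ∈ T.inner e := fun ⟨e', he'⟩ =>
    hx _ ((T.inner_subset_sheet e').choose_spec he')
  have h2 : ¬ ∃ e, x ∈ T.outer e := fun ⟨e', he'⟩ =>
    hx _ ((T.outer_subset_sheet e').choose_spec he')
  have h3 : ¬ ∃ e, x ∈ T.bandInner e := fun ⟨e', he'⟩ => by
    obtain rfl := T.band_unique (T.bandInner_subset_band _ he') (T.bandOuter_subset_band _ h)
    exact T.bandInner_bandOuter he' h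
  have h' : ∃ e, x ∈ T.bandOuter e := ⟨e, h⟩
  rw [discFunction, dif_neg h1, dif_neg h2, dif_neg h3, dif_pos h', T.band_unique
    (T.bandOuter_subset_band _ h'.choose_spec) (T.bandOuter_subset_band _ h)]

theorem discFunction_of_notMem {x : X} (hx : ∀ k, x ∉ T.sheet k) (hx' : ∀ e, x ∉ T.band e) :
    T.discFunction a b w x = 0 := by
  have h1 : ¬ ∃ e, x ∈ T.inner e := fun ⟨e', he'⟩ =>
    hx _ ((T.inner_subset_sheet e').choose_spec he')
  have h2 : ¬ ∃ e, x ∈ T.outer e := fun ⟨e', he'⟩ =>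
    hx _ ((T.outer_subset_sheet e').choose_spec he')
  have h3 : ¬ ∃ e, x ∈ T.bandInner e := fun ⟨e', he'⟩ => hx' _ (T.bandInner_subset_band _ he')
  have h4 : ¬ ∃ e, x ∈ T.bandOuter e := fun ⟨e', he'⟩ => hx' _ (T.bandOuter_subset_band _ he')
  rw [discFunction, dif_neg h1, dif_neg h2, dif_neg h3, dif_neg h4]

theorem bandFunction_left {e : E} {x : X} (h : x ∈ T.left e) : T.bandFunction a b e x = a e :=
  if_pos h

theorem bandFunction_right {e : E} {x : X} (h : x ∈ T.right e) :
    T.bandFunction a b e x = a e - b e + b (T.permIn e) := by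
  rw [bandFunction, if_neg (fun h' => T.left_right h' h), if_pos h]

theorem bandFunction_of_notMem {e : E} {x : X} (hx : ∀ k, x ∉ T.sheet k) :
    T.bandFunction a b e x = 0 := by
  rw [bandFunction, if_neg fun h => hx _ ((T.left_subset_sheet e).choose_spec h),
    if_neg fun h => hx _ ((T.right_subset_sheet e).choose_spec h)]

theorem band_sub_disc_inner {e : E} {x : X} (h : x ∈ T.bandInner e) :
    T.bandFunction a b e x - T.discFunction a b w x = a e - b e := by
  by_cases hs : ∃ k, x ∈ T.sheet k
  · obtain ⟨k, hk⟩ := hs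
    rcases T.band_inter_sheet (T.bandInner_subset_band e h) hk with h' | h'
    · rw [T.bandFunction_left h', T.discFunction_inner (T.bandInner_left e ⟨h, h'⟩)]
    · rw [T.bandFunction_right h', T.discFunction_inner (T.bandInner_right e ⟨h, h'⟩)]; ring
  · have hs' : ∀ k, x ∉ T.sheet k := by simpa using hs
    rw [T.bandFunction_of_notMem hs', T.discFunction_bandInner h hs']; ring

/-- On the right half of the band this is exactly the relation between the increments; elsewhere it
holds by construction. -/
theorem band_sub_disc_outer (hbw : (b, w) ∈ equalIncrements T.permIn T.permOut)
    {e : E} {x : X} (h : x ∈ T.bandOuter e) :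
    T.bandFunction a b e x - T.discFunction a b w x = a e - w e := by
  by_cases hs : ∃ k, x ∈ T.sheet k
  · obtain ⟨k, hk⟩ := hs
    rcases T.band_inter_sheet (T.bandOuter_subset_band e h) hk with h' | h'
    · rw [T.bandFunction_left h', T.discFunction_outer (T.bandOuter_left e ⟨h, h'⟩)]
    · rw [T.bandFunction_right h', T.discFunction_outer (T.bandOuter_right e ⟨h, h'⟩)]
      have := hbw e
      simp only at this
      linarith
  · have hs' : ∀ k, x ∉ T.sheet k := by simpa using hs
    rw [T.bandFunction_of_notMem hs', T.discFunction_bandOuter h hs']; ring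

theorem cocycleOfValues_band {e : E} {x : X} (h : x ∈ T.band e) :
    T.cocycleOfValues a b w (.inr (.inl e)) x = T.bandFunction a b e x := by
  simp [cocycleOfValues, cover, h]

theorem cocycleOfValues_disc {y : F} {x : X} (h : x ∈ T.disc y) :
    T.cocycleOfValues a b w (.inr (.inr y)) x = T.discFunction a b w x := by
  simp [cocycleOfValues, cover, h]

theorem cocycleOfValues_sheet {k : K} {x : X} :
    T.cocycleOfValues a b w (.inl k) x = 0 := by
  simp [cocycleOfValues]

theorem cocycleOfValues_mem (hbw : (b, w) ∈ equalIncrements T.permIn T.permOut) :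
    T.cocycleOfValues a b w ∈ cechCocycles T.cover T.sel := by
  have hSV : ∀ k e, ∀ x, x ∈ T.sheet k → x ∈ T.band e → ∀ᶠ y in 𝓝 x,
      T.cocycleOfValues a b w (.inr (.inl e)) y = T.cocycleOfValues a b w (.inr (.inl e)) x := by
    intro k e x hk he
    rw [T.cocycleOfValues_band he]
    rcases T.band_inter_sheet he hk with h | h
    · filter_upwards [(T.isOpen_left e).mem_nhds h] with y hy
      rw [T.cocycleOfValues_band (T.left_subset_band e hy), T.bandFunction_left h,
        T.bandFunction_left hy]
    · filter_upwards [(T.isOpen_right e).mem_nhds h] with y hy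
      rw [T.cocycleOfValues_band (T.right_subset_band e hy), T.bandFunction_right h,
        T.bandFunction_right hy]
  have hSD : ∀ k z, ∀ x, x ∈ T.sheet k → x ∈ T.disc z → ∀ᶠ y in 𝓝 x,
      T.cocycleOfValues a b w (.inr (.inr z)) y = T.cocycleOfValues a b w (.inr (.inr z)) x := by
    intro k z x hk hz
    rw [T.cocycleOfValues_disc hz]
    obtain ⟨e, h | h⟩ := T.sheet_inter_disc hk hz
    · filter_upwards [(T.isOpen_inner e).mem_nhds h, (T.isOpen_disc z).mem_nhds hz] with y hy hy'
      rw [T.cocycleOfValues_disc hy', T.discFunction_inner h, T.discFunction_inner hy]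
    · filter_upwards [(T.isOpen_outer e).mem_nhds h, (T.isOpen_disc z).mem_nhds hz] with y hy hy'
      rw [T.cocycleOfValues_disc hy', T.discFunction_outer h, T.discFunction_outer hy]
  have hVD : ∀ e z, ∀ x, x ∈ T.band e → x ∈ T.disc z → ∀ᶠ y in 𝓝 x,
      T.cocycleOfValues a b w (.inr (.inl e)) y - T.cocycleOfValues a b w (.inr (.inr z)) y =
      T.cocycleOfValues a b w (.inr (.inl e)) x - T.cocycleOfValues a b w (.inr (.inr z)) x := by
    intro e z x he hz
    rw [T.cocycleOfValues_disc hz, T.cocycleOfValues_band he]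
    rcases T.band_inter_disc he hz with h | h
    · filter_upwards [(T.isOpen_bandInner e).mem_nhds h, (T.isOpen_disc z).mem_nhds hz] with y hy hy'
      rw [T.cocycleOfValues_disc hy', T.cocycleOfValues_band (T.bandInner_subset_band e hy),
        T.band_sub_disc_inner h, T.band_sub_disc_inner hy]
    · filter_upwards [(T.isOpen_bandOuter e).mem_nhds h, (T.isOpen_disc z).mem_nhds hz] with y hy hy'
      rw [T.cocycleOfValues_disc hy', T.cocycleOfValues_band (T.bandOuter_subset_band e hy),
        T.band_sub_disc_outer hbw h, T.band_sub_disc_outer hbw hy]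
  refine ⟨fun i j x hx => ?_, fun i x hx => if_neg hx, fun x => ?_⟩
  · rcases i with k | e | z <;> rcases j with k' | e' | z'
    · simp [cocycleOfValues_sheet]
    · simpa [cocycleOfValues_sheet] using hSV k e' x hx.1 hx.2
    · simpa [cocycleOfValues_sheet] using hSD k z' x hx.1 hx.2
    · simpa [cocycleOfValues_sheet] using hSV k' e x hx.2 hx.1
    · obtain rfl := T.band_unique hx.1 hx.2
      simp
    · exact hVD e z' x hx.1 hx.2
    · simpa [cocycleOfValues_sheet] using hSD k' z x hx.2 hx.1
    · filter_upwards [hVD e' z x hx.2 hx.1] with y hy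
      linarith
    · obtain rfl := T.disc_unique hx.1 hx.2
      simp
  · by_cases hs : ∃ k, x ∈ T.sheet k
    · obtain ⟨k, hk⟩ := hs
      rw [T.sel_sheet hk, T.cocycleOfValues_sheet]
    · have hs' : ∀ k, x ∉ T.sheet k := by simpa using hs
      by_cases hb : ∃ e, x ∈ T.band e
      · obtain ⟨e, he⟩ := hb
        rw [T.sel_band he hs', T.cocycleOfValues_band he, T.bandFunction_of_notMem hs']
      · have hb' : ∀ e, x ∉ T.band e := by simpa using hb
        obtain ⟨y, hy⟩ := ((T.exists_mem x).resolve_left hs).resolve_left hb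
        rw [T.sel_disc hy hs' hb', T.cocycleOfValues_disc hy, T.discFunction_of_notMem hs' hb']

theorem leftValue_cocycleOfValues : T.leftValue (T.cocycleOfValues a b w) = a := by
  ext e
  have h := (T.left_nonempty e).some_mem
  rw [leftValue, T.cocycleOfValues_band (T.left_subset_band e h), T.bandFunction_left h]

theorem innerValue_cocycleOfValues : T.innerValue (T.cocycleOfValues a b w) = b := by
  ext e
  have h := (T.inner_nonempty e).some_mem
  rw [innerValue, T.cocycleOfValues_disc ((T.inner_subset_disc e).choose_spec h),
    T.discFunction_inner h]

theorem outerValue_cocycleOfValues : T.outerValue (T.cocycleOfValues a b w) = w := by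
  ext e
  have h := (T.outer_nonempty e).some_mem
  rw [outerValue, T.cocycleOfValues_disc ((T.outer_subset_disc e).choose_spec h),
    T.discFunction_outer h]

end Realisation

/-- Čech cocycles of a slit cover correspond to their values on the pieces. -/
noncomputable def cocycleEquiv : cechCocycles T.cover T.sel ≃ₗ[ℚ]
    (E → ℚ) × equalIncrements T.permIn T.permOut :=
  LinearEquiv.ofBijective
    { toFun := fun u => (T.leftValue u.1, ⟨(T.innerValue u.1, T.outerValue u.1), values_mem u.2⟩)
      map_add' := fun _ _ => rfl
      map_smul' := fun _ _ => rfl } <| by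
    constructor
    · rw [← LinearMap.ker_eq_bot, LinearMap.ker_eq_bot']
      intro u hu
      have h1 := congrArg Prod.fst hu
      have h2 := congrArg (fun v => v.2.1.1) hu
      have h3 := congrArg (fun v => v.2.1.2) hu
      exact Subtype.ext (cocycle_eq_zero u.2 h1 h2 h3)
    · rintro ⟨a, ⟨⟨b, w⟩, h⟩⟩
      refine ⟨⟨T.cocycleOfValues a b w, T.cocycleOfValues_mem h⟩, ?_⟩
      exact Prod.ext T.leftValue_cocycleOfValues (Subtype.ext (Prod.ext
        T.innerValue_cocycleOfValues T.outerValue_cocycleOfValues))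

/-- The first Betti number of a space with a slit cover. -/
theorem rank_homology [Fintype K] [Fintype E] [Fintype F] [Nonempty E] [ConnectedSpace X]
    [PathConnectedSpace X] [LocallyPathConnectedSpace X]
    (hs : ∀ k, IsSimplyConnected (T.sheet k)) (hb : ∀ e, IsSimplyConnected (T.band e))
    (hd : ∀ y, IsSimplyConnected (T.disc y))
    (h : ∀ f : E → ℚ, (∀ e, f (T.permIn e) = f e) → (∀ e, f (T.permOut e) = f e) →
      ∀ e e', f e = f e') (x : X) :
    ∃ r : ℕ, Module.rank ℤ (FirstHomology X x) = r ∧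
      r + Fintype.card K + Fintype.card F = Fintype.card E + 2 := by
  have h0 : FiniteDimensional ℚ (cechCocycles T.cover T.sel) :=
    Module.Finite.equiv T.cocycleEquiv.symm
  have hsc : ∀ i, IsSimplyConnected (T.cover i) := by
    rintro (k | e | y)
    exacts [hs k, hb e, hd y]
  obtain ⟨h1, h2⟩ := finrank_homology_hom T.isOpen_cover T.mem_cover_sel hsc x
  refine ⟨_, rank_int_eq_of_finrank_hom, ?_⟩
  -- The cocycles have dimension `|E| + (|E| + 1)`, and the coboundaries `|K| + |E| + |F| - 1`.
  rw [T.cocycleEquiv.finrank_eq, Module.finrank_prod, finrank_equalIncrements _ _ h,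
    Module.finrank_fintype_fun_eq_card, Fintype.card_sum, Fintype.card_sum] at h2
  omega

end SlitCover

/-! ### Plane geometry of slits, bands, discs and gaps -/

theorem Convex.isSimplyConnected {E : Type*} [AddCommGroup E] [Module ℝ E] [TopologicalSpace E]
    [ContinuousAdd E] [ContinuousSMul ℝ E] {s : Set E} (hs : Convex ℝ s) (hne : s.Nonempty) :
    IsSimplyConnected s := by
  have := hs.contractibleSpace hne
  exact SimplyConnectedSpace.ofContractible s

theorem StarConvex.isSimplyConnected {E : Type*} [AddCommGroup E] [Module ℝ E]
    [TopologicalSpace E] [ContinuousAdd E] [ContinuousSMul ℝ E] {s : Set E} {x : E}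
    (hs : StarConvex ℝ x s) (hne : s.Nonempty) : IsSimplyConnected s := by
  have := hs.contractibleSpace hne
  exact SimplyConnectedSpace.ofContractible s

/-- The plane cut along the upward vertical rays starting at the points `q i`. -/
def upSlitPlane {N : ℕ} (q : Fin N → ℂ) : Set ℂ := {z | ∀ i, z.re = (q i).re → z.im < (q i).im}

/-- The open vertical band of half-width `ε` above the point `a`. -/
def upBand (a : ℂ) (ε : ℝ) : Set ℂ := {z | |z.re - a.re| < ε ∧ a.im < z.im}

/-- The left half of a vertical band. -/
def upBandLeft (a : ℂ) (ε : ℝ) : Set ℂ := {z | a.re - ε < z.re ∧ z.re < a.re ∧ a.im < z.im}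

/-- The right half of a vertical band. -/
def upBandRight (a : ℂ) (ε : ℝ) : Set ℂ := {z | a.re < z.re ∧ z.re < a.re + ε ∧ a.im < z.im}

/-- The complement of the closed square of radius `R`. -/
def outsideSquare (R : ℝ) : Set ℂ := {z | R < |z.re| ∨ R < |z.im|}

/-- The components of the slit plane outside a large square: `slitGap q R i` lies to the left of
the `i`-th slit, and `slitGap q R 0` also lies to the right of the last slit. -/
def slitGap {N : ℕ} [NeZero N] (q : Fin N → ℂ) (R : ℝ) (i : Fin N) : Set ℂ :=
  if i = 0 then {z | z.im < -R} ∪ {z | z.re < -R} ∪ {z | R < z.re} ∪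
    {z | R < z.im ∧ z.re < (q 0).re} ∪ {z | R < z.im ∧ (q (0 - 1)).re < z.re}
  else {z | R < z.im ∧ (q (i - 1)).re < z.re ∧ z.re < (q i).re}

/-- The width `ε` is small and the radius `R` is large compared to the points `q i`, which are
ordered from left to right. -/
structure SlitParams {N : ℕ} (q : Fin N → ℂ) (ε R : ℝ) : Prop where
  pos : 0 < ε
  strictMono : StrictMono fun i => (q i).re
  sep : ∀ i j, i ≠ j → 2 * ε ≤ |(q i).re - (q j).re|
  re_lt : ∀ i, |(q i).re| + ε < R
  im_lt : ∀ i, |(q i).im| + ε < R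

theorem exists_slitParams {N : ℕ} (q : Fin N → ℂ) (hq : StrictMono fun i => (q i).re)
    {ε₀ R₀ : ℝ} (hε : 0 < ε₀) : ∃ ε R, ε ≤ ε₀ ∧ R₀ ≤ R ∧ SlitParams q ε R := by
  have h1 : ∃ ε > 0, ε ≤ ε₀ ∧ ∀ i j, i ≠ j → 2 * ε ≤ |(q i).re - (q j).re| := by
    have : ∀ p : Fin N × Fin N, ∀ᶠ ε in 𝓝[>] (0 : ℝ),
        p.1 ≠ p.2 → 2 * ε ≤ |(q p.1).re - (q p.2).re| := by
      rintro ⟨i, j⟩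
      by_cases hij : i = j
      · simp [hij]
      · have hpos : 0 < |(q i).re - (q j).re| := abs_pos.2 (sub_ne_zero.2 (hq.injective.ne hij))
        have := Ioo_mem_nhdsGT (half_pos hpos)
        filter_upwards [this] with ε hε _
        linarith [hε.2]
    have h2 := (Filter.eventually_all.2 this).and (Ioo_mem_nhdsGT hε)
    obtain ⟨ε, h, h'⟩ := h2.exists
    exact ⟨ε, h'.1, h'.2.le, fun i j hij => h (i, j) hij⟩
  obtain ⟨ε, hpos, hle, hsep⟩ := h1
  have h2 : ∃ R, R₀ ≤ R ∧ ∀ i, |(q i).re| + ε < R ∧ |(q i).im| + ε < R := by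
    have : ∀ i, ∀ᶠ R in Filter.atTop, |(q i).re| + ε < R ∧ |(q i).im| + ε < R := fun i =>
      (Filter.eventually_gt_atTop _).and (Filter.eventually_gt_atTop _)
    exact ((Filter.eventually_ge_atTop R₀).and (Filter.eventually_all.2 this)).exists
  obtain ⟨R, hR, h⟩ := h2
  exact ⟨ε, R, hle, hR, hpos, hq, hsep, fun i => (h i).1, fun i => (h i).2⟩

section Geometry

variable {N : ℕ} {q : Fin N → ℂ} {ε R : ℝ}

theorem isOpen_upSlitPlane (q : Fin N → ℂ) : IsOpen (upSlitPlane q) := by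
  have : upSlitPlane q = ⋂ i, ({z | z.re = (q i).re} ∩ {z | (q i).im ≤ z.im})ᶜ := by
    ext z
    simp [upSlitPlane]
  rw [this]
  refine isOpen_iInter_of_finite fun i => IsClosed.isOpen_compl (self := ?_)
  exact (isClosed_eq Complex.continuous_re continuous_const).inter
    (isClosed_le continuous_const Complex.continuous_im)

/-- The slits point upwards, so the slit plane can be pushed vertically below a level `M` lying
under all the `q i`, and the half-plane below `M` contracts linearly to a point. -/
theorem isSimplyConnected_upSlitPlane (q : Fin N → ℂ) : IsSimplyConnected (upSlitPlane q) := by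
  obtain ⟨M, hM⟩ : ∃ M : ℝ, ∀ i, M < (q i).im := by
    obtain ⟨M, hM⟩ := (Set.finite_range fun i => (q i).im).bddBelow
    exact ⟨M - 1, fun i => by linarith [hM ⟨i, rfl⟩]⟩
  have hlow : ∀ z : ℂ, z.im ≤ M → z ∈ upSlitPlane q := fun z hz i _ => hz.trans_lt (hM i)
  have hdown : ∀ z ∈ upSlitPlane q, ∀ y ≤ z.im, (⟨z.re, y⟩ : ℂ) ∈ upSlitPlane q :=
    fun z hz y hy i hi => lt_of_le_of_lt hy (hz i hi)
  let c : upSlitPlane q := ⟨⟨0, M⟩, hlow _ le_rfl⟩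
  have hmk : Continuous fun p : ℝ × ℝ => (⟨p.1, p.2⟩ : ℂ) :=
    Complex.equivRealProdCLM.symm.continuous
  let r : C(upSlitPlane q, upSlitPlane q) :=
    ⟨fun z => ⟨⟨z.1.re, min z.1.im M⟩, hlow _ (min_le_right _ _)⟩, by
      refine Continuous.subtype_mk (hmk.comp (f := fun z : upSlitPlane q =>
        (z.1.re, min z.1.im M)) ?_) _
      fun_prop⟩
  have h1 : (ContinuousMap.id (upSlitPlane q)).Homotopic r := by
    refine ⟨⟨⟨fun p => ⟨⟨p.2.1.re, (1 - p.1) * p.2.1.im + p.1 * min p.2.1.im M⟩, ?_⟩, ?_⟩, ?_, ?_⟩⟩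
    · refine hdown _ p.2.2 _ ?_
      nlinarith [min_le_left p.2.1.im M, p.1.2.1, p.1.2.2]
    · refine Continuous.subtype_mk (hmk.comp (f := fun p : I × upSlitPlane q =>
        (p.2.1.re, (1 - (p.1 : ℝ)) * p.2.1.im + p.1 * min p.2.1.im M)) ?_) _
      fun_prop
    · intro z; ext; simp
    · intro z; ext; simp [r]
  have h2 : r.Homotopic (ContinuousMap.const _ c) := by
    refine ⟨⟨⟨fun p => ⟨⟨(1 - p.1) * p.2.1.re, (1 - p.1) * min p.2.1.im M + p.1 * M⟩, ?_⟩, ?_⟩,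
      ?_, ?_⟩⟩
    · refine hlow _ ?_
      change (1 - (p.1 : ℝ)) * min p.2.1.im M + p.1 * M ≤ M
      nlinarith [min_le_right p.2.1.im M, p.1.2.1, p.1.2.2]
    · refine Continuous.subtype_mk (hmk.comp (f := fun p : I × upSlitPlane q =>
        ((1 - (p.1 : ℝ)) * p.2.1.re, (1 - (p.1 : ℝ)) * min p.2.1.im M + p.1 * M)) ?_) _
      fun_prop
    · intro z; ext; simp [r]
    · intro z; ext; simp [c]
  have : ContractibleSpace (upSlitPlane q) :=
    (contractible_iff_id_nullhomotopic _).2 ⟨c, h1.trans h2⟩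
  exact SimplyConnectedSpace.ofContractible _

theorem upBandLeft_eq (a : ℂ) (ε : ℝ) : upBandLeft a ε =
    ({z | a.re - ε < z.re} ∩ {z | z.re < a.re}) ∩ {z | a.im < z.im} := by
  ext z; simp [upBandLeft, and_assoc]

theorem upBandRight_eq (a : ℂ) (ε : ℝ) : upBandRight a ε =
    ({z | a.re < z.re} ∩ {z | z.re < a.re + ε}) ∩ {z | a.im < z.im} := by
  ext z; simp [upBandRight, and_assoc]

theorem upBand_eq (a : ℂ) (ε : ℝ) : upBand a ε =
    ({z | a.re - ε < z.re} ∩ {z | z.re < a.re + ε}) ∩ {z | a.im < z.im} := by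
  ext z
  simp only [upBand, abs_lt, Set.mem_inter_iff, Set.mem_ofPred_eq]
  constructor <;> rintro ⟨⟨h1, h2⟩, h3⟩ <;> exact ⟨⟨by linarith, by linarith⟩, h3⟩

theorem isOpen_re_lt (c : ℝ) : IsOpen {z : ℂ | z.re < c} :=
  isOpen_lt Complex.continuous_re continuous_const
theorem isOpen_lt_re (c : ℝ) : IsOpen {z : ℂ | c < z.re} :=
  isOpen_lt continuous_const Complex.continuous_re
theorem isOpen_im_lt (c : ℝ) : IsOpen {z : ℂ | z.im < c} :=
  isOpen_lt Complex.continuous_im continuous_const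
theorem isOpen_lt_im (c : ℝ) : IsOpen {z : ℂ | c < z.im} :=
  isOpen_lt continuous_const Complex.continuous_im

theorem isOpen_upBand (a : ℂ) (ε : ℝ) : IsOpen (upBand a ε) := by
  rw [upBand_eq]
  exact ((isOpen_lt_re _).inter (isOpen_re_lt _)).inter (isOpen_lt_im _)

theorem isOpen_upBandLeft (a : ℂ) (ε : ℝ) : IsOpen (upBandLeft a ε) := by
  rw [upBandLeft_eq]
  exact ((isOpen_lt_re _).inter (isOpen_re_lt _)).inter (isOpen_lt_im _)

theorem isOpen_upBandRight (a : ℂ) (ε : ℝ) : IsOpen (upBandRight a ε) := by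
  rw [upBandRight_eq]
  exact ((isOpen_lt_re _).inter (isOpen_re_lt _)).inter (isOpen_lt_im _)

theorem convex_upBand (a : ℂ) (ε : ℝ) : Convex ℝ (upBand a ε) := by
  rw [upBand_eq]
  exact ((convex_halfSpace_re_gt _).inter (convex_halfSpace_re_lt _)).inter
    (convex_halfSpace_im_gt _)

theorem convex_upBandLeft (a : ℂ) (ε : ℝ) : Convex ℝ (upBandLeft a ε) := by
  rw [upBandLeft_eq]
  exact ((convex_halfSpace_re_gt _).inter (convex_halfSpace_re_lt _)).inter
    (convex_halfSpace_im_gt _)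

theorem convex_upBandRight (a : ℂ) (ε : ℝ) : Convex ℝ (upBandRight a ε) := by
  rw [upBandRight_eq]
  exact ((convex_halfSpace_re_gt _).inter (convex_halfSpace_re_lt _)).inter
    (convex_halfSpace_im_gt _)

theorem isOpen_outsideSquare (R : ℝ) : IsOpen (outsideSquare R) :=
  (isOpen_lt continuous_const (Complex.continuous_re.abs)).union
    (isOpen_lt continuous_const (Complex.continuous_im.abs))

theorem upBandLeft_subset (a : ℂ) (ε : ℝ) : upBandLeft a ε ⊆ upBand a ε :=
  fun z hz => ⟨by rw [abs_lt]; constructor <;> linarith [hz.1, hz.2.1], hz.2.2⟩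

theorem upBandRight_subset (a : ℂ) (ε : ℝ) : upBandRight a ε ⊆ upBand a ε :=
  fun z hz => ⟨by rw [abs_lt]; constructor <;> linarith [hz.1, hz.2.1], hz.2.2⟩

namespace SlitParams

variable (P : SlitParams q ε R)
include P

theorem eq_of_re_sub_lt {z : ℂ} {i j : Fin N} (hi : |z.re - (q i).re| < ε)
    (hj : |z.re - (q j).re| < ε) : i = j := by
  by_contra h
  have := P.sep i j h
  have h2 : |(q i).re - (q j).re| ≤ |z.re - (q i).re| + |z.re - (q j).re| := by
    rw [abs_sub_comm z.re (q i).re]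
    have := abs_add_le ((q i).re - z.re) (z.re - (q j).re)
    simpa using this
  linarith

theorem mem_upSlitPlane_of_re_ne {z : ℂ} {i : Fin N} (hi : |z.re - (q i).re| < ε)
    (h : z.re ≠ (q i).re) : z ∈ upSlitPlane q := by
  intro j hj
  have : i = j := P.eq_of_re_sub_lt hi (by rw [hj]; simpa using P.pos)
  subst this
  exact absurd hj h

theorem upBandLeft_subset_slitPlane (i : Fin N) : upBandLeft (q i) ε ⊆ upSlitPlane q :=
  fun _ hz => P.mem_upSlitPlane_of_re_ne (upBandLeft_subset _ _ hz).1 hz.2.1.ne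

theorem upBandRight_subset_slitPlane (i : Fin N) : upBandRight (q i) ε ⊆ upSlitPlane q :=
  fun _ hz => P.mem_upSlitPlane_of_re_ne (upBandRight_subset _ _ hz).1 hz.1.ne'

omit P in
theorem left_or_right {z : ℂ} {i : Fin N} (hz : z ∈ upBand (q i) ε) (hs : z ∈ upSlitPlane q) :
    z ∈ upBandLeft (q i) ε ∨ z ∈ upBandRight (q i) ε := by
  obtain ⟨h1, h2⟩ := hz
  rw [abs_lt] at h1
  rcases lt_trichotomy z.re (q i).re with h | h | h
  · exact Or.inl ⟨by linarith, h, h2⟩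
  · exact absurd (hs i h) (not_lt.2 h2.le)
  · exact Or.inr ⟨h, by linarith, h2⟩

theorem slitPlane_or_band_or_eq (z : ℂ) :
    z ∈ upSlitPlane q ∨ (∃ i, z ∈ upBand (q i) ε) ∨ ∃ i, z = q i := by
  by_cases h : z ∈ upSlitPlane q
  · exact Or.inl h
  · simp only [upSlitPlane, Set.mem_ofPred_eq, not_forall, not_lt] at h
    obtain ⟨i, h1, h2⟩ := h
    rcases h2.lt_or_eq with h3 | h3
    · exact Or.inr (Or.inl ⟨i, by rw [h1]; simpa using P.pos, h3⟩)
    · exact Or.inr (Or.inr ⟨i, Complex.ext h1 h3.symm⟩)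

theorem notMem_upBand (i j : Fin N) : q i ∉ upBand (q j) ε := by
  intro h
  have : i = j := P.eq_of_re_sub_lt (z := q i) (by simpa using P.pos) h.1
  subst this
  exact lt_irrefl _ h.2

omit P in
theorem notMem_upSlitPlane (i : Fin N) : q i ∉ upSlitPlane q := fun h => lt_irrefl _ (h i rfl)

omit P in
theorem re_sub_lt_of_mem_ball {z a : ℂ} (h : z ∈ Metric.ball a ε) : |z.re - a.re| < ε := by
  have := Complex.abs_re_le_norm (z - a)
  rw [Complex.sub_re] at this
  exact this.trans_lt (by simpa [dist_eq_norm] using h)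

omit P in
theorem im_sub_lt_of_mem_ball {z a : ℂ} (h : z ∈ Metric.ball a ε) : |z.im - a.im| < ε := by
  have := Complex.abs_im_le_norm (z - a)
  rw [Complex.sub_im] at this
  exact this.trans_lt (by simpa [dist_eq_norm] using h)

theorem eq_of_mem_ball_of_mem_band {z : ℂ} {i j : Fin N} (hi : z ∈ Metric.ball (q i) ε)
    (hj : z ∈ upBand (q j) ε) : i = j :=
  P.eq_of_re_sub_lt (re_sub_lt_of_mem_ball hi) hj.1

theorem eq_of_mem_ball {z : ℂ} {i j : Fin N} (hi : z ∈ Metric.ball (q i) ε)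
    (hj : z ∈ Metric.ball (q j) ε) : i = j :=
  P.eq_of_re_sub_lt (re_sub_lt_of_mem_ball hi) (re_sub_lt_of_mem_ball hj)

theorem notMem_outsideSquare_of_mem_ball {z : ℂ} {i : Fin N} (hi : z ∈ Metric.ball (q i) ε) :
    z ∉ outsideSquare R := by
  have h1 := re_sub_lt_of_mem_ball hi
  have h2 := im_sub_lt_of_mem_ball hi
  have h3 := P.re_lt i
  have h4 := P.im_lt i
  rintro (h | h)
  · have := abs_sub_abs_le_abs_sub z.re (q i).re
    linarith
  · have := abs_sub_abs_le_abs_sub z.im (q i).im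
    linarith

/-- Only the slit of `q i` meets this ball, so the set is star-shaped about the point at distance `ε
/ 2` straight below `q i`. -/
theorem isPreconnected_slitPlane_inter_ball (i : Fin N) :
    IsPreconnected (upSlitPlane q ∩ Metric.ball (q i) ε) := by
  have hpos := P.pos
  set c : ℂ := q i - ((ε / 2 : ℝ) : ℂ) * Complex.I with hcdef
  have hc : c ∈ Metric.ball (q i) ε := by
    rw [mem_ball_iff_norm, hcdef, sub_sub_cancel_left, norm_neg, norm_mul, Complex.norm_I, mul_one,
      Complex.norm_real, Real.norm_eq_abs, abs_of_pos (half_pos hpos)]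
    linarith
  have : StarConvex ℝ (c) (upSlitPlane q ∩ Metric.ball (q i) ε) := by
    rintro z ⟨hz, hzb⟩ s t hs ht hst
    have hb := (convex_ball (q i) ε) hc hzb hs ht hst
    refine ⟨fun j hj => ?_, hb⟩
    have : i = j := P.eq_of_re_sub_lt (re_sub_lt_of_mem_ball hb) (by rw [hj]; simpa using hpos)
    subst this
    have hre : (s • (c) + t • z).re = s * (q i).re + t * z.re := by
      simp [hcdef]
    have him : (s • (c) + t • z).im =
        s * ((q i).im - ε / 2) + t * z.im := by simp [hcdef]
    rw [hre] at hj
    rw [him]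
    have hs1 : s = 1 - t := by linarith
    have hj' : t * (z.re - (q i).re) = 0 := by rw [hs1] at hj; linarith
    rcases mul_eq_zero.1 hj' with h | h
    · rw [h] at hs1 ⊢; rw [hs1]; linarith
    · have := hz i (sub_eq_zero.1 h)
      rw [hs1]
      rcases ht.eq_or_lt with h0 | h0
      · rw [← h0]; linarith
      · have hs' : 0 ≤ 1 - t := hs1 ▸ hs
        nlinarith
  refine (this.isSimplyConnected ⟨c, fun j hj => ?_, hc⟩).isPathConnected.isConnected.isPreconnected
  have : i = j := P.eq_of_re_sub_lt (re_sub_lt_of_mem_ball hc) (by rw [hj]; simpa using hpos)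
  subst this
  simp [hcdef]
  exact hpos

theorem im_of_band_outside {z : ℂ} {i : Fin N} (hz : z ∈ upBand (q i) ε)
    (ho : z ∈ outsideSquare R) : R < z.im := by
  have h1 := P.re_lt i
  have h2 := P.im_lt i
  have hpos := P.pos
  rcases ho with h | h
  · have := abs_sub_abs_le_abs_sub z.re (q i).re
    linarith [hz.1]
  · rcases lt_abs.1 h with h | h
    · exact h
    · have := neg_abs_le (q i).im
      linarith [hz.2]

theorem upBand_inter_outsideSquare (i : Fin N) :
    upBand (q i) ε ∩ outsideSquare R = upBand (q i) ε ∩ {z | R < z.im} := by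
  ext z
  refine ⟨fun h => ⟨h.1, P.im_of_band_outside h.1 h.2⟩, fun h => ⟨h.1, Or.inr ?_⟩⟩
  exact lt_of_lt_of_le h.2 (le_abs_self _)

variable [NeZero N]

omit P in
theorem isOpen_slitGap (q : Fin N → ℂ) (R : ℝ) (i : Fin N) : IsOpen (slitGap q R i) := by
  unfold slitGap
  split_ifs
  · exact ((((isOpen_im_lt _).union (isOpen_re_lt _)).union (isOpen_lt_re _)).union
      ((isOpen_lt_im _).inter (isOpen_re_lt _))).union ((isOpen_lt_im _).inter (isOpen_lt_re _))
  · exact (isOpen_lt_im _).inter ((isOpen_lt_re _).inter (isOpen_re_lt _))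

omit P in
theorem isPreconnected_slitGap (q : Fin N → ℂ) (R : ℝ) (i : Fin N) :
    IsPreconnected (slitGap q R i) := by
  unfold slitGap
  split_ifs
  -- The gap `0` is a chain of five convex pieces around the square. The explicit points lie in the
  -- overlap of each new piece with an earlier one.
  · refine IsPreconnected.union ⟨max R (q (0 - 1)).re + 1, R + 1⟩ (Or.inl (Or.inr ?_)) ⟨?_, ?_⟩
      (IsPreconnected.union ⟨min (-R) (q 0).re - 1, R + 1⟩ (Or.inl (Or.inr ?_)) ⟨?_, ?_⟩
      (IsPreconnected.union ⟨R + 1, - R - 1⟩ (Or.inl ?_) ?_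
      (IsPreconnected.union ⟨-R - 1, - R - 1⟩ ?_ ?_ (convex_halfSpace_im_lt _).isPreconnected
        (convex_halfSpace_re_lt _).isPreconnected) (convex_halfSpace_re_gt _).isPreconnected)
      ((convex_halfSpace_im_gt _).inter (convex_halfSpace_re_lt _)).isPreconnected)
      ((convex_halfSpace_im_gt _).inter (convex_halfSpace_re_gt _)).isPreconnected
    all_goals simp only [Set.mem_ofPred_eq]
    · linarith [le_max_left R (q (0 - 1)).re]
    · linarith
    · linarith [le_max_right R (q (0 - 1)).re]
    · linarith [min_le_left (-R) (q 0).re]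
    · linarith
    · linarith [min_le_right (-R) (q 0).re]
    · linarith
    · linarith
    · linarith
    · linarith
  · exact ((convex_halfSpace_im_gt _).inter
      ((convex_halfSpace_re_gt _).inter (convex_halfSpace_re_lt _))).isPreconnected

omit [NeZero N] in
theorem re_le {i j : Fin N} (h : i ≤ j) : (q i).re ≤ (q j).re := P.strictMono.monotone h

-- Subtraction in `Fin N` wraps around, so `0 - 1` is the last index, and the gap `0` begins to the
-- right of the last slit.
omit P in
theorem le_zero_sub_one (j : Fin N) : j ≤ 0 - 1 := by
  obtain ⟨n, rfl⟩ := Nat.exists_eq_succ_of_ne_zero (NeZero.ne N)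
  have : (0 - 1 : Fin (n + 1)) = Fin.last n := by
    rw [sub_eq_iff_eq_add, Fin.last_add_one]
  exact this ▸ Fin.le_last j

omit P in
theorem sub_one_lt {i : Fin N} (h : i ≠ 0) : i - 1 < i := by
  obtain ⟨n, rfl⟩ := Nat.exists_eq_succ_of_ne_zero (NeZero.ne N)
  exact Fin.sub_one_lt_iff.2 (Fin.pos_iff_ne_zero.2 h)

omit P in
theorem le_sub_one {i j : Fin N} (h : i < j) : i ≤ j - 1 := by
  obtain ⟨n, rfl⟩ := Nat.exists_eq_succ_of_ne_zero (NeZero.ne N)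
  have hj : j ≠ 0 := ((Fin.zero_le i).trans_lt h).ne'
  rw [Fin.le_def, Fin.val_sub_one_of_ne_zero hj]
  have := Fin.lt_def.1 h
  omega

omit P in
theorem slitGap_subset_outsideSquare (i : Fin N) : slitGap q R i ⊆ outsideSquare R := by
  unfold slitGap
  intro z hz
  split_ifs at hz
  · rcases hz with (((h | h) | h) | h) | h
    · exact Or.inr (lt_abs.2 (Or.inr (by simp at h; linarith)))
    · exact Or.inl (lt_abs.2 (Or.inr (by simp at h; linarith)))
    · exact Or.inl (lt_abs.2 (Or.inl h))
    · exact Or.inr (lt_abs.2 (Or.inl h.1))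
    · exact Or.inr (lt_abs.2 (Or.inl h.1))
  · exact Or.inr (lt_abs.2 (Or.inl hz.1))

theorem slitGap_subset_slitPlane (i : Fin N) : slitGap q R i ⊆ upSlitPlane q := by
  unfold slitGap
  intro z hz j hj
  have h1 := P.re_lt j
  have h2 := P.im_lt j
  have h3 := P.pos
  have h4 := abs_le.1 (le_refl |(q j).re|)
  have h5 := abs_le.1 (le_refl |(q j).im|)
  split_ifs at hz with hi
  · rcases hz with (((h | h) | h) | h) | h
    · simp only [Set.mem_ofPred_eq] at h; linarith
    · simp only [Set.mem_ofPred_eq] at h; linarith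
    · simp only [Set.mem_ofPred_eq] at h; linarith
    · have := P.re_le (Fin.zero_le j)
      linarith [h.2]
    · have := P.re_le (le_zero_sub_one j)
      linarith [h.2]
  · obtain ⟨-, h6, h7⟩ := hz
    rw [hj] at h6 h7
    have h8 := P.strictMono.lt_iff_lt.1 h6
    have h9 := P.strictMono.lt_iff_lt.1 h7
    exact absurd h8 (not_lt.2 (le_sub_one h9))

theorem exists_mem_slitGap {z : ℂ} (hz : z ∈ upSlitPlane q) (ho : z ∈ outsideSquare R) :
    ∃ i, z ∈ slitGap q R i := by
  by_cases him : R < z.im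
  · have hne : ∀ j, z.re ≠ (q j).re := by
      intro j hj
      have := hz j hj
      have := P.im_lt j
      linarith [le_abs_self (q j).im, P.pos]
    by_cases hex : ∃ j, z.re < (q j).re
    · obtain ⟨i, hi, hmin⟩ := WellFounded.has_min (wellFounded_lt (α := Fin N))
        {j | z.re < (q j).re} hex
      refine ⟨i, ?_⟩
      unfold slitGap
      split_ifs with h0
      · subst h0; exact Or.inl (Or.inr ⟨him, hi⟩)
      · refine ⟨him, lt_of_le_of_ne (not_lt.1 fun h => hmin _ h (sub_one_lt h0)) (hne _).symm, hi⟩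
    · refine ⟨0, ?_⟩
      unfold slitGap
      rw [if_pos rfl]
      exact Or.inr ⟨him, lt_of_le_of_ne (not_lt.1 fun h => hex ⟨_, h⟩) (hne _).symm⟩
  · refine ⟨0, ?_⟩
    unfold slitGap
    rw [if_pos rfl]
    rcases ho with h | h
    · rcases lt_abs.1 h with h | h
      · exact Or.inl (Or.inl (Or.inr h))
      · exact Or.inl (Or.inl (Or.inl (Or.inr (show z.re < -R by linarith))))
    · rcases lt_abs.1 h with h | h
      · exact absurd h him
      · exact Or.inl (Or.inl (Or.inl (Or.inl (show z.im < -R by linarith))))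

theorem slitGap_unique {i j : Fin N} {z : ℂ} (hi : z ∈ slitGap q R i) (hj : z ∈ slitGap q R j) :
    i = j := by
  have key : ∀ i j : Fin N, i < j → z ∈ slitGap q R i → z ∈ slitGap q R j → False := by
    intro i j hij hi hj
    have hj0 : j ≠ 0 := ((Fin.zero_le i).trans_lt hij).ne'
    unfold slitGap at hi hj
    rw [if_neg hj0] at hj
    obtain ⟨h1, h2, h3⟩ := hj
    split_ifs at hi with h0
    · have a1 := P.re_lt (j - 1)
      have a2 := P.re_lt j
      have a3 := P.pos
      have a4 := abs_le.1 (le_refl |(q (j - 1)).re|)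
      have a5 := abs_le.1 (le_refl |(q j).re|)
      have a6 := P.im_lt j
      have a7 := abs_nonneg (q j).im
      rcases hi with (((h | h) | h) | h) | h
      · simp only [Set.mem_ofPred_eq] at h; linarith
      · simp only [Set.mem_ofPred_eq] at h; linarith
      · simp only [Set.mem_ofPred_eq] at h; linarith
      · have := P.re_le (Fin.zero_le (j - 1))
        linarith [h.2]
      · have := P.re_le (le_zero_sub_one j)
        linarith [h.2]
    · have := P.re_le (le_sub_one hij)
      linarith [hi.2.2]
  rcases lt_trichotomy i j with h | h | h
  exacts [(key i j h hi hj).elim, h, (key j i h hj hi).elim]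

theorem upBandLeft_outside (i : Fin N) :
    upBandLeft (q i) ε ∩ outsideSquare R ⊆ slitGap q R i := by
  rintro z ⟨hz, ho⟩
  have him := P.im_of_band_outside (upBandLeft_subset _ _ hz) ho
  unfold slitGap
  split_ifs with h0
  · subst h0; exact Or.inl (Or.inr ⟨him, hz.2.1⟩)
  · refine ⟨him, ?_, hz.2.1⟩
    have h1 := P.sep i (i - 1) (sub_one_lt h0).ne'
    have h2 : (q (i - 1)).re < (q i).re := P.strictMono (sub_one_lt h0)
    rw [abs_of_pos (by linarith)] at h1
    linarith [hz.1, P.pos]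

/-- Crossing the `i`-th slit near infinity leads from gap `i` to gap `i + 1`, cyclically. The
separation of the slits by `2 * ε` keeps the half-band away from the next slit. -/
theorem upBandRight_outside (i : Fin N) :
    upBandRight (q i) ε ∩ outsideSquare R ⊆ slitGap q R (i + 1) := by
  rintro z ⟨hz, ho⟩
  have him := P.im_of_band_outside (upBandRight_subset _ _ hz) ho
  unfold slitGap
  split_ifs with h0
  · refine Or.inr ⟨him, ?_⟩
    have : (0 - 1 : Fin N) = i := by rw [← h0, add_sub_cancel_right]
    rw [this]; exact hz.1
  · refine ⟨him, by rw [add_sub_cancel_right]; exact hz.1, ?_⟩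
    have hlt : i < i + 1 := by simpa using sub_one_lt h0
    have h1 := P.sep (i + 1) i hlt.ne'
    have h2 : (q i).re < (q (i + 1)).re := P.strictMono hlt
    rw [abs_of_pos (by linarith)] at h1
    linarith [hz.2.1, P.pos]

end SlitParams

end Geometry

/-! ### The standard coordinates of the sphere -/

section SphereParam

theorem sphereParam_coe (a w : ℂ) : sphereParam (a : OnePoint ℂ) w = ((a + w : ℂ) : OnePoint ℂ) :=
  rfl

theorem sphereParam_infty_zero : sphereParam OnePoint.infty 0 = OnePoint.infty := if_pos rfl

theorem sphereParam_infty_of_ne {w : ℂ} (hw : w ≠ 0) :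
    sphereParam OnePoint.infty w = ((w⁻¹ : ℂ) : OnePoint ℂ) := if_neg hw

theorem sphereParam_zero (v : OnePoint ℂ) : sphereParam v 0 = v := by
  induction v using OnePoint.rec with
  | infty => exact sphereParam_infty_zero
  | coe a => rw [sphereParam_coe, add_zero]

theorem sphereParam_injective (v : OnePoint ℂ) : Function.Injective (sphereParam v) := by
  intro w w' h
  induction v using OnePoint.rec with
  | infty =>
    by_cases h0 : w = 0 <;> by_cases h0' : w' = 0
    · rw [h0, h0']
    · rw [h0, sphereParam_infty_zero, sphereParam_infty_of_ne h0'] at h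
      exact absurd h (OnePoint.infty_ne_coe _)
    · rw [h0', sphereParam_infty_zero, sphereParam_infty_of_ne h0] at h
      exact absurd h (OnePoint.coe_ne_infty _)
    · rw [sphereParam_infty_of_ne h0, sphereParam_infty_of_ne h0'] at h
      exact inv_injective (OnePoint.coe_injective h)
  | coe a =>
    rw [sphereParam_coe, sphereParam_coe] at h
    exact add_left_cancel (OnePoint.coe_injective h)

theorem sphereParam_eq_self_iff {v : OnePoint ℂ} {w : ℂ} : sphereParam v w = v ↔ w = 0 :=
  ⟨fun h => sphereParam_injective v (h.trans (sphereParam_zero v).symm),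
    fun h => h ▸ sphereParam_zero v⟩

/-- An equality of filters gives continuity and openness at once. At `∞` it holds because inversion
exchanges the punctured neighbourhoods of zero with the complements of bounded sets. -/
theorem map_sphereParam_nhds (v : OnePoint ℂ) (w : ℂ) :
    Filter.map (sphereParam v) (𝓝 w) = 𝓝 (sphereParam v w) := by
  induction v using OnePoint.rec with
  | infty =>
    by_cases hw : w = 0
    · subst hw
      have hinv : Filter.map Inv.inv (𝓝[≠] (0 : ℂ)) = Bornology.cobounded ℂ := by
        refine le_antisymm Filter.tendsto_inv₀_nhdsNE_zero ?_
        have := Filter.map_mono (m := Inv.inv) (Filter.tendsto_inv₀_cobounded' (α := ℂ))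
        rwa [Filter.map_map, inv_involutive.comp_self, Filter.map_id] at this
      rw [sphereParam_infty_zero, OnePoint.nhds_infty_eq, Filter.coclosedCompact_eq_cocompact,
        ← Metric.cobounded_eq_cocompact, ← hinv, ← nhdsNE_sup_pure, Filter.map_sup,
        Filter.map_pure, sphereParam_infty_zero, Filter.map_map]
      congr 1
      refine Filter.map_congr ?_
      filter_upwards [self_mem_nhdsWithin] with z hz
      exact sphereParam_infty_of_ne hz
    · rw [sphereParam_infty_of_ne hw, OnePoint.nhds_coe_eq]
      have hinv : Filter.map Inv.inv (𝓝 w) = 𝓝 w⁻¹ := by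
        refine le_antisymm (tendsto_inv₀ hw) ?_
        have := Filter.map_mono (m := Inv.inv) (tendsto_inv₀ (inv_ne_zero hw))
        rwa [inv_inv, Filter.map_map, inv_involutive.comp_self, Filter.map_id] at this
      rw [← hinv, Filter.map_map]
      refine Filter.map_congr ?_
      filter_upwards [isOpen_ne.mem_nhds hw] with z hz
      exact sphereParam_infty_of_ne hz
  | coe a =>
    rw [sphereParam_coe, OnePoint.nhds_coe_eq, ← map_add_left_nhds, Filter.map_map]
    rfl

theorem isOpenEmbedding_sphereParam (v : OnePoint ℂ) : IsOpenEmbedding (sphereParam v) :=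
  .of_continuous_injective_isOpenMap
    (continuous_iff_continuousAt.2 fun w => (map_sphereParam_nhds v w).le)
    (sphereParam_injective v)
    (isOpenMap_iff_nhds_le.2 fun w => (map_sphereParam_nhds v w).ge)

theorem continuous_sphereParam (v : OnePoint ℂ) : Continuous (sphereParam v) :=
  (isOpenEmbedding_sphereParam v).continuous

end SphereParam

/-! ### Branched covers: deck transformations, fibres and sections -/

/-- A cyclic branched cover of the sphere with branch points in `V`: the structure of
`CyclicBranchedCover` without its monodromy. -/
structure BranchedCover (d : ℕ) (V : Set (OnePoint ℂ)) (X : Type*) [TopologicalSpace X] where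
  proj : X → OnePoint ℂ
  deck : X ≃ₜ X
  continuous_proj : Continuous proj
  surjective_proj : Function.Surjective proj
  proj_eq_iff : ∀ x y, proj x = proj y ↔ ∃ k : ℕ, deck^[k] x = y
  deck_free : ∀ x, proj x ∉ V → ∀ k : ℕ, deck^[k] x = x ↔ d ∣ k
  isCoveringMapOn : IsCoveringMapOn proj Vᶜ
  exists_chart : ∀ x, ∃ k : ℕ, 0 < k ∧ ∃ φ : OpenPartialHomeomorph X ℂ,
    x ∈ φ.source ∧ φ x = 0 ∧ ∀ y ∈ φ.source, proj y = sphereParam (proj x) (φ y ^ k)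

namespace BranchedCover

variable {d : ℕ} {V : Set (OnePoint ℂ)} {X : Type*} [TopologicalSpace X]

theorem _root_.IsCoveringMapOn.exists_sphere_chart {proj : X → OnePoint ℂ}
    (h : IsCoveringMapOn proj Vᶜ) {x : X} (hx : proj x ∉ V) :
    ∃ φ : OpenPartialHomeomorph X ℂ,
      x ∈ φ.source ∧ φ x = 0 ∧ ∀ y ∈ φ.source, proj y = sphereParam (proj x) (φ y) := by
  obtain ⟨e, hxe, he⟩ := h.isLocalHomeomorphOn x hx
  have : Nonempty ℂ := ⟨0⟩
  let ψ := (isOpenEmbedding_sphereParam (proj x)).toOpenPartialHomeomorph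
  have hψ : ∀ w, ψ.symm (sphereParam (proj x) w) = w := fun w => ψ.left_inv (by simp [ψ])
  have htgt : ∀ y ∈ (e.trans ψ.symm).source, proj y ∈ Set.range (sphereParam (proj x)) := by
    intro y hy
    have := hy.2
    have hpy : proj y = e y := congrFun he y
    rw [hpy]
    simpa [ψ] using this
  refine ⟨e.trans ψ.symm, ?_, ?_, ?_⟩
  · rw [OpenPartialHomeomorph.trans_source]
    refine ⟨hxe, ?_⟩
    rw [← he]
    simp only [ψ, Set.mem_preimage, OpenPartialHomeomorph.symm_source,
      IsOpenEmbedding.toOpenPartialHomeomorph_target]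
    exact ⟨0, sphereParam_zero _⟩
  · rw [OpenPartialHomeomorph.coe_trans, Function.comp_apply, ← he]
    conv_lhs => rw [← sphereParam_zero (proj x)]
    have := hψ 0
    rw [sphereParam_zero] at this ⊢
    exact this
  · intro y hy
    obtain ⟨w, hw⟩ := htgt y hy
    rw [OpenPartialHomeomorph.coe_trans, Function.comp_apply, ← he, ← hw, hψ]

/-- A cyclically branched cover, without its monodromy. -/
def ofCyclic {n : ℕ} {p : Fin n → OnePoint ℂ} {b : Fin n → ℕ} (C : CyclicBranchedCover d p b X) :
    BranchedCover d (Set.range p) X where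
  proj := C.proj
  deck := C.deck
  continuous_proj := C.continuous_proj
  surjective_proj := C.surjective_proj
  proj_eq_iff := C.proj_eq_iff
  deck_free := C.deck_free
  isCoveringMapOn := C.isCoveringMapOn
  exists_chart x := by
    by_cases hx : C.proj x ∈ Set.range p
    · exact C.local_form x hx
    · obtain ⟨φ, h1, h2, h3⟩ := C.isCoveringMapOn.exists_sphere_chart hx
      exact ⟨1, one_pos, φ, h1, h2, fun y hy => by rw [pow_one]; exact h3 y hy⟩

/-- Further points of the sphere may be regarded as branch points. -/
def enlarge (C : BranchedCover d V X) {V' : Set (OnePoint ℂ)} (h : V ⊆ V') :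
    BranchedCover d V' X where
  proj := C.proj
  deck := C.deck
  continuous_proj := C.continuous_proj
  surjective_proj := C.surjective_proj
  proj_eq_iff := C.proj_eq_iff
  deck_free x hx := C.deck_free x fun hx' => hx (h hx')
  isCoveringMapOn := C.isCoveringMapOn.mono (Set.compl_subset_compl.2 h)
  exists_chart := C.exists_chart

variable (C : BranchedCover d V X)

theorem proj_iterate (k : ℕ) (x : X) : C.proj (C.deck^[k] x) = C.proj x :=
  ((C.proj_eq_iff x _).2 ⟨k, rfl⟩).symm

theorem continuous_iterate (k : ℕ) : Continuous C.deck^[k] := C.deck.continuous.iterate k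

theorem tendsto_symm_chart {x : X} {φ : OpenPartialHomeomorph X ℂ} (hx : x ∈ φ.source)
    (h0 : φ x = 0) : Filter.Tendsto φ.symm (𝓝[≠] 0) (𝓝[≠] x) := by
  have h0t : (0 : ℂ) ∈ φ.target := h0 ▸ φ.map_source hx
  have h0s : φ.symm 0 = x := by rw [← h0, φ.left_inv hx]
  refine tendsto_nhdsWithin_iff.2 ⟨?_, ?_⟩
  · have := φ.continuousAt_symm h0t
    rw [ContinuousAt, h0s] at this
    exact this.mono_left inf_le_left
  · filter_upwards [self_mem_nhdsWithin, mem_nhdsWithin_of_mem_nhds (φ.open_target.mem_nhds h0t)]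
      with z hz hzt
    intro h
    rw [Set.mem_singleton_iff] at h
    apply hz
    rw [Set.mem_singleton_iff, ← φ.right_inv hzt, h, h0]

include C in
theorem neBot_nhdsNE (x : X) : (𝓝[≠] x).NeBot := by
  obtain ⟨k, -, φ, hx, h0, -⟩ := C.exists_chart x
  exact (tendsto_symm_chart hx h0).neBot

theorem eventually_proj_ne (x : X) : ∀ᶠ y in 𝓝[≠] x, C.proj y ≠ C.proj x := by
  obtain ⟨k, hk, φ, hx, h0, h⟩ := C.exists_chart x
  filter_upwards [self_mem_nhdsWithin, mem_nhdsWithin_of_mem_nhds (φ.open_source.mem_nhds hx)]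
    with y hy hys
  rw [h y hys, Ne, sphereParam_eq_self_iff]
  intro h'
  apply hy
  exact φ.injOn hys hx ((pow_eq_zero_iff hk.ne').1 h' |>.trans h0.symm)

theorem eventually_proj_notMem (hV : V.Finite) (x : X) : ∀ᶠ y in 𝓝[≠] x, C.proj y ∉ V := by
  have h1 : (V \ {C.proj x})ᶜ ∈ 𝓝 (C.proj x) :=
    ((hV.subset Set.sdiff_subset).isClosed.isOpen_compl).mem_nhds (by simp)
  filter_upwards [C.eventually_proj_ne x,
    mem_nhdsWithin_of_mem_nhds (C.continuous_proj.continuousAt h1)] with y h2 h3 h4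
  exact h3 ⟨h4, h2⟩

/-- Over the complement of `V` this is part of the free action. Every point of `X` is a limit of
such points, and the identity extends by continuity. -/
theorem iterate_eq_self [T2Space X] (hV : V.Finite) (x : X) : C.deck^[d] x = x := by
  have := C.neBot_nhdsNE x
  refine tendsto_nhds_unique_of_eventuallyEq (l := 𝓝[≠] x)
    ((C.continuous_iterate d).continuousAt.mono_left inf_le_left)
    (Filter.tendsto_id.mono_left inf_le_left) ?_
  filter_upwards [C.eventually_proj_notMem hV x] with y hy
  exact (C.deck_free y hy d).2 dvd_rfl

theorem iterate_mod [T2Space X] (hV : V.Finite) (m : ℕ) (x : X) :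
    C.deck^[m % d] x = C.deck^[m] x :=
  Function.IsPeriodicPt.iterate_mod_apply (C.iterate_eq_self hV x) m

/-- The power of the deck transformation with exponent in `ZMod d`. -/
noncomputable def shift (k : ZMod d) (x : X) : X := C.deck^[k.val] x

theorem proj_shift (k : ZMod d) (x : X) : C.proj (C.shift k x) = C.proj x := C.proj_iterate _ x

theorem continuous_shift (k : ZMod d) : Continuous (C.shift k) := C.continuous_iterate _

section Shift

variable [T2Space X] (hV : V.Finite)
include hV

theorem shift_natCast [NeZero d] (m : ℕ) (x : X) : C.shift m x = C.deck^[m] x := by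
  rw [shift, ZMod.val_natCast, C.iterate_mod hV]

theorem shift_add [NeZero d] (k l : ZMod d) (x : X) :
    C.shift (k + l) x = C.shift k (C.shift l x) := by
  rw [shift, ZMod.val_add, C.iterate_mod hV, Function.iterate_add_apply]
  rfl

omit hV [T2Space X] in
theorem shift_zero [NeZero d] (x : X) : C.shift 0 x = x := by
  rw [shift, ZMod.val_zero]; rfl

theorem exists_shift_eq [NeZero d] {x y : X} (h : C.proj x = C.proj y) :
    ∃ k : ZMod d, C.shift k x = y := by
  obtain ⟨m, hm⟩ := (C.proj_eq_iff x y).1 h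
  exact ⟨m, by rw [C.shift_natCast hV, hm]⟩

omit hV [T2Space X] in
theorem shift_eq_self_iff [NeZero d] {x : X} (hx : C.proj x ∉ V) {k : ZMod d} :
    C.shift k x = x ↔ k = 0 := by
  rw [shift, C.deck_free x hx, ← ZMod.natCast_eq_zero_iff, ZMod.natCast_zmod_val]

theorem shift_injective_left [NeZero d] {x : X} (hx : C.proj x ∉ V) {k l : ZMod d}
    (h : C.shift k x = C.shift l x) : k = l := by
  have h1 : C.shift (-l + k) x = x := by
    rw [C.shift_add hV, h, ← C.shift_add hV, neg_add_cancel, C.shift_zero]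
  rw [C.shift_eq_self_iff hx] at h1
  rw [← sub_eq_zero, sub_eq_neg_add, h1]

theorem finite_fibre (hd : 0 < d) (v : OnePoint ℂ) : (C.proj ⁻¹' {v}).Finite := by
  obtain ⟨x, rfl⟩ := C.surjective_proj v
  refine ((Set.finite_lt_nat d).image fun k => C.deck^[k] x).subset fun y hy => ?_
  obtain ⟨k, hk⟩ := (C.proj_eq_iff x y).1 (Eq.symm hy)
  exact ⟨k % d, Nat.mod_lt k hd, by simp only [C.iterate_mod hV, hk]⟩

theorem finite_preimage (hd : 0 < d) : (C.proj ⁻¹' V).Finite := by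
  rw [← Set.biUnion_preimage_singleton]
  exact hV.biUnion fun v _ => C.finite_fibre hV hd v

/-- A fibre is one orbit of the deck transformation. -/
theorem card_fibre (hd : 0 < d) (x : X) :
    Nat.card (C.proj ⁻¹' {C.proj x}) = Function.minimalPeriod C.deck x := by
  have hpos : 0 < Function.minimalPeriod C.deck x :=
    Function.IsPeriodicPt.minimalPeriod_pos hd (C.iterate_eq_self hV x)
  have : C.proj ⁻¹' {C.proj x} =
      Set.range fun k : Fin (Function.minimalPeriod C.deck x) => C.deck^[k] x := by
    ext y
    constructor
    · intro hy
      obtain ⟨k, hk⟩ := (C.proj_eq_iff x y).1 (Eq.symm hy)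
      exact ⟨⟨k % _, Nat.mod_lt k hpos⟩, by
        simp only [Function.iterate_mod_minimalPeriod_eq, hk]⟩
    · rintro ⟨k, rfl⟩
      exact C.proj_iterate _ x
  rw [this, Nat.card_range_of_injective, Nat.card_fin]
  intro k l hkl
  exact Fin.ext (Function.iterate_injOn_Iio_minimalPeriod k.2 l.2 hkl)

theorem minimalPeriod_dvd (x : X) : Function.minimalPeriod C.deck x ∣ d :=
  Function.IsPeriodicPt.minimalPeriod_dvd (C.iterate_eq_self hV x)

theorem minimalPeriod_of_notMem {x : X} (hx : C.proj x ∉ V) :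
    Function.minimalPeriod C.deck x = d :=
  Nat.dvd_antisymm (C.minimalPeriod_dvd hV x)
    ((C.deck_free x hx _).1 (Function.iterate_minimalPeriod))

end Shift

include C in
theorem locallyPathConnectedSpace : LocallyPathConnectedSpace X := by
  choose k hk φ hφ h0 h using C.exists_chart
  let : ChartedSpace ℂ X :=
    { atlas := Set.range φ
      chartAt := φ
      mem_chart_source := hφ
      chart_mem_atlas := fun x => ⟨x, rfl⟩ }
  exact ChartedSpace.locallyPathConnectedSpace ℂ X

/-- `s` is a section of the branched cover over the open set `O` in the punctured plane. -/
structure IsSection (s : ℂ → X) (O : Set ℂ) : Prop where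
  isOpen : IsOpen O
  continuousOn : ContinuousOn s O
  proj_apply : ∀ z ∈ O, C.proj (s z) = z
  notMem : ∀ z ∈ O, (z : OnePoint ℂ) ∉ V

/-- The inclusion of a simply connected open set lifts through the covering. The value `x₀` outside
`O` is irrelevant. -/
theorem exists_section {O : Set ℂ} (hO : IsOpen O) (hs : IsSimplyConnected O)
    (hOV : ∀ z ∈ O, (z : OnePoint ℂ) ∉ V) {z₀ : ℂ} (hz₀ : z₀ ∈ O) {x₀ : X}
    (hx₀ : C.proj x₀ = z₀) : ∃ s, C.IsSection s O ∧ s z₀ = x₀ := by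
  classical
  have := hs.simplyConnectedSpace
  have := hO.locallyPathConnectedSpace
  obtain ⟨F, ⟨h1, h2⟩, -⟩ := C.isCoveringMapOn.existsUnique_continuousMap_lifts
    (⟨fun z => ((z : ℂ) : OnePoint ℂ), OnePoint.continuous_coe.comp continuous_subtype_val⟩ :
      C(O, OnePoint ℂ)) (a₀ := ⟨z₀, hz₀⟩) (e₀ := x₀) hx₀ (fun a => hOV a a.2)
  let s : ℂ → X := fun z => if h : z ∈ O then F ⟨z, h⟩ else x₀
  have hs : ∀ z (h : z ∈ O), s z = F ⟨z, h⟩ := fun z h => dif_pos h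
  refine ⟨s, ⟨hO, ?_, ?_, hOV⟩, by rw [hs z₀ hz₀, h1]⟩
  · rw [continuousOn_iff_continuous_domRestrict]
    exact F.continuous.congr fun z => (hs z z.2).symm
  · intro z hz
    rw [hs z hz]
    exact congrFun h2 ⟨z, hz⟩

namespace IsSection

variable {C} {s s' : ℂ → X} {O O' : Set ℂ} (h : C.IsSection s O)
include h

theorem mono (hO' : IsOpen O') (hsub : O' ⊆ O) : C.IsSection s O' :=
  ⟨hO', h.continuousOn.mono hsub, fun z hz => h.proj_apply z (hsub hz),
    fun z hz => h.notMem z (hsub hz)⟩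

theorem shift (k : ZMod d) : C.IsSection (fun z => C.shift k (s z)) O :=
  ⟨h.isOpen, (C.continuous_shift k).comp_continuousOn h.continuousOn,
    fun z hz => by rw [C.proj_shift, h.proj_apply z hz], h.notMem⟩

theorem proj_notMem {z : ℂ} (hz : z ∈ O) : C.proj (s z) ∉ V := by
  rw [h.proj_apply z hz]; exact h.notMem z hz

/-- Near `s z` the projection is injective, so a point over `O` close to `s z` agrees with the value
of `s` below it. -/
theorem isOpen_image : IsOpen (s '' O) := by
  rw [isOpen_iff_mem_nhds]
  rintro _ ⟨z, hz, rfl⟩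
  obtain ⟨e, hze, he⟩ := C.isCoveringMapOn.isLocalHomeomorphOn (s z) (h.proj_notMem hz)
  have hW : IsOpen (O ∩ s ⁻¹' e.source) :=
    h.continuousOn.isOpen_inter_preimage h.isOpen e.open_source
  have hW' : IsOpen (((↑) : ℂ → OnePoint ℂ) '' (O ∩ s ⁻¹' e.source)) :=
    OnePoint.isOpenEmbedding_coe.isOpenMap _ hW
  have hmem : e.source ∩ C.proj ⁻¹' (((↑) : ℂ → OnePoint ℂ) '' (O ∩ s ⁻¹' e.source)) ∈ 𝓝 (s z) :=
    Filter.inter_mem (e.open_source.mem_nhds hze)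
      ((hW'.preimage C.continuous_proj).mem_nhds ⟨z, ⟨hz, hze⟩, (h.proj_apply z hz).symm⟩)
  refine Filter.mem_of_superset hmem ?_
  rintro y ⟨hy, w, ⟨hw, hws⟩, hwy⟩
  refine ⟨w, hw, e.injOn hws hy ?_⟩
  rw [← he]
  exact (h.proj_apply w hw).trans hwy

theorem isSimplyConnected_image (hO : IsSimplyConnected O) : IsSimplyConnected (s '' O) := by
  have hc : Continuous (fun z : O => s z) := continuousOn_iff_continuous_domRestrict.1 h.continuousOn
  have hemb : IsEmbedding (fun z : O => s z) := by
    refine IsEmbedding.of_comp hc C.continuous_proj ?_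
    have : C.proj ∘ (fun z : O => s z) = ((↑) : ℂ → OnePoint ℂ) ∘ Subtype.val :=
      funext fun z => h.proj_apply z z.2
    rw [this]
    exact OnePoint.isOpenEmbedding_coe.isEmbedding.comp IsEmbedding.subtypeVal
  have := (hemb.isSimplyConnected_image (s := Set.univ)).2 (by
    have := hO.simplyConnectedSpace
    exact (Homeomorph.Set.univ O).toHomotopyEquiv.simplyConnectedSpace)
  rwa [show (fun z : O => s z) '' Set.univ = s '' O by
    rw [Set.image_univ]
    ext; simp] at this

/-- Whether `s` and `s'` agree is a locally constant proposition: agreement is open as the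
projection is locally injective, and disagreement is open as `X` is Hausdorff. -/
theorem eqOn [T2Space X] (h' : C.IsSection s' O) (hO : IsPreconnected O) {z₀ : ℂ}
    (hz₀ : z₀ ∈ O) (he : s z₀ = s' z₀) : Set.EqOn s s' O := by
  intro z hz
  have key := hO.eq_of_eventually_eq (f := fun z => s z = s' z) (fun w hw => ?_) hz hz₀
  · exact key.mpr he
  · have hc := (h.continuousOn.continuousAt (h.isOpen.mem_nhds hw))
    have hc' := (h'.continuousOn.continuousAt (h.isOpen.mem_nhds hw))
    by_cases hww : s w = s' w
    · obtain ⟨e, hze, he⟩ := C.isCoveringMapOn.isLocalHomeomorphOn (s w) (h.proj_notMem hw)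
      filter_upwards [h.isOpen.mem_nhds hw, hc (e.open_source.mem_nhds hze),
        hc' (e.open_source.mem_nhds (hww ▸ hze))] with y hy h1 h2
      refine propext ⟨fun _ => hww, fun _ => e.injOn h1 h2 ?_⟩
      rw [← he, h.proj_apply y hy, h'.proj_apply y hy]
    · filter_upwards [(hc.tendsto.prodMk_nhds hc'.tendsto).eventually
          (isOpen_ne_fun continuous_fst continuous_snd |>.mem_nhds hww)] with y hy
      exact propext ⟨fun h => absurd h hy, fun h => absurd h hww⟩

end IsSection

end BranchedCover

/-! ### Disc neighbourhoods of the points of a fibre -/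

theorem isPreconnected_ball_diff_singleton (r : ℝ) :
    IsPreconnected (Metric.ball (0 : ℂ) r \ {0}) := by
  have : Metric.ball (0 : ℂ) r \ {0} = (fun p : ℝ × ℝ => (p.1 : ℂ) * Complex.exp (p.2 * Complex.I)) ''
      (Set.Ioo 0 r ×ˢ Set.univ) := by
    ext z
    constructor
    · rintro ⟨hz, h0⟩
      exact ⟨(‖z‖, z.arg), ⟨⟨norm_pos_iff.2 h0, mem_ball_zero_iff.1 hz⟩, trivial⟩,
        Complex.norm_mul_exp_arg_mul_I z⟩
    · rintro ⟨⟨ρ, θ⟩, ⟨⟨h1, h2⟩, -⟩, rfl⟩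
      have : ‖(ρ : ℂ) * Complex.exp (θ * Complex.I)‖ = ρ := by
        rw [norm_mul, Complex.norm_exp_ofReal_mul_I, mul_one, Complex.norm_real, Real.norm_eq_abs,
          abs_of_pos h1]
      refine ⟨mem_ball_zero_iff.2 (this.trans_lt h2), ?_⟩
      rw [Set.mem_singleton_iff, ← norm_eq_zero, this]
      exact h1.ne'
  rw [this]
  refine IsPreconnected.image ?_ _ (by fun_prop)
  exact isPreconnected_Ioo.prod isPreconnected_univ

/-- Every point can be moved radially into a small punctured ball inside `S`, which is connected by
polar coordinates. -/
theorem StarConvex.isPreconnected_diff_singleton {S : Set ℂ} (hS : StarConvex ℝ 0 S)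
    (ho : IsOpen S) (h0 : 0 ∈ S) : IsPreconnected (S \ {0}) := by
  obtain ⟨r, hr, hrS⟩ := Metric.isOpen_iff.1 ho 0 h0
  have hmem : ∀ t : ℝ, 0 < t → t < r → (t : ℂ) ∈ Metric.ball (0 : ℂ) r \ {0} := fun t ht htr => by
    refine ⟨mem_ball_zero_iff.2 ?_, by simpa using ht.ne'⟩
    rwa [Complex.norm_real, Real.norm_eq_abs, abs_of_pos ht]
  refine isPreconnected_of_forall ((r / 2 : ℝ) : ℂ) fun z hz => ?_
  have hz0 : 0 < ‖z‖ := norm_pos_iff.2 hz.2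
  refine ⟨(Metric.ball 0 r \ {0}) ∪ (fun t : ℝ => t • z) '' Set.Ioc 0 1, ?_,
    Or.inl (hmem _ (half_pos hr) (half_lt_self hr)), Or.inr ⟨1, by simp, one_smul _ _⟩, ?_⟩
  · rintro w (hw | ⟨t, ht, rfl⟩)
    · exact ⟨hrS hw.1, hw.2⟩
    · exact ⟨starConvex_zero_iff.1 hS hz.1 ht.1.le ht.2, smul_ne_zero ht.1.ne' hz.2⟩
  · have hpos : 0 < min 1 (r / 2 / ‖z‖) := lt_min one_pos (div_pos (half_pos hr) hz0)
    refine IsPreconnected.union (min 1 (r / 2 / ‖z‖) • z) ⟨mem_ball_zero_iff.2 ?_, ?_⟩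
      ⟨_, ⟨hpos, min_le_left _ _⟩, rfl⟩ (isPreconnected_ball_diff_singleton r)
      (isPreconnected_Ioc.image _ (by fun_prop))
    · rw [norm_smul, Real.norm_of_nonneg hpos.le]
      calc min 1 (r / 2 / ‖z‖) * ‖z‖ ≤ r / 2 / ‖z‖ * ‖z‖ := by gcongr; exact min_le_right _ _
        _ = r / 2 := div_mul_cancel₀ _ hz0.ne'
        _ < r := half_lt_self hr
    · exact smul_ne_zero hpos.ne' hz.2

theorem OpenPartialHomeomorph.isSimplyConnected_image {X Y : Type*} [TopologicalSpace X]
    [TopologicalSpace Y] (e : OpenPartialHomeomorph X Y) {S : Set X} (hS : IsSimplyConnected S)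
    (h : S ⊆ e.source) : IsSimplyConnected (e '' S) := by
  have h1 := e.isOpenEmbedding_restrict.isEmbedding.isSimplyConnected_image
    (s := (Subtype.val ⁻¹' S : Set e.source))
  have h2 := IsEmbedding.subtypeVal.isSimplyConnected_image
    (s := (Subtype.val ⁻¹' S : Set e.source))
  rw [Subtype.image_preimage_coe, Set.inter_eq_right.2 h] at h2
  have h3 : e '' S = e.source.domRestrict e '' (Subtype.val ⁻¹' S) := by
    ext y
    constructor
    · rintro ⟨x, hx, rfl⟩
      exact ⟨⟨x, h hx⟩, hx, rfl⟩
    · rintro ⟨x, hx, rfl⟩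
      exact ⟨x, hx, rfl⟩
  rw [h3]
  exact h1.2 (h2.1 hS)

namespace BranchedCover

variable {d : ℕ} {V : Set (OnePoint ℂ)} {X : Type*} [TopologicalSpace X]

/-- `D` assigns to the points over `v` disjoint disc neighbourhoods, which together make up the
preimage of the neighbourhood of `v` with coordinates in `B`. -/
structure IsDiscFamily (C : BranchedCover d V X) (v : OnePoint ℂ) (B : Set ℂ) (D : X → Set X) :
    Prop where
  mem : ∀ x, C.proj x = v → x ∈ D x
  isOpen : ∀ x, C.proj x = v → IsOpen (D x)
  isSimplyConnected : ∀ x, C.proj x = v → IsSimplyConnected (D x)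
  isPreconnected_diff : ∀ x, C.proj x = v → IsPreconnected (D x \ {x})
  unique : ∀ x x' y, C.proj x = v → C.proj x' = v → y ∈ D x → y ∈ D x' → x = x'
  proj_mem : ∀ x y, C.proj x = v → y ∈ D x → C.proj y ∈ sphereParam v '' B
  exists_mem : ∀ y, C.proj y ∈ sphereParam v '' B → ∃ x, C.proj x = v ∧ y ∈ D x

variable (C : BranchedCover d V X)

/-- In a chart where the projection is `ζ ↦ ζ ^ k`, the preimage of a star-shaped neighbourhood of
zero is star-shaped, hence simply connected and connected after removal of its centre. The fibre is
finite, so small charts are disjoint; compactness of `X` shows that they exhaust the preimage.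
General star-shaped `B` are needed because the neighbourhood of `∞` is the exterior of a square. -/
theorem exists_isDiscFamily [T2Space X] [CompactSpace X] (hV : V.Finite) (hd : 0 < d)
    (v : OnePoint ℂ) : ∃ ρ > 0, ∀ B : Set ℂ, IsOpen B → StarConvex ℝ 0 B → 0 ∈ B →
      B ⊆ Metric.ball 0 ρ → ∃ D, C.IsDiscFamily v B D := by
  choose k hk φ hφ h0 h using C.exists_chart
  have hfin : (C.proj ⁻¹' {v}).Finite := C.finite_fibre hV hd v
  obtain ⟨U, hU, hdisj⟩ := hfin.t2_separation
  have h0t : ∀ x, (0 : ℂ) ∈ (φ x).target := fun x => h0 x ▸ (φ x).map_source (hφ x)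
  have h0s : ∀ x, (φ x).symm 0 = x := fun x => by
    conv_rhs => rw [← (φ x).left_inv (hφ x), h0 x]
  have hρ : ∀ x, ∃ r > 0, Metric.ball 0 r ⊆ (φ x).target ∩ (φ x).symm ⁻¹' U x := fun x => by
    refine Metric.isOpen_iff.1 ((φ x).isOpen_inter_preimage_symm (hU x).2) 0 ⟨h0t x, ?_⟩
    rw [Set.mem_preimage, h0s]
    exact (hU x).1
  choose r hr hrs using hρ
  have hopen : ∀ x, ∀ S ⊆ Metric.ball 0 (r x), IsOpen S → IsOpen ((φ x).symm '' S) :=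
    fun x S hS hSo => (φ x).isOpen_image_symm_of_subset_target hSo
      (hS.trans ((hrs x).trans Set.inter_subset_left))
  -- The part of `X` outside the chart balls is compact, so its image is closed, and it misses `v`.
  let K : Set X := (⋃ x ∈ C.proj ⁻¹' {v}, (φ x).symm '' Metric.ball 0 (r x))ᶜ
  have hK : IsClosed (C.proj '' K) := by
    refine ((IsClosed.isCompact ?_).image C.continuous_proj).isClosed
    exact (isOpen_biUnion fun x _ => hopen x _ le_rfl Metric.isOpen_ball).isClosed_compl
  have hvK : v ∉ C.proj '' K := by
    rintro ⟨x, hx, hxv⟩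
    exact hx (Set.mem_biUnion hxv ⟨0, Metric.mem_ball_self (hr x), h0s x⟩)
  obtain ⟨ρ₀, hρ₀, hρ₀K⟩ := Metric.isOpen_iff.1
    (hK.isOpen_compl.preimage (continuous_sphereParam v)) 0
    (by rwa [Set.mem_preimage, sphereParam_zero])
  -- The bound `r x ^ k x` confines the `k x`-th roots of points of `B` to the ball of radius `r x`.
  have hev : ∀ᶠ ρ in 𝓝[>] (0 : ℝ), ρ ≤ ρ₀ ∧ ∀ x ∈ C.proj ⁻¹' {v}, ρ ≤ r x ^ k x := by
    have hle : ∀ a : ℝ, 0 < a → ∀ᶠ ρ in 𝓝[>] (0 : ℝ), ρ ≤ a := fun a ha => by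
      filter_upwards [Ioc_mem_nhdsGT ha] with ρ hρ using hρ.2
    exact (hle _ hρ₀).and ((hfin.eventually_all).2 fun x _ => hle _ (pow_pos (hr x) _))
  obtain ⟨ρ, ⟨hρ1, hρ2⟩, hρ⟩ := (hev.and self_mem_nhdsWithin).exists
  refine ⟨ρ, hρ, fun B hBo hBs hB0 hB => ?_⟩
  let S : X → Set ℂ := fun x => {ζ | ζ ^ k x ∈ B}
  have hSr : ∀ x, C.proj x = v → S x ⊆ Metric.ball 0 (r x) := fun x hx ζ hζ => by
    have := mem_ball_zero_iff.1 (hB hζ)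
    rw [norm_pow] at this
    exact mem_ball_zero_iff.2 (lt_of_pow_lt_pow_left₀ _ (hr x).le (this.trans_le (hρ2 x hx)))
  have hS0 : ∀ x, (0 : ℂ) ∈ S x := fun x => by
    change (0 : ℂ) ^ k x ∈ B
    rwa [zero_pow (hk x).ne']
  have hSo : ∀ x, IsOpen (S x) := fun x => hBo.preimage (continuous_pow _)
  have hSs : ∀ x, StarConvex ℝ 0 (S x) := fun x => by
    refine starConvex_zero_iff.2 fun ζ hζ a ha ha1 => ?_
    change (a • ζ) ^ k x ∈ B
    rw [smul_pow]
    exact starConvex_zero_iff.1 hBs hζ (pow_nonneg ha _) (pow_le_one₀ ha ha1)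
  have htgt : ∀ x, C.proj x = v → S x ⊆ (φ x).target := fun x hx =>
    (hSr x hx).trans ((hrs x).trans Set.inter_subset_left)
  refine ⟨fun x => (φ x).symm '' S x, ?_, ?_, ?_, ?_, ?_, ?_, ?_⟩
  · exact fun x _ => ⟨0, hS0 x, h0s x⟩
  · exact fun x hx => hopen x _ (hSr x hx) (hSo x)
  · exact fun x hx => (φ x).symm.isSimplyConnected_image
      ((hSs x).isSimplyConnected ⟨0, hS0 x⟩) (htgt x hx)
  · intro x hx
    have : (φ x).symm '' S x \ {x} = (φ x).symm '' (S x \ {0}) := by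
      rw [((φ x).symm.injOn.mono (htgt x hx)).image_sdiff_subset (by simpa using hS0 x),
        Set.image_singleton, h0s]
    rw [this]
    exact ((hSs x).isPreconnected_diff_singleton (hSo x) (hS0 x)).image _
      ((φ x).symm.continuousOn.mono (Set.sdiff_subset.trans (htgt x hx)))
  · rintro x x' y hx hx' ⟨ζ, hζ, rfl⟩ ⟨ζ', hζ', he⟩
    by_contra hne
    refine Set.disjoint_left.1 (hdisj hx hx' hne) (hrs x (hSr x hx hζ)).2 ?_
    rw [← he]
    exact (hrs x' (hSr x' hx' hζ')).2
  · rintro x _ hx ⟨ζ, hζ, rfl⟩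
    have ht := htgt x hx hζ
    refine ⟨ζ ^ k x, hζ, ?_⟩
    rw [h x _ ((φ x).map_target ht), (φ x).right_inv ht, hx]
  · rintro y ⟨w, hw, hwy⟩
    have hyK : y ∉ K := fun hy => hρ₀K (Metric.ball_subset_ball hρ1 (hB hw)) ⟨y, hy, hwy.symm⟩
    rw [Set.notMem_compl_iff] at hyK
    obtain ⟨x, hx, ζ, hζ, rfl⟩ := Set.mem_iUnion₂.1 hyK
    have ht := (hrs x hζ).1
    refine ⟨x, hx, ζ, ?_, rfl⟩
    rw [h x _ ((φ x).map_target ht), (φ x).right_inv ht, (hx : C.proj x = v)] at hwy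
    change ζ ^ k x ∈ B
    rwa [← sphereParam_injective v hwy]

namespace IsDiscFamily

variable {C} {v : OnePoint ℂ} {B : Set ℂ} {D : X → Set X} (h : C.IsDiscFamily v B D)
include h

/-- The discs are open, disjoint, and cover the whole preimage, so a connected set over the
neighbourhood lies in one of them. -/
theorem exists_subset {S : Set X} (hS : IsPreconnected S) (hne : S.Nonempty)
    (hSB : ∀ y ∈ S, C.proj y ∈ sphereParam v '' B) : ∃ x, C.proj x = v ∧ S ⊆ D x := by
  obtain ⟨y₀, hy₀⟩ := hne
  obtain ⟨x, hx, hxy₀⟩ := h.exists_mem y₀ (hSB y₀ hy₀)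
  refine ⟨x, hx, fun y hy => ?_⟩
  have := hS.eq_of_eventually_eq (f := fun z => z ∈ D x) (fun z hz => ?_) hy hy₀
  · exact this.mpr hxy₀
  · obtain ⟨x', hx', hzx'⟩ := h.exists_mem z (hSB z hz)
    filter_upwards [(h.isOpen x' hx').mem_nhds hzx'] with w hw
    refine propext ⟨fun hwx => ?_, fun hzx => ?_⟩
    · rwa [h.unique x x' w hx hx' hwx hw]
    · rwa [h.unique x x' z hx hx' hzx hzx']

/-- Deck transformations permute the discs: the image of a disc is connected, hence lies in the disc
around the image of the centre. -/
theorem iterate_mem (m : ℕ) {x y : X} (hx : C.proj x = v) (hy : y ∈ D x) :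
    C.deck^[m] y ∈ D (C.deck^[m] x) := by
  obtain ⟨x', hx', hsub⟩ := h.exists_subset (S := C.deck^[m] '' D x)
    (((h.isSimplyConnected x hx).isPathConnected.isConnected.isPreconnected).image _
      (C.continuous_iterate m).continuousOn) ⟨_, x, h.mem x hx, rfl⟩ (by
      rintro _ ⟨z, hz, rfl⟩
      rw [C.proj_iterate]
      exact h.proj_mem x z hx hz)
  have hmx : C.proj (C.deck^[m] x) = v := by rw [C.proj_iterate, hx]
  have := h.unique _ _ _ hmx hx' (h.mem _ hmx) (hsub ⟨x, h.mem x hx, rfl⟩)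
  rw [this]
  exact hsub ⟨y, hy, rfl⟩

end IsDiscFamily

end BranchedCover

/-! ### Vertices, the neighbourhood of infinity, and sections over slits -/

/-- The finite points `q i` of the sphere, together with `∞`. -/
def vertices {N : ℕ} (q : Fin N → ℂ) : Set (OnePoint ℂ) :=
  insert OnePoint.infty (Set.range fun i => (q i : OnePoint ℂ))

theorem finite_vertices {N : ℕ} (q : Fin N → ℂ) : (vertices q).Finite :=
  (Set.finite_range _).insert _

theorem coe_mem_vertices {N : ℕ} {q : Fin N → ℂ} {z : ℂ} :
    (z : OnePoint ℂ) ∈ vertices q ↔ ∃ i, q i = z := by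
  simp [vertices]

/-- The coordinates at `∞` of the points outside a square. -/
def inftyNhd (R : ℝ) : Set ℂ := {w | w ≠ 0 → w⁻¹ ∈ outsideSquare R}

theorem coe_mem_image_inftyNhd {R : ℝ} (hR : 0 ≤ R) {z : ℂ} :
    (z : OnePoint ℂ) ∈ sphereParam OnePoint.infty '' inftyNhd R ↔ z ∈ outsideSquare R := by
  constructor
  · rintro ⟨w, hw, hwz⟩
    by_cases h0 : w = 0
    · rw [h0, sphereParam_infty_zero] at hwz
      exact absurd hwz (OnePoint.infty_ne_coe _)
    · rw [sphereParam_infty_of_ne h0] at hwz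
      exact OnePoint.coe_injective hwz ▸ hw h0
  · intro hz
    have hz0 : z ≠ 0 := by
      rintro rfl
      rcases hz with h | h <;> simp at h <;> linarith
    exact ⟨z⁻¹, fun _ => by rwa [inv_inv], by
      rw [sphereParam_infty_of_ne (inv_ne_zero hz0), inv_inv]⟩

theorem zero_mem_inftyNhd (R : ℝ) : (0 : ℂ) ∈ inftyNhd R := fun h => absurd rfl h

theorem inftyNhd_subset_ball {R ρ : ℝ} (hρ : 0 < ρ) (hR : ρ⁻¹ ≤ R) :
    inftyNhd R ⊆ Metric.ball 0 ρ := by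
  intro w hw
  rw [mem_ball_zero_iff]
  by_cases h0 : w = 0
  · simpa [h0] using hρ
  · have h1 : R < ‖w‖⁻¹ := by
      rw [← norm_inv]
      rcases hw h0 with h | h
      · exact h.trans_le (Complex.abs_re_le_norm _)
      · exact h.trans_le (Complex.abs_im_le_norm _)
    exact (inv_lt_inv₀ hρ (norm_pos_iff.2 h0)).1 (hR.trans_lt h1)

theorem outsideSquare_smul {R : ℝ} (hR : 0 ≤ R) {z : ℂ} (hz : z ∈ outsideSquare R) {a : ℝ}
    (ha : 1 ≤ a) : a • z ∈ outsideSquare R := by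
  have key : ∀ x : ℝ, R < |x| → R < |a * x| := fun x hx => by
    rw [abs_mul, abs_of_nonneg (by linarith)]
    nlinarith
  exact hz.imp (fun h => by simpa using key _ h) (fun h => by simpa using key _ h)

theorem starConvex_inftyNhd {R : ℝ} (hR : 0 ≤ R) : StarConvex ℝ 0 (inftyNhd R) := by
  refine starConvex_zero_iff.2 fun w hw a ha ha1 h => ?_
  have ha0 : a ≠ 0 := fun h0 => h (by rw [h0, zero_smul])
  have hw0 : w ≠ 0 := fun h0 => h (by rw [h0, smul_zero])
  have : (a • w)⁻¹ = a⁻¹ • w⁻¹ := by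
    rw [Complex.real_smul, Complex.real_smul, mul_inv, Complex.ofReal_inv]
  rw [this]
  exact outsideSquare_smul hR (hw hw0) ((one_le_inv₀ (ha.lt_of_ne' ha0)).2 ha1)

/-- Expanding `w⁻¹` turns the condition into strict inequalities between continuous functions. The
third of them implies one of the other two when `w ≠ 0`, and serves only to include `w = 0`. -/
theorem isOpen_inftyNhd {R : ℝ} (hR : 0 ≤ R) : IsOpen (inftyNhd R) := by
  have h : ∀ w : ℂ, w ∈ inftyNhd R ↔
      R * ‖w‖ ^ 2 < |w.re| ∨ R * ‖w‖ ^ 2 < |w.im| ∨ ‖w‖ < (R + 1)⁻¹ / 2 := by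
    intro w
    by_cases h0 : w = 0
    · subst h0
      have : 0 < (R + 1)⁻¹ / 2 := by positivity
      simp [zero_mem_inftyNhd, this]
    · have hn : 0 < ‖w‖ ^ 2 := by positivity
      have key : ∀ x : ℝ, R < |x / ‖w‖ ^ 2| ↔ R * ‖w‖ ^ 2 < |x| := fun x => by
        rw [abs_div, abs_of_pos hn, lt_div_iff₀ hn]
      have h1 : w ∈ inftyNhd R ↔ R * ‖w‖ ^ 2 < |w.re| ∨ R * ‖w‖ ^ 2 < |w.im| := by
        rw [← key, ← key]
        simp [inftyNhd, outsideSquare, h0, Complex.inv_re, Complex.inv_im,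
          Complex.normSq_eq_norm_sq, neg_div, abs_neg]
      rw [h1, ← or_assoc]
      refine (or_iff_left_of_imp fun h2 => ?_).symm
      by_contra! h3
      have h4 := Complex.norm_le_abs_re_add_abs_im w
      have h5 : 0 < ‖w‖ := norm_pos_iff.2 h0
      have h6 : ‖w‖ * (R + 1) < 1 / 2 := by
        have : 0 < R + 1 := by linarith
        calc ‖w‖ * (R + 1) < (R + 1)⁻¹ / 2 * (R + 1) := by gcongr
          _ = 1 / 2 := by field_simp
      nlinarith
  rw [show inftyNhd R = {w : ℂ | R * ‖w‖ ^ 2 < |w.re|} ∪ ({w : ℂ | R * ‖w‖ ^ 2 < |w.im|} ∪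
    {w : ℂ | ‖w‖ < (R + 1)⁻¹ / 2}) from Set.ext h]
  refine .union (isOpen_lt (by fun_prop) (by fun_prop)) (.union (isOpen_lt (by fun_prop) ?_)
    (isOpen_lt (by fun_prop) (by fun_prop)))
  fun_prop

theorem coe_mem_image_ball {a z : ℂ} {ε : ℝ} :
    (z : OnePoint ℂ) ∈ sphereParam a '' Metric.ball 0 ε ↔ z ∈ Metric.ball a ε := by
  constructor
  · rintro ⟨w, hw, hwz⟩
    rw [sphereParam_coe] at hwz
    rw [← OnePoint.coe_injective hwz]
    simpa using hw
  · intro hz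
    exact ⟨z - a, by simpa [dist_eq_norm] using hz, by rw [sphereParam_coe, add_sub_cancel]⟩

/-- Sections of a branched cover of the sphere over the slit plane and over the vertical bands
around the slits, together with disc neighbourhoods of the points over the vertices. -/
structure SlitSections {d : ℕ} {X : Type*} [TopologicalSpace X] {N : ℕ} {q : Fin N → ℂ}
    (C : BranchedCover d (vertices q) X) (ε R : ℝ) where
  params : SlitParams q ε R
  s : ℂ → X
  t : Fin N → ℂ → X
  c : Fin N → ZMod d
  D : X → Set X
  isSection_s : C.IsSection s (upSlitPlane q)
  isSection_t : ∀ i, C.IsSection (t i) (upBand (q i) ε)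
  t_left : ∀ i, Set.EqOn (t i) s (upBandLeft (q i) ε)
  t_right : ∀ i, Set.EqOn (t i) (fun z => C.shift (c i) (s z)) (upBandRight (q i) ε)
  disc_coe : ∀ i, C.IsDiscFamily (q i) (Metric.ball 0 ε) D
  disc_infty : C.IsDiscFamily OnePoint.infty (inftyNhd R) D

theorem upBandLeft_nonempty {a : ℂ} {ε : ℝ} (hε : 0 < ε) : (upBandLeft a ε).Nonempty :=
  ⟨⟨a.re - ε / 2, a.im + 1⟩, by simp [hε], by simp [hε], by simp⟩

theorem upBandRight_nonempty {a : ℂ} {ε : ℝ} (hε : 0 < ε) : (upBandRight a ε).Nonempty :=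
  ⟨⟨a.re + ε / 2, a.im + 1⟩, by simp [hε], by simp [hε], by simp⟩

section

variable {d : ℕ} {X : Type*} [TopologicalSpace X] [T2Space X] {N : ℕ} {q : Fin N → ℂ}

/-- The slit plane and the bands are simply connected and contain no vertices, so sections exist;
those over the bands continue `s` from the left halves. On a connected right half two sections
differ by a constant power of the deck transformation, which gives the jump `c i`. The discs fix how
small `ε` and how large `R` must be. -/
theorem exists_slitSections [CompactSpace X] [NeZero d] (hq : StrictMono fun i => (q i).re)
    (C : BranchedCover d (vertices q) X) : ∃ ε R, Nonempty (SlitSections C ε R) := by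
  have hV := finite_vertices q
  have hd : 0 < d := NeZero.pos d
  choose ρ hρ hD using C.exists_isDiscFamily hV hd
  have hε : ∃ ε₀ > 0, ∀ i, ε₀ ≤ ρ (q i) := by
    have hle : ∀ᶠ ε in 𝓝[>] (0 : ℝ), ∀ i, ε ≤ ρ (q i) := Filter.eventually_all.2 fun i => by
      filter_upwards [Ioc_mem_nhdsGT (hρ (q i))] with ρ hρ using hρ.2
    obtain ⟨ε, h1, h2⟩ := (hle.and self_mem_nhdsWithin).exists
    exact ⟨ε, h2, h1⟩
  obtain ⟨ε₀, hε₀, hε₀ρ⟩ := hε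
  obtain ⟨ε, R, hε, hR, P⟩ := exists_slitParams q hq (R₀ := (ρ OnePoint.infty)⁻¹) hε₀
  have hR0 : 0 ≤ R := (inv_pos.2 (hρ _)).le.trans hR
  have hD1 : ∀ i, ∃ D, C.IsDiscFamily (q i) (Metric.ball 0 ε) D := fun i =>
    hD (q i) _ Metric.isOpen_ball ((convex_ball _ _).starConvex (Metric.mem_ball_self P.pos))
      (Metric.mem_ball_self P.pos) (Metric.ball_subset_ball (hε.trans (hε₀ρ i)))
  obtain ⟨Dinf, hDinf⟩ := hD OnePoint.infty _ (isOpen_inftyNhd hR0) (starConvex_inftyNhd hR0)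
    (zero_mem_inftyNhd R) (inftyNhd_subset_ball (hρ _) hR)
  choose D' hD' using hD1
  classical
  let D : X → Set X := fun x =>
    if h : ∃ i, C.proj x = q i then D' h.choose x else Dinf x
  have hDi : ∀ i x, C.proj x = q i → D x = D' i x := fun i x hx => by
    have h : ∃ i, C.proj x = q i := ⟨i, hx⟩
    have h2 : h.choose = i := by
      have := OnePoint.coe_injective (h.choose_spec.symm.trans hx)
      exact hq.injective (congrArg Complex.re this)
    simp only [D, dif_pos h, h2]
  have hDinf' : ∀ x, C.proj x = OnePoint.infty → D x = Dinf x := fun x hx => by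
    have h : ¬∃ i, C.proj x = q i := by
      rintro ⟨i, hi⟩
      exact OnePoint.infty_ne_coe _ (hx.symm.trans hi)
    simp only [D, dif_neg h]
  have congrD : ∀ {v B D₁}, C.IsDiscFamily v B D₁ → (∀ x, C.proj x = v → D x = D₁ x) →
      C.IsDiscFamily v B D := fun {v B D₁} h he =>
    ⟨fun x hx => by rw [he x hx]; exact h.mem x hx,
      fun x hx => by rw [he x hx]; exact h.isOpen x hx,
      fun x hx => by rw [he x hx]; exact h.isSimplyConnected x hx,
      fun x hx => by rw [he x hx]; exact h.isPreconnected_diff x hx,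
      fun x x' y hx hx' => by rw [he x hx, he x' hx']; exact h.unique x x' y hx hx',
      fun x y hx => by rw [he x hx]; exact h.proj_mem x y hx,
      fun y hy => by
        obtain ⟨x, hx, hxy⟩ := h.exists_mem y hy
        exact ⟨x, hx, by rwa [he x hx]⟩⟩
  obtain ⟨z₀, hz₀⟩ := (isSimplyConnected_upSlitPlane q).nonempty
  obtain ⟨x₀, hx₀⟩ := C.surjective_proj z₀
  obtain ⟨s, hs, -⟩ := C.exists_section (isOpen_upSlitPlane q) (isSimplyConnected_upSlitPlane q)
    (fun z hz => by
      rw [coe_mem_vertices]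
      rintro ⟨i, rfl⟩
      exact SlitParams.notMem_upSlitPlane i hz) hz₀ hx₀
  have ht : ∀ i, ∃ t, C.IsSection t (upBand (q i) ε) ∧ Set.EqOn t s (upBandLeft (q i) ε) := by
    intro i
    obtain ⟨z, hz⟩ := upBandLeft_nonempty (a := q i) P.pos
    have hzs := P.upBandLeft_subset_slitPlane i hz
    obtain ⟨t, ht, htz⟩ := C.exists_section (isOpen_upBand (q i) ε)
      ((convex_upBand (q i) ε).isSimplyConnected ⟨z, upBandLeft_subset _ _ hz⟩)
      (fun z hz => by
        rw [coe_mem_vertices]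
        rintro ⟨j, rfl⟩
        exact P.notMem_upBand j i hz) (upBandLeft_subset _ _ hz) (hs.proj_apply z hzs)
    exact ⟨t, ht, (ht.mono (isOpen_upBandLeft _ _) (upBandLeft_subset _ _)).eqOn
      (hs.mono (isOpen_upBandLeft _ _) (P.upBandLeft_subset_slitPlane i))
      (convex_upBandLeft _ _).isPreconnected hz htz⟩
  choose t ht htl using ht
  have hc : ∀ i, ∃ c, Set.EqOn (t i) (fun z => C.shift c (s z)) (upBandRight (q i) ε) := by
    intro i
    obtain ⟨z, hz⟩ := upBandRight_nonempty (a := q i) P.pos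
    have hzs := P.upBandRight_subset_slitPlane i hz
    have hzt := upBandRight_subset _ _ hz
    obtain ⟨c, hc⟩ := C.exists_shift_eq hV
      ((hs.proj_apply z hzs).trans ((ht i).proj_apply z hzt).symm)
    exact ⟨c, ((ht i).mono (isOpen_upBandRight _ _) (upBandRight_subset _ _)).eqOn
      ((hs.shift c).mono (isOpen_upBandRight _ _) (P.upBandRight_subset_slitPlane i))
      (convex_upBandRight _ _).isPreconnected hz hc.symm⟩
  choose c hc using hc
  exact ⟨ε, R, ⟨⟨P, s, t, c, D, hs, ht, htl, hc, fun i => congrD (hD' i) (hDi i),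
    congrD hDinf hDinf'⟩⟩⟩

end

namespace BranchedCover.IsSection

variable {d : ℕ} {V : Set (OnePoint ℂ)} {X : Type*} [TopologicalSpace X]
  {C : BranchedCover d V X} {s : ℂ → X} {O : Set ℂ}

theorem eq_of_shift_eq [T2Space X] [NeZero d] (hV : V.Finite) (h : C.IsSection s O) {z z' : ℂ}
    (hz : z ∈ O) (hz' : z' ∈ O) {k k' : ZMod d} (he : C.shift k (s z) = C.shift k' (s z')) :
    z = z' ∧ k = k' := by
  have h1 : z = z' := by
    apply OnePoint.coe_injective
    rw [← h.proj_apply z hz, ← h.proj_apply z' hz', ← C.proj_shift k, he, C.proj_shift]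
  subst h1
  exact ⟨rfl, C.shift_injective_left hV (h.proj_notMem hz) he⟩

theorem proj_shift_apply (h : C.IsSection s O) {z : ℂ} (hz : z ∈ O) (k : ZMod d) :
    C.proj (C.shift k (s z)) = z := by rw [C.proj_shift, h.proj_apply z hz]

end BranchedCover.IsSection

/-! ### The slit cover of a branched cover -/

namespace SlitSections

variable {d : ℕ} {X : Type*} [TopologicalSpace X] {N : ℕ} {q : Fin N → ℂ}
  {C : BranchedCover d (vertices q) X} {ε R : ℝ} (S : SlitSections C ε R)

/-- The sheets of the cover over the slit plane. -/
def sheet (k : ZMod d) : Set X := (fun z => C.shift k (S.s z)) '' upSlitPlane q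

/-- The sheets of the cover over a part of a band. -/
def bandOver (O : Fin N → Set ℂ) (e : Fin N × ZMod d) : Set X :=
  (fun z => C.shift e.2 (S.t e.1 z)) '' (upBand (q e.1) ε ∩ O e.1)

/-- The sheets of the cover over a part of the slit plane. -/
def sheetOver (O : Fin N → Set ℂ) (e : Fin N × ZMod d) : Set X :=
  (fun z => C.shift e.2 (S.s z)) '' (upSlitPlane q ∩ O e.1)

/-- Going around a finite vertex changes the sheet. -/
def permIn : Equiv.Perm (Fin N × ZMod d) :=
  Equiv.prodShear (Equiv.refl _) fun i => Equiv.addRight (S.c i)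

/-- Going around `∞` changes the gap and the sheet. -/
def permOut [NeZero N] : Equiv.Perm (Fin N × ZMod d) :=
  Equiv.prodShear (Equiv.addRight 1) fun i => Equiv.addRight (S.c i)

theorem permIn_apply (e : Fin N × ZMod d) : S.permIn e = (e.1, e.2 + S.c e.1) := rfl

theorem permOut_apply [NeZero N] (e : Fin N × ZMod d) : S.permOut e = (e.1 + 1, e.2 + S.c e.1) :=
  rfl

theorem isOpen_bandOver {O : Fin N → Set ℂ} (hO : ∀ i, IsOpen (O i)) (e : Fin N × ZMod d) :
    IsOpen (S.bandOver O e) :=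
  (((S.isSection_t e.1).shift e.2).mono ((isOpen_upBand _ _).inter (hO e.1))
    Set.inter_subset_left).isOpen_image

theorem isOpen_sheetOver {O : Fin N → Set ℂ} (hO : ∀ i, IsOpen (O i)) (e : Fin N × ZMod d) :
    IsOpen (S.sheetOver O e) :=
  ((S.isSection_s.shift e.2).mono ((isOpen_upSlitPlane _).inter (hO e.1))
    Set.inter_subset_left).isOpen_image

theorem isPreconnected_bandOver {O : Fin N → Set ℂ}
    (hO : ∀ i, IsPreconnected (upBand (q i) ε ∩ O i)) (e : Fin N × ZMod d) :
    IsPreconnected (S.bandOver O e) :=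
  (hO e.1).image _ (((S.isSection_t e.1).shift e.2).continuousOn.mono Set.inter_subset_left)

theorem isPreconnected_sheetOver {O : Fin N → Set ℂ}
    (hO : ∀ i, IsPreconnected (upSlitPlane q ∩ O i)) (e : Fin N × ZMod d) :
    IsPreconnected (S.sheetOver O e) :=
  (hO e.1).image _ ((S.isSection_s.shift e.2).continuousOn.mono Set.inter_subset_left)

theorem bandOver_mono {O O' : Fin N → Set ℂ} (e : Fin N × ZMod d) (h : O e.1 ⊆ O' e.1) :
    S.bandOver O e ⊆ S.bandOver O' e :=
  Set.image_mono (Set.inter_subset_inter_right _ h)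

theorem sheetOver_subset_sheet (O : Fin N → Set ℂ) (e : Fin N × ZMod d) :
    S.sheetOver O e ⊆ S.sheet e.2 := Set.image_mono Set.inter_subset_left

theorem mem_bandOver_inter {O O' : Fin N → Set ℂ} {e : Fin N × ZMod d} {x : X}
    (h : x ∈ S.bandOver O e) (h' : x ∈ S.bandOver O' e) :
    ∃ z ∈ upBand (q e.1) ε, z ∈ O e.1 ∧ z ∈ O' e.1 ∧ C.shift e.2 (S.t e.1 z) = x := by
  obtain ⟨z, hz, rfl⟩ := h
  obtain ⟨z', hz', he⟩ := h'
  have hzz' : z = z' := by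
    apply OnePoint.coe_injective
    rw [← (S.isSection_t e.1).proj_shift_apply hz.1 e.2,
      ← (S.isSection_t e.1).proj_shift_apply hz'.1 e.2]
    exact congrArg C.proj he.symm
  subst hzz'
  exact ⟨z, hz.1, hz.2, hz'.2, rfl⟩

variable [T2Space X] [NeZero d]

omit [T2Space X] [NeZero d] in
theorem isOpen_sheet (k : ZMod d) : IsOpen (S.sheet k) := (S.isSection_s.shift k).isOpen_image

theorem bandOver_unique {O O' : Fin N → Set ℂ} {e e' : Fin N × ZMod d} {x : X}
    (h : x ∈ S.bandOver O e) (h' : x ∈ S.bandOver O' e') : e = e' := by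
  obtain ⟨i, k⟩ := e
  obtain ⟨i', k'⟩ := e'
  obtain ⟨z, hz, rfl⟩ := h
  obtain ⟨z', hz', he⟩ := h'
  have hzz' : z = z' := by
    apply OnePoint.coe_injective
    rw [← (S.isSection_t i).proj_shift_apply hz.1 k,
      ← (S.isSection_t i').proj_shift_apply hz'.1 k']
    exact congrArg C.proj he.symm
  subst hzz'
  obtain rfl : i = i' := S.params.eq_of_re_sub_lt hz.1.1 hz'.1.1
  exact congrArg (Prod.mk i)
    ((S.isSection_t i).eq_of_shift_eq (finite_vertices q) hz.1 hz'.1 he.symm).2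

theorem sheet_unique {k k' : ZMod d} {x : X} (h : x ∈ S.sheet k) (h' : x ∈ S.sheet k') :
    k = k' := by
  obtain ⟨z, hz, rfl⟩ := h
  obtain ⟨z', hz', he⟩ := h'
  exact (S.isSection_s.eq_of_shift_eq (finite_vertices q) hz hz' he.symm).2

theorem sheetOver_unique {O : Fin N → Set ℂ} (hO : ∀ i j z, z ∈ O i → z ∈ O j → i = j)
    {e e' : Fin N × ZMod d} {x : X}
    (h : x ∈ S.sheetOver O e) (h' : x ∈ S.sheetOver O e') : e = e' := by
  obtain ⟨i, k⟩ := e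
  obtain ⟨i', k'⟩ := e'
  obtain ⟨z, hz, rfl⟩ := h
  obtain ⟨z', hz', he⟩ := h'
  obtain ⟨rfl, rfl⟩ := S.isSection_s.eq_of_shift_eq (finite_vertices q) hz.1 hz'.1 he.symm
  rw [hO i i' z hz.2 hz'.2]

omit [T2Space X] [NeZero d] in
theorem shift_t_left {i : Fin N} {z : ℂ} (hz : z ∈ upBandLeft (q i) ε) (l : ZMod d) :
    C.shift l (S.t i z) = C.shift l (S.s z) := by rw [S.t_left i hz]

theorem shift_t_right {i : Fin N} {z : ℂ} (hz : z ∈ upBandRight (q i) ε) (l : ZMod d) :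
    C.shift l (S.t i z) = C.shift (l + S.c i) (S.s z) := by
  rw [C.shift_add (finite_vertices q), S.t_right i hz]

/-- The left half of a sheet over a band. -/
abbrev left (e : Fin N × ZMod d) : Set X := S.bandOver (fun i => upBandLeft (q i) ε) e

/-- The right half of a sheet over a band. -/
abbrev right (e : Fin N × ZMod d) : Set X := S.bandOver (fun i => upBandRight (q i) ε) e

omit [T2Space X] [NeZero d] in
theorem bandOver_inter_left {O O' : Fin N → Set ℂ} (e : Fin N × ZMod d)
    (h : upBandLeft (q e.1) ε ∩ O e.1 ⊆ O' e.1) : S.bandOver O e ∩ S.left e ⊆ S.sheetOver O' e := by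
  rintro x ⟨h1, h2⟩
  obtain ⟨z, -, hz1, hz2, rfl⟩ := S.mem_bandOver_inter h1 h2
  -- The section over the band continues `s` across the left half, so no change of sheet occurs
  -- there.
  exact ⟨z, ⟨S.params.upBandLeft_subset_slitPlane _ hz2, h ⟨hz2, hz1⟩⟩, (S.shift_t_left hz2 _).symm⟩

theorem bandOver_inter_right {O O' : Fin N → Set ℂ} (e e' : Fin N × ZMod d)
    (he : e'.2 = e.2 + S.c e.1) (h : upBandRight (q e.1) ε ∩ O e.1 ⊆ O' e'.1) :
    S.bandOver O e ∩ S.right e ⊆ S.sheetOver O' e' := by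
  rintro x ⟨h1, h2⟩
  obtain ⟨z, -, hz1, hz2, rfl⟩ := S.mem_bandOver_inter h1 h2
  exact ⟨z, ⟨S.params.upBandRight_subset_slitPlane _ hz2, h ⟨hz2, hz1⟩⟩, by
    simp only [he, S.shift_t_right hz2]⟩

omit [T2Space X] [NeZero d] in
theorem left_subset_sheet (e : Fin N × ZMod d) : S.left e ⊆ S.sheet e.2 := by
  rintro _ ⟨z, hz, rfl⟩
  exact ⟨z, S.params.upBandLeft_subset_slitPlane _ hz.2, (S.shift_t_left hz.2 _).symm⟩

theorem right_subset_sheet (e : Fin N × ZMod d) : S.right e ⊆ S.sheet (e.2 + S.c e.1) := by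
  rintro _ ⟨z, hz, rfl⟩
  exact ⟨z, S.params.upBandRight_subset_slitPlane _ hz.2, (S.shift_t_right hz.2 _).symm⟩

omit [T2Space X] [NeZero d] in
theorem bandOver_inter_sheet {O : Fin N → Set ℂ} {e : Fin N × ZMod d} {k : ZMod d} {x : X}
    (h : x ∈ S.bandOver O e) (h' : x ∈ S.sheet k) : x ∈ S.left e ∨ x ∈ S.right e := by
  obtain ⟨z, hz, rfl⟩ := h
  obtain ⟨z', hz', he⟩ := h'
  have hzz' : z = z' := by
    apply OnePoint.coe_injective
    rw [← (S.isSection_t e.1).proj_shift_apply hz.1 e.2, ← S.isSection_s.proj_shift_apply hz' k]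
    exact congrArg C.proj he.symm
  subst hzz'
  rcases SlitParams.left_or_right hz.1 hz' with h | h
  · exact Or.inl ⟨z, ⟨hz.1, h⟩, rfl⟩
  · exact Or.inr ⟨z, ⟨hz.1, h⟩, rfl⟩

omit [T2Space X] [NeZero d] in
theorem mem_disc_coe {i : Fin N} {x : X} (hx : C.proj x = q i) {y : X} (hy : y ∈ S.D x) :
    ∃ z ∈ Metric.ball (q i) ε, C.proj y = z := by
  obtain ⟨w, hw, hwy⟩ := (S.disc_coe i).proj_mem x y hx hy
  rw [sphereParam_coe] at hwy
  exact ⟨q i + w, by simpa using hw, hwy.symm⟩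

variable [NeZero N]

omit [T2Space X] [NeZero d] in
include S in
theorem R_nonneg : 0 ≤ R := by
  linarith [S.params.re_lt 0, abs_nonneg (q 0).re, S.params.pos]

omit [T2Space X] [NeZero d] in
theorem mem_disc_infty {x : X} (hx : C.proj x = OnePoint.infty) {y : X} (hy : y ∈ S.D x) {z : ℂ}
    (hz : C.proj y = z) : z ∈ outsideSquare R := by
  rw [← coe_mem_image_inftyNhd S.R_nonneg, ← hz]
  exact S.disc_infty.proj_mem x y hx hy

omit [T2Space X] [NeZero d] in
theorem disc_unique {x x' y : X} (hx : C.proj x ∈ vertices q) (hx' : C.proj x' ∈ vertices q)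
    (h : y ∈ S.D x) (h' : y ∈ S.D x') : x = x' := by
  have key : ∀ x x', C.proj x = OnePoint.infty → (∃ i, C.proj x' = q i) → y ∈ S.D x →
      y ∈ S.D x' → False := by
    rintro x x' hx ⟨i, hx'⟩ h h'
    obtain ⟨z, hz, hyz⟩ := S.mem_disc_coe hx' h'
    exact S.params.notMem_outsideSquare_of_mem_ball hz (S.mem_disc_infty hx h hyz)
  have hv : ∀ x, C.proj x ∈ vertices q → C.proj x = OnePoint.infty ∨ ∃ i, C.proj x = q i :=
    fun x hx => hx.imp id fun ⟨i, hi⟩ => ⟨i, hi.symm⟩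
  rcases hv x hx with hx | ⟨i, hx⟩ <;> rcases hv x' hx' with hx' | ⟨i', hx'⟩
  · exact S.disc_infty.unique x x' y hx hx' h h'
  · exact (key x x' hx ⟨i', hx'⟩ h h').elim
  · exact (key x' x hx' ⟨i, hx⟩ h' h).elim
  · obtain ⟨z, hz, hyz⟩ := S.mem_disc_coe hx h
    obtain ⟨z', hz', hyz'⟩ := S.mem_disc_coe hx' h'
    obtain rfl := OnePoint.coe_injective (hyz.symm.trans hyz')
    obtain rfl := S.params.eq_of_mem_ball hz hz'
    exact (S.disc_coe i).unique x x' y hx hx' h h'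

/-- The neighbourhoods of the finite vertices. -/
abbrev ballAt (q : Fin N → ℂ) (ε : ℝ) (i : Fin N) : Set ℂ := Metric.ball (q i) ε

omit [T2Space X] [NeZero d] [NeZero N] in
theorem exists_subset_disc_coe {s : ℂ → X} {O : Set ℂ} (hs : C.IsSection s O) {i : Fin N}
    (hO : IsPreconnected (O ∩ ballAt q ε i)) (hne : (O ∩ ballAt q ε i).Nonempty) (k : ZMod d) :
    ∃ x, C.proj x = q i ∧ (fun z => C.shift k (s z)) '' (O ∩ ballAt q ε i) ⊆ S.D x := by
  refine (S.disc_coe i).exists_subset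
    (hO.image _ ((hs.shift k).continuousOn.mono Set.inter_subset_left)) (hne.image _) ?_
  rintro _ ⟨z, hz, rfl⟩
  rw [hs.proj_shift_apply hz.1, coe_mem_image_ball]
  exact hz.2

omit [T2Space X] [NeZero d] in
theorem exists_subset_disc_infty {s : ℂ → X} {O O' : Set ℂ} (hs : C.IsSection s O)
    (hO : IsPreconnected (O ∩ O')) (hne : (O ∩ O').Nonempty) (hO' : O' ⊆ outsideSquare R)
    (k : ZMod d) :
    ∃ x, C.proj x = OnePoint.infty ∧ (fun z => C.shift k (s z)) '' (O ∩ O') ⊆ S.D x := by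
  refine S.disc_infty.exists_subset
    (hO.image _ ((hs.shift k).continuousOn.mono Set.inter_subset_left)) (hne.image _) ?_
  rintro _ ⟨z, hz, rfl⟩
  rw [hs.proj_shift_apply hz.1, coe_mem_image_inftyNhd S.R_nonneg]
  exact hO' hz.2

omit [T2Space X] [NeZero d] [NeZero N] in
include S in
theorem left_inter_ball_nonempty (i : Fin N) : (upBandLeft (q i) ε ∩ ballAt q ε i).Nonempty := by
  have hε := S.params.pos
  refine ⟨q i + ⟨-(ε / 3), ε / 3⟩, ⟨?_, ?_, ?_⟩, ?_⟩
  · simp; linarith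
  · simp [hε]
  · simp [hε]
  · have := Complex.norm_le_abs_re_add_abs_im ⟨-(ε / 3), ε / 3⟩
    simp only [abs_neg, abs_of_pos (show 0 < ε / 3 by positivity)] at this
    simp only [Metric.mem_ball, dist_self_add_left]
    linarith

omit [T2Space X] [NeZero d] [NeZero N] in
include S in
theorem right_inter_ball_nonempty (i : Fin N) : (upBandRight (q i) ε ∩ ballAt q ε i).Nonempty := by
  have hε := S.params.pos
  refine ⟨q i + ⟨ε / 3, ε / 3⟩, ⟨?_, ?_, ?_⟩, ?_⟩
  · simp [hε]
  · simp; linarith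
  · simp [hε]
  · have := Complex.norm_le_abs_re_add_abs_im ⟨ε / 3, ε / 3⟩
    simp only [abs_of_pos (show 0 < ε / 3 by positivity)] at this
    simp only [Metric.mem_ball, dist_self_add_left]
    linarith

omit [T2Space X] [NeZero d] [NeZero N] in
include S in
theorem left_inter_outside_nonempty (i : Fin N) :
    (upBandLeft (q i) ε ∩ outsideSquare R).Nonempty := by
  have hε := S.params.pos
  have hR := S.params.im_lt i
  have := le_abs_self (q i).im
  have := abs_nonneg (q i).im
  refine ⟨⟨(q i).re - ε / 2, R + 1⟩, ⟨?_, ?_, ?_⟩, Or.inr ?_⟩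
  · simp; linarith
  · simp [hε]
  · simp; linarith
  · simp only; rw [abs_of_pos] <;> linarith

omit [T2Space X] [NeZero d] [NeZero N] in
include S in
theorem right_inter_outside_nonempty (i : Fin N) :
    (upBandRight (q i) ε ∩ outsideSquare R).Nonempty := by
  have hε := S.params.pos
  have hR := S.params.im_lt i
  have := le_abs_self (q i).im
  have := abs_nonneg (q i).im
  refine ⟨⟨(q i).re + ε / 2, R + 1⟩, ⟨?_, ?_, ?_⟩, Or.inr ?_⟩
  · simp [hε]
  · simp; linarith
  · simp; linarith
  · simp only; rw [abs_of_pos] <;> linarith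

omit [T2Space X] [NeZero d] [NeZero N] in
theorem bandOver_inter_nonempty {O : Fin N → Set ℂ} {U : Set ℂ} (e : Fin N × ZMod d)
    (hU : U ⊆ upBand (q e.1) ε) (h : (U ∩ O e.1).Nonempty) :
    (S.bandOver O e ∩ S.bandOver (fun _ => U) e).Nonempty := by
  obtain ⟨z, hz⟩ := h
  exact ⟨_, ⟨z, ⟨hU hz.1, hz.2⟩, rfl⟩, ⟨z, ⟨hU hz.1, hz.1⟩, rfl⟩⟩

omit [T2Space X] [NeZero d] [NeZero N] in
include S in
theorem isPreconnected_band_inter_outside (i : Fin N) :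
    IsPreconnected (upBand (q i) ε ∩ outsideSquare R) := by
  rw [S.params.upBand_inter_outsideSquare]
  exact ((convex_upBand _ _).inter ((convex_halfSpace_im_gt R))).isPreconnected

omit [NeZero N] in
theorem exists_mem_sheet {x : X} {z : ℂ} (hz : z ∈ upSlitPlane q) (hx : C.proj x = z) :
    ∃ k, C.shift k (S.s z) = x :=
  C.exists_shift_eq (finite_vertices q) ((S.isSection_s.proj_apply z hz).trans hx.symm)

omit [NeZero N] in
theorem exists_mem_band {x : X} {i : Fin N} {z : ℂ} (hz : z ∈ upBand (q i) ε) (hx : C.proj x = z) :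
    ∃ k, C.shift k (S.t i z) = x :=
  C.exists_shift_eq (finite_vertices q) (((S.isSection_t i).proj_apply z hz).trans hx.symm)

omit [T2Space X] [NeZero d] in
include S in
theorem slitGap_nonempty (i : Fin N) : (upSlitPlane q ∩ slitGap q R i).Nonempty := by
  obtain ⟨z, hz⟩ := S.left_inter_outside_nonempty i
  exact ⟨z, S.params.upBandLeft_subset_slitPlane i hz.1, S.params.upBandLeft_outside i hz⟩

omit [T2Space X] [NeZero d] [NeZero N] in
theorem exists_inner_subset (e : Fin N × ZMod d) :
    ∃ x, C.proj x = q e.1 ∧ S.sheetOver (ballAt q ε) e ⊆ S.D x := by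
  obtain ⟨z, hz⟩ := S.left_inter_ball_nonempty e.1
  exact S.exists_subset_disc_coe S.isSection_s
    (S.params.isPreconnected_slitPlane_inter_ball e.1)
    ⟨z, S.params.upBandLeft_subset_slitPlane _ hz.1, hz.2⟩ e.2

omit [T2Space X] [NeZero d] in
theorem exists_outer_subset (e : Fin N × ZMod d) :
    ∃ x, C.proj x = OnePoint.infty ∧ S.sheetOver (slitGap q R) e ⊆ S.D x :=
  S.exists_subset_disc_infty S.isSection_s
    (by
      rw [Set.inter_eq_right.2 (S.params.slitGap_subset_slitPlane e.1)]
      exact SlitParams.isPreconnected_slitGap q R e.1)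
    (S.slitGap_nonempty e.1) (SlitParams.slitGap_subset_outsideSquare _) e.2

/-- The cover of a branched cover by sheets over the slit plane, sheets over the bands, and discs
around the points over the vertices. -/
def slitCover : SlitCover X (ZMod d) (Fin N × ZMod d) (C.proj ⁻¹' vertices q) where
  sheet := S.sheet
  band := S.bandOver fun _ => Set.univ
  disc y := S.D y
  left := S.left
  right := S.right
  inner := S.sheetOver (ballAt q ε)
  outer := S.sheetOver (slitGap q R)
  bandInner := S.bandOver (ballAt q ε)
  bandOuter := S.bandOver fun _ => outsideSquare R
  permIn := S.permIn
  permOut := S.permOut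
  isOpen_sheet := S.isOpen_sheet
  isOpen_band := S.isOpen_bandOver fun _ => isOpen_univ
  isOpen_disc y := by
    rcases y.2 with h | ⟨i, h⟩
    · exact S.disc_infty.isOpen _ h
    · exact (S.disc_coe i).isOpen _ h.symm
  isOpen_left := S.isOpen_bandOver fun _ => isOpen_upBandLeft _ _
  isOpen_right := S.isOpen_bandOver fun _ => isOpen_upBandRight _ _
  isOpen_inner := S.isOpen_sheetOver fun _ => Metric.isOpen_ball
  isOpen_outer := S.isOpen_sheetOver fun _ => SlitParams.isOpen_slitGap _ _ _
  isOpen_bandInner := S.isOpen_bandOver fun _ => Metric.isOpen_ball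
  isOpen_bandOuter := S.isOpen_bandOver fun _ => isOpen_outsideSquare _
  isPreconnected_left := S.isPreconnected_bandOver fun _ =>
    ((convex_upBand _ _).inter (convex_upBandLeft _ _)).isPreconnected
  isPreconnected_right := S.isPreconnected_bandOver fun _ =>
    ((convex_upBand _ _).inter (convex_upBandRight _ _)).isPreconnected
  isPreconnected_inner := S.isPreconnected_sheetOver S.params.isPreconnected_slitPlane_inter_ball
  isPreconnected_outer := S.isPreconnected_sheetOver fun i => by
    rw [Set.inter_eq_right.2 (S.params.slitGap_subset_slitPlane i)]
    exact SlitParams.isPreconnected_slitGap q R i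
  isPreconnected_bandInner := S.isPreconnected_bandOver fun _ =>
    ((convex_upBand _ _).inter (convex_ball _ _)).isPreconnected
  isPreconnected_bandOuter := S.isPreconnected_bandOver S.isPreconnected_band_inter_outside
  sheet_unique := S.sheet_unique
  band_unique := S.bandOver_unique
  disc_unique {y y' x} h h' := Subtype.ext (S.disc_unique y.2 y'.2 h h')
  inner_unique := S.sheetOver_unique fun _ _ _ => S.params.eq_of_mem_ball
  outer_unique := S.sheetOver_unique fun _ _ _ => S.params.slitGap_unique
  left_right h h' := by
    obtain ⟨z, -, h1, h2, -⟩ := S.mem_bandOver_inter h h'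
    exact lt_asymm h1.2.1 h2.1
  inner_outer {e e' x} h h' := by
    obtain ⟨z, hz, rfl⟩ := h
    obtain ⟨z', hz', he⟩ := h'
    obtain ⟨rfl, -⟩ := S.isSection_s.eq_of_shift_eq (finite_vertices q) hz.1 hz'.1 he.symm
    exact S.params.notMem_outsideSquare_of_mem_ball hz.2
      (SlitParams.slitGap_subset_outsideSquare _ hz'.2)
  bandInner_bandOuter h h' := by
    obtain ⟨z, -, h1, h2, -⟩ := S.mem_bandOver_inter h h'
    exact S.params.notMem_outsideSquare_of_mem_ball h1 h2
  left_subset_band e := S.bandOver_mono e (Set.subset_univ _)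
  right_subset_band e := S.bandOver_mono e (Set.subset_univ _)
  left_subset_sheet e := ⟨_, S.left_subset_sheet e⟩
  right_subset_sheet e := ⟨_, S.right_subset_sheet e⟩
  band_inter_sheet := S.bandOver_inter_sheet
  inner_subset_sheet e := ⟨_, S.sheetOver_subset_sheet _ e⟩
  outer_subset_sheet e := ⟨_, S.sheetOver_subset_sheet _ e⟩
  inner_subset_disc e := by
    obtain ⟨x, hx, h⟩ := S.exists_inner_subset e
    exact ⟨⟨x, by rw [Set.mem_preimage, hx]; exact coe_mem_vertices.2 ⟨_, rfl⟩⟩, h⟩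
  outer_subset_disc e := by
    obtain ⟨x, hx, h⟩ := S.exists_outer_subset e
    exact ⟨⟨x, Or.inl hx⟩, h⟩
  sheet_inter_disc {k y x} h h' := by
    obtain ⟨z, hz, rfl⟩ := h
    have hzp := S.isSection_s.proj_shift_apply hz k
    rcases y.2 with hy | ⟨i, hy⟩
    · obtain ⟨i, hi⟩ := S.params.exists_mem_slitGap hz (S.mem_disc_infty hy h' hzp)
      exact ⟨(i, k), Or.inr ⟨z, ⟨hz, hi⟩, rfl⟩⟩
    · obtain ⟨z', hz', h1⟩ := S.mem_disc_coe hy.symm h'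
      obtain rfl := OnePoint.coe_injective (hzp.symm.trans h1)
      exact ⟨(i, k), Or.inl ⟨z, ⟨hz, hz'⟩, rfl⟩⟩
  bandInner_subset_band e := S.bandOver_mono e (Set.subset_univ _)
  bandOuter_subset_band e := S.bandOver_mono e (Set.subset_univ _)
  bandInner_subset_disc e := by
    obtain ⟨z, hz⟩ := S.left_inter_ball_nonempty e.1
    obtain ⟨x, hx, h⟩ := S.exists_subset_disc_coe (S.isSection_t e.1)
      ((convex_upBand _ _).inter (convex_ball _ _)).isPreconnected
      ⟨z, upBandLeft_subset _ _ hz.1, hz.2⟩ e.2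
    exact ⟨⟨x, by rw [Set.mem_preimage, hx]; exact coe_mem_vertices.2 ⟨_, rfl⟩⟩, h⟩
  bandOuter_subset_disc e := by
    obtain ⟨z, hz⟩ := S.left_inter_outside_nonempty e.1
    obtain ⟨x, hx, h⟩ := S.exists_subset_disc_infty (S.isSection_t e.1)
      (S.isPreconnected_band_inter_outside e.1)
      ⟨z, upBandLeft_subset _ _ hz.1, hz.2⟩ le_rfl e.2
    exact ⟨⟨x, Or.inl hx⟩, h⟩
  band_inter_disc {e y x} h h' := by
    obtain ⟨z, hz, rfl⟩ := h
    have hzp := (S.isSection_t e.1).proj_shift_apply hz.1 e.2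
    rcases y.2 with hy | ⟨i, hy⟩
    · exact Or.inr ⟨z, ⟨hz.1, S.mem_disc_infty hy h' hzp⟩, rfl⟩
    · obtain ⟨z', hz', h1⟩ := S.mem_disc_coe hy.symm h'
      obtain rfl := OnePoint.coe_injective (hzp.symm.trans h1)
      obtain rfl := S.params.eq_of_mem_ball_of_mem_band hz' hz.1
      exact Or.inl ⟨z, ⟨hz.1, hz'⟩, rfl⟩
  bandInner_left e := S.bandOver_inter_left e Set.inter_subset_right
  bandInner_right e := S.bandOver_inter_right e _ rfl Set.inter_subset_right
  bandOuter_left e := S.bandOver_inter_left e (S.params.upBandLeft_outside e.1)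
  bandOuter_right e := S.bandOver_inter_right e _ rfl (S.params.upBandRight_outside e.1)
  bandInner_left_nonempty e :=
    S.bandOver_inter_nonempty e (upBandLeft_subset _ _) (S.left_inter_ball_nonempty e.1)
  bandInner_right_nonempty e :=
    S.bandOver_inter_nonempty e (upBandRight_subset _ _) (S.right_inter_ball_nonempty e.1)
  bandOuter_left_nonempty e :=
    S.bandOver_inter_nonempty e (upBandLeft_subset _ _) (S.left_inter_outside_nonempty e.1)
  bandOuter_right_nonempty e :=
    S.bandOver_inter_nonempty e (upBandRight_subset _ _) (S.right_inter_outside_nonempty e.1)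
  exists_mem x := by
    induction hx : C.proj x using OnePoint.rec with
    | infty =>
      exact Or.inr (Or.inr ⟨⟨x, Or.inl hx⟩, S.disc_infty.mem x hx⟩)
    | coe z =>
      rcases S.params.slitPlane_or_band_or_eq z with h | ⟨i, h⟩ | ⟨i, h⟩
      · obtain ⟨k, hk⟩ := S.exists_mem_sheet h hx
        exact Or.inl ⟨k, z, h, hk⟩
      · obtain ⟨k, hk⟩ := S.exists_mem_band h hx
        exact Or.inr (Or.inl ⟨(i, k), z, ⟨h, trivial⟩, hk⟩)
      · rw [h] at hx
        exact Or.inr (Or.inr ⟨⟨x, by rw [Set.mem_preimage, hx]; exact coe_mem_vertices.2 ⟨i, rfl⟩⟩,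
          (S.disc_coe i).mem x hx⟩)

end SlitSections

/-! ### Connectedness of the surface and transitivity of the permutations -/

theorem exists_glue {K E X α : Type*} [Nonempty α] {A : K → Set X} {B : E → Set X}
    (hA : ∀ {k k' x}, x ∈ A k → x ∈ A k' → k = k') (hB : ∀ {e e' x}, x ∈ B e → x ∈ B e' → e = e')
    {f : K → α} {g : E → α} (h : ∀ {k e x}, x ∈ A k → x ∈ B e → f k = g e) :
    ∃ G : X → α, (∀ k, ∀ x ∈ A k, G x = f k) ∧ ∀ e, ∀ x ∈ B e, G x = g e := by
  classical
  let G : X → α := fun x => if hx : ∃ k, x ∈ A k then f hx.choose else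
    if hx : ∃ e, x ∈ B e then g hx.choose else Classical.arbitrary α
  have hG : ∀ k, ∀ x ∈ A k, G x = f k := fun k x hx => by
    have hex : ∃ k, x ∈ A k := ⟨k, hx⟩
    simp only [G, dif_pos hex, hA hex.choose_spec hx]
  refine ⟨G, hG, fun e x hx => ?_⟩
  by_cases hex : ∃ k, x ∈ A k
  · obtain ⟨k, hk⟩ := hex
    rw [hG k x hk, h hk hx]
  · have hex' : ∃ e, x ∈ B e := ⟨e, hx⟩
    simp only [G, dif_neg hex, dif_pos hex', hB hex'.choose_spec hx]

/-- The limits `c x` through punctured neighbourhoods form a locally constant function, even if `G`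
itself misbehaves at isolated points; it agrees with `G` wherever `G` is locally constant. -/
theorem exists_eq_of_eventually_nhdsNE {X α : Type*} [TopologicalSpace X] [T1Space X]
    [ConnectedSpace X] [∀ x : X, (𝓝[≠] x).NeBot] {G : X → α}
    (h : ∀ x, ∃ c, ∀ᶠ y in 𝓝[≠] x, G y = c) :
    ∃ c, ∀ x, (∀ᶠ y in 𝓝 x, G y = G x) → G x = c := by
  choose c hc using h
  obtain ⟨x₀⟩ := (inferInstance : Nonempty X)
  refine ⟨c x₀, fun x hx => ?_⟩
  obtain ⟨y, hy1, hy2⟩ := ((hc x).and (hx.filter_mono inf_le_left)).exists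
  rw [← hy2, hy1]
  refine isPreconnected_univ.eq_of_eventually_eq (fun x _ => ?_) (Set.mem_univ x) (Set.mem_univ x₀)
  have h1 := eventually_eventually_nhdsWithin.2 (hc x)
  rw [eventually_nhdsWithin_iff] at h1
  filter_upwards [h1] with y hy
  by_cases hyx : y = x
  · rw [hyx]
  · have h2 := hy hyx
    rw [isOpen_compl_singleton.nhdsWithin_eq hyx] at h2
    obtain ⟨z, hz1, hz2⟩ := ((hc y).and (h2.filter_mono inf_le_left)).exists
    rw [← hz1, hz2]

namespace SlitCover

variable {X K E F : Type*} [TopologicalSpace X] (T : SlitCover X K E F)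

theorem eq_or_eq_permIn {e e' : E} {x : X} (h : x ∈ T.inner e) (h' : x ∈ T.bandInner e') :
    e = e' ∨ e = T.permIn e' := by
  obtain ⟨k, hk⟩ := T.inner_subset_sheet e
  rcases T.band_inter_sheet (T.bandInner_subset_band _ h') (hk h) with h1 | h1
  · exact Or.inl (T.inner_unique h (T.bandInner_left _ ⟨h', h1⟩))
  · exact Or.inr (T.inner_unique h (T.bandInner_right _ ⟨h', h1⟩))

theorem eq_or_eq_permOut {e e' : E} {x : X} (h : x ∈ T.outer e) (h' : x ∈ T.bandOuter e') :
    e = e' ∨ e = T.permOut e' := by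
  obtain ⟨k, hk⟩ := T.outer_subset_sheet e
  rcases T.band_inter_sheet (T.bandOuter_subset_band _ h') (hk h) with h1 | h1
  · exact Or.inl (T.outer_unique h (T.bandOuter_left _ ⟨h', h1⟩))
  · exact Or.inr (T.outer_unique h (T.bandOuter_right _ ⟨h', h1⟩))

/-- The connected set `bandInner e` meets both pieces and lies in one disc. -/
theorem inner_permIn_subset {e : E} {y : F} (h : T.inner e ⊆ T.disc y) :
    T.inner (T.permIn e) ⊆ T.disc y := by
  obtain ⟨y1, h1⟩ := T.bandInner_subset_disc e
  obtain ⟨y2, h2⟩ := T.inner_subset_disc (T.permIn e)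
  obtain ⟨x, hx⟩ := T.bandInner_left_nonempty e
  obtain ⟨x', hx'⟩ := T.bandInner_right_nonempty e
  have e1 := T.disc_unique (h (T.bandInner_left e hx)) (h1 hx.1)
  have e2 := T.disc_unique (h2 (T.bandInner_right e hx')) (h1 hx'.1)
  rwa [e1, ← e2]

theorem outer_permOut_subset {e : E} {y : F} (h : T.outer e ⊆ T.disc y) :
    T.outer (T.permOut e) ⊆ T.disc y := by
  obtain ⟨y1, h1⟩ := T.bandOuter_subset_disc e
  obtain ⟨y2, h2⟩ := T.outer_subset_disc (T.permOut e)
  obtain ⟨x, hx⟩ := T.bandOuter_left_nonempty e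
  obtain ⟨x', hx'⟩ := T.bandOuter_right_nonempty e
  have e1 := T.disc_unique (h (T.bandOuter_left e hx)) (h1 hx.1)
  have e2 := T.disc_unique (h2 (T.bandOuter_right e hx')) (h1 hx'.1)
  rwa [e1, ← e2]

end SlitCover

/-- A function on the index set of two families of open sets is constant on the sets meeting a
preconnected set that they cover, if it is compatible with the intersections. -/
theorem IsPreconnected.eq_of_mem_families {X E α : Type*} [TopologicalSpace X] {P : Set X}
    (hP : IsPreconnected P) {A B : E → Set X} (hAo : ∀ e, IsOpen (A e)) (hBo : ∀ e, IsOpen (B e))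
    (hA : ∀ {e e' x}, x ∈ A e → x ∈ A e' → e = e') (hB : ∀ {e e' x}, x ∈ B e → x ∈ B e' → e = e')
    {f : E → α} (h : ∀ {e e' x}, x ∈ A e → x ∈ B e' → f e = f e')
    (hcov : ∀ x ∈ P, (∃ e, x ∈ A e) ∨ ∃ e, x ∈ B e) {e e' : E} {x x' : X} (hx : x ∈ P)
    (hx' : x' ∈ P) (hxe : x ∈ A e) (hxe' : x' ∈ A e') : f e = f e' := by
  have : Nonempty α := ⟨f e⟩
  obtain ⟨G, h1, h2⟩ := exists_glue hA hB h
  rw [← h1 e x hxe, ← h1 e' x' hxe']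
  refine hP.eq_of_eventually_eq (fun y hy => ?_) hx hx'
  rcases hcov y hy with ⟨e, he⟩ | ⟨e, he⟩
  · filter_upwards [(hAo e).mem_nhds he] with w hw
    rw [h1 e w hw, h1 e y he]
  · filter_upwards [(hBo e).mem_nhds he] with w hw
    rw [h2 e w hw, h2 e y he]

theorem BranchedCover.card_preimage {d : ℕ} {V : Set (OnePoint ℂ)} {X : Type*} [TopologicalSpace X]
    [T2Space X] (C : BranchedCover d V X) (hV : V.Finite) (hd : 0 < d) (W : Finset (OnePoint ℂ)) :
    Nat.card (C.proj ⁻¹' W) = ∑ v ∈ W, Nat.card (C.proj ⁻¹' {v}) := by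
  classical
  have hfin : (C.proj ⁻¹' (W : Set (OnePoint ℂ))).Finite := by
    rw [← Set.biUnion_preimage_singleton]
    exact W.finite_toSet.biUnion fun v _ => C.finite_fibre hV hd v
  have h1 : ∀ S : Set X, ∀ hS : S.Finite, Nat.card S = hS.toFinset.card := fun S hS => by
    rw [Nat.card_coe_set_eq, Set.ncard_eq_toFinset_card S hS]
  rw [h1 _ hfin, Finset.card_eq_sum_card_fiberwise (f := C.proj) (t := W) (by
    intro x hx
    simpa using hx)]
  refine Finset.sum_congr rfl fun v hv => ?_
  rw [h1 _ (C.finite_fibre hV hd v)]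
  congr 1
  ext x
  simp only [Finset.mem_filter, Set.Finite.mem_toFinset, Set.mem_preimage, Set.mem_singleton_iff]
  exact ⟨fun h => h.2, fun h => ⟨h ▸ hv, h⟩⟩

namespace SlitSections

variable {d : ℕ} {X : Type*} [TopologicalSpace X] {N : ℕ} {q : Fin N → ℂ}
  {C : BranchedCover d (vertices q) X} {ε R : ℝ} (S : SlitSections C ε R)
  [T2Space X] [NeZero d] [NeZero N]

omit [T2Space X] [NeZero d] [NeZero N] in
theorem isDiscFamily_of_mem {x : X} (hx : C.proj x ∈ vertices q) :
    ∃ B, C.IsDiscFamily (C.proj x) B S.D := by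
  rcases hx with h | ⟨i, h⟩
  · rw [h]; exact ⟨_, S.disc_infty⟩
  · rw [← h]; exact ⟨_, S.disc_coe i⟩

omit [T2Space X] [NeZero d] in
theorem proj_notMem_of_mem_disc {x y : X} (hx : C.proj x ∈ vertices q) (hy : y ∈ S.D x \ {x}) :
    C.proj y ∉ vertices q := by
  intro h
  obtain ⟨B, hB⟩ := S.isDiscFamily_of_mem h
  exact hy.2 (S.disc_unique h hx (hB.mem y rfl) hy.1)

omit [NeZero N] in
theorem mem_sheet_or_band {x : X} (hx : C.proj x ∉ vertices q) :
    (∃ k, x ∈ S.sheet k) ∨ ∃ e, x ∈ S.bandOver (fun _ => Set.univ) e := by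
  induction hz : C.proj x using OnePoint.rec with
  | infty => exact absurd (Or.inl hz) hx
  | coe z =>
    rcases S.params.slitPlane_or_band_or_eq z with h | ⟨i, h⟩ | ⟨i, h⟩
    · obtain ⟨k, hk⟩ := S.exists_mem_sheet h hz
      exact Or.inl ⟨k, z, h, hk⟩
    · obtain ⟨k, hk⟩ := S.exists_mem_band h hz
      exact Or.inr ⟨(i, k), z, ⟨h, trivial⟩, hk⟩
    · rw [h] at hz
      rw [hz] at hx
      exact absurd (coe_mem_vertices.2 ⟨i, rfl⟩) hx

omit [T2Space X] [NeZero d] in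
theorem inner_cover {i : Fin N} {x y : X} (hx : C.proj x = q i) (hy : y ∈ S.D x \ {x}) [T2Space X]
    [NeZero d] : (∃ e, y ∈ S.sheetOver (ballAt q ε) e) ∨ ∃ e, y ∈ S.bandOver (ballAt q ε) e := by
  have hxv : C.proj x ∈ vertices q := by rw [hx]; exact coe_mem_vertices.2 ⟨i, rfl⟩
  obtain ⟨z, hz, hyz⟩ := S.mem_disc_coe hx hy.1
  rcases S.mem_sheet_or_band (S.proj_notMem_of_mem_disc hxv hy) with ⟨k, w, hw, rfl⟩ |
    ⟨e, w, hw, rfl⟩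
  · obtain rfl := OnePoint.coe_injective ((S.isSection_s.proj_shift_apply hw k).symm.trans hyz)
    exact Or.inl ⟨(i, k), w, ⟨hw, hz⟩, rfl⟩
  · obtain rfl := OnePoint.coe_injective
      (((S.isSection_t e.1).proj_shift_apply hw.1 e.2).symm.trans hyz)
    obtain rfl := S.params.eq_of_mem_ball_of_mem_band hz hw.1
    exact Or.inr ⟨e, w, ⟨hw.1, hz⟩, rfl⟩

theorem outer_cover {x y : X} (hx : C.proj x = OnePoint.infty) (hy : y ∈ S.D x \ {x}) :
    (∃ e, y ∈ S.sheetOver (slitGap q R) e) ∨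
      ∃ e, y ∈ S.bandOver (fun _ => outsideSquare R) e := by
  rcases S.mem_sheet_or_band (S.proj_notMem_of_mem_disc (Or.inl hx) hy) with ⟨k, w, hw, rfl⟩ |
    ⟨e, w, hw, rfl⟩
  · have := S.mem_disc_infty hx hy.1 (S.isSection_s.proj_shift_apply hw k)
    obtain ⟨i, hi⟩ := S.params.exists_mem_slitGap hw this
    exact Or.inl ⟨(i, k), w, ⟨hw, hi⟩, rfl⟩
  · have := S.mem_disc_infty hx hy.1 ((S.isSection_t e.1).proj_shift_apply hw.1 e.2)
    exact Or.inr ⟨e, w, ⟨hw.1, this⟩, rfl⟩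

omit [T2Space X] [NeZero d] [NeZero N] in
theorem sheetOver_subset_diff {x : X} (hx : C.proj x ∈ vertices q) {O : Fin N → Set ℂ}
    {e : Fin N × ZMod d} (h : S.sheetOver O e ⊆ S.D x) : S.sheetOver O e ⊆ S.D x \ {x} := by
  intro y hy
  refine ⟨h hy, ?_⟩
  rintro rfl
  obtain ⟨z, hz, hzy⟩ := hy
  have h1 := (S.isSection_s.shift e.2).proj_notMem hz.1
  have h2 : C.shift e.2 (S.s z) = y := hzy
  rw [h2] at h1
  exact h1 hx

/-- The punctured disc around `x` is connected and covered by pieces of sheets and bands.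
Overlapping ones are related by `permIn`, so an invariant function takes one value on the whole
disc. -/
theorem eq_of_inner_subset {α : Type*} {f : Fin N × ZMod d → α} (hf : ∀ e, f (S.permIn e) = f e)
    {i : Fin N} {x y y' : X} (hx : C.proj x = q i) {e e' : Fin N × ZMod d}
    (hy : y ∈ S.D x \ {x}) (hy' : y' ∈ S.D x \ {x})
    (he : y ∈ S.sheetOver (ballAt q ε) e) (he' : y' ∈ S.sheetOver (ballAt q ε) e') :
    f e = f e' :=
  ((S.disc_coe i).isPreconnected_diff x hx).eq_of_mem_families S.slitCover.isOpen_inner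
    S.slitCover.isOpen_bandInner S.slitCover.inner_unique (S.bandOver_unique)
    (fun {e e' z} h h' => by
      rcases S.slitCover.eq_or_eq_permIn h h' with h1 | h1
      · rw [h1]
      · rw [h1]; exact hf e')
    (fun _ h => S.inner_cover hx h) hy hy' he he'

theorem eq_of_outer_subset {α : Type*} {f : Fin N × ZMod d → α} (hf : ∀ e, f (S.permOut e) = f e)
    {x y y' : X} (hx : C.proj x = OnePoint.infty) {e e' : Fin N × ZMod d}
    (hy : y ∈ S.D x \ {x}) (hy' : y' ∈ S.D x \ {x})
    (he : y ∈ S.sheetOver (slitGap q R) e) (he' : y' ∈ S.sheetOver (slitGap q R) e') :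
    f e = f e' :=
  (S.disc_infty.isPreconnected_diff x hx).eq_of_mem_families S.slitCover.isOpen_outer
    S.slitCover.isOpen_bandOuter S.slitCover.outer_unique (S.bandOver_unique (O := fun _ => outsideSquare R)
      (O' := fun _ => outsideSquare R))
    (fun {e e' z} h h' => by
      rcases S.slitCover.eq_or_eq_permOut h h' with h1 | h1
      · rw [h1]
      · rw [h1]; exact hf e')
    (fun _ h => S.outer_cover hx h) hy hy' he he'

/-- Comparing the two permutations shows that `f` depends only on the sheet, and invariance under
the jumps makes it a locally constant function on the union of the sheets and bands. Removing the
points over the vertices does not disconnect `X`, so it is constant. -/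
theorem eq_of_invariant [ConnectedSpace X] {α : Type*} {f : Fin N × ZMod d → α}
    (hin : ∀ e, f (S.permIn e) = f e) (hout : ∀ e, f (S.permOut e) = f e)
    (e e' : Fin N × ZMod d) : f e = f e' := by
  have h1 : ∀ i k, f (i + 1, k) = f (i, k) := fun i k => by
    have a := hin (i, k - S.c i)
    have b := hout (i, k - S.c i)
    rw [permIn_apply] at a
    rw [permOut_apply] at b
    simp only [sub_add_cancel] at a b
    rw [a, b]
  have h2 : ∀ k, ∀ m (hm : m < N), f (⟨m, hm⟩, k) = f (0, k) := by
    intro k m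
    induction m with
    | zero => exact fun hm => rfl
    | succ m ih =>
      intro hm
      rw [← ih (by omega), ← h1 ⟨m, by omega⟩]
      congr 2
      ext
      simp [Fin.val_add, Nat.mod_eq_of_lt hm]
  have h3 : ∀ i k, f (i, k) = f (0, k) := fun i k => h2 k i.1 i.2
  have h4 : ∀ i k, f (0, k + S.c i) = f (0, k) := fun i k => by
    rw [← h3 i, ← h3 i]; exact hin (i, k)
  have : Nonempty α := ⟨f e⟩
  obtain ⟨G, hA, hB⟩ := exists_glue (A := S.sheet) (B := S.bandOver fun _ => Set.univ)
    S.sheet_unique S.bandOver_unique (f := fun k => f (0, k)) (g := fun e => f (0, e.2))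
    (fun {k e x} h h' => by
      rcases S.bandOver_inter_sheet h' h with h5 | h5
      · rw [S.sheet_unique h (S.left_subset_sheet e h5)]
      · rw [S.sheet_unique h (S.right_subset_sheet e h5), h4])
  have hloc : ∀ x, C.proj x ∉ vertices q → ∀ᶠ y in 𝓝 x, G y = G x := fun x hx => by
    rcases S.mem_sheet_or_band hx with ⟨k, hk⟩ | ⟨e, he⟩
    · filter_upwards [(S.isOpen_sheet k).mem_nhds hk] with y hy
      rw [hA k y hy, hA k x hk]
    · filter_upwards [(S.isOpen_bandOver (fun _ => isOpen_univ) e).mem_nhds he] with y hy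
      rw [hB e y hy, hB e x he]
  have := fun x => C.neBot_nhdsNE x
  obtain ⟨c, hc⟩ := exists_eq_of_eventually_nhdsNE (G := G) fun x => by
    by_cases hx : C.proj x ∈ vertices q
    · obtain ⟨B, hBf⟩ := S.isDiscFamily_of_mem hx
      have hmem : S.D x \ {x} ∈ 𝓝[≠] x :=
        Filter.inter_mem (mem_nhdsWithin_of_mem_nhds ((hBf.isOpen x rfl).mem_nhds (hBf.mem x rfl)))
          self_mem_nhdsWithin
      obtain ⟨y₀, hy₀⟩ := Filter.nonempty_of_mem hmem
      refine ⟨G y₀, ?_⟩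
      filter_upwards [hmem] with y hy
      exact (hBf.isPreconnected_diff x rfl).eq_of_eventually_eq
        (fun z hz => hloc z (S.proj_notMem_of_mem_disc hx hz)) hy hy₀
    · exact ⟨G x, (hloc x hx).filter_mono inf_le_left⟩
  obtain ⟨z, hz⟩ := (isSimplyConnected_upSlitPlane q).nonempty
  have h5 : ∀ k, f (0, k) = c := fun k => by
    rw [← hA k _ ⟨z, hz, rfl⟩]
    exact hc _ (hloc _ ((S.isSection_s.shift k).proj_notMem hz))
  rw [← Prod.mk.eta (p := e), ← Prod.mk.eta (p := e'), h3, h3 e'.1, h5, h5]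

-- The slit cover has `d` sheets, `N * d` bands and one disc for each point over a vertex.
include S in
theorem rank_homology [ConnectedSpace X] (x : X) :
    ∃ r : ℕ, Module.rank ℤ (FirstHomology X x) = r ∧
      r + d + Nat.card (C.proj ⁻¹' vertices q) = N * d + 2 := by
  have := C.locallyPathConnectedSpace
  have : PathConnectedSpace X := PathConnectedSpace.of_locallyPathConnectedSpace
  have := (C.finite_preimage (finite_vertices q) (NeZero.pos d)).fintype
  obtain ⟨r, h1, h2⟩ := S.slitCover.rank_homology
    (fun k => (S.isSection_s.shift k).isSimplyConnected_image (isSimplyConnected_upSlitPlane q))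
    (fun e => by
      have h1 : S.slitCover.band e = (fun z => C.shift e.2 (S.t e.1 z)) '' upBand (q e.1) ε := by
        change _ '' (_ ∩ Set.univ) = _
        rw [Set.inter_univ]
      obtain ⟨z, hz⟩ := upBandLeft_nonempty (a := q e.1) S.params.pos
      rw [h1]
      exact ((S.isSection_t e.1).shift e.2).isSimplyConnected_image
        ((convex_upBand _ _).isSimplyConnected ⟨z, upBandLeft_subset _ _ hz⟩))
    (fun y => by
      obtain ⟨B, hB⟩ := S.isDiscFamily_of_mem y.2
      exact hB.isSimplyConnected y rfl)
    (fun f hin hout => S.eq_of_invariant hin hout) x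
  refine ⟨r, h1, ?_⟩
  rw [Fintype.card_prod, ZMod.card, Fintype.card_fin] at h2
  rw [Nat.card_eq_fintype_card, h2]

end SlitSections

/-! ### Parity of the fibres and evenness of the Betti number -/

theorem ZMod.cast_eq_castHom_of_dvd {d m : ℕ} [NeZero d] (h : 2 ∣ d) {a : ZMod d}
    (hm : m ∣ a.val) (ha : ZMod.castHom h (ZMod 2) a ≠ 0) :
    (m : ZMod 2) = ZMod.castHom h (ZMod 2) a := by
  have h1 : ZMod.castHom h (ZMod 2) a = (a.val : ZMod 2) := by
    rw [← map_natCast (ZMod.castHom h (ZMod 2)), ZMod.natCast_zmod_val]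
  have h2 : (m : ZMod 2) ≠ 0 := by
    rw [h1] at ha
    exact fun h0 => ha ((ZMod.natCast_eq_zero_iff _ _).2
      (((ZMod.natCast_eq_zero_iff _ _).1 h0).trans hm))
  have key : ∀ u v : ZMod 2, u ≠ 0 → v ≠ 0 → u = v := by decide
  exact key _ _ h2 ha

namespace SlitSections

variable {d : ℕ} {X : Type*} [TopologicalSpace X] {N : ℕ} {q : Fin N → ℂ}
  {C : BranchedCover d (vertices q) X} {ε R : ℝ} (S : SlitSections C ε R)
  [T2Space X] [NeZero d]

/-- The power `a` of the deck transformation carries the first piece to the second and permutes the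
discs, so it preserves this disc and its centre. -/
theorem iterate_eq_of_subset {x : X} (hx : C.proj x ∈ vertices q) {O : Fin N → Set ℂ} {i : Fin N}
    {k a : ZMod d} (hne : (upSlitPlane q ∩ O i).Nonempty) (h : S.sheetOver O (i, k) ⊆ S.D x)
    (h' : S.sheetOver O (i, k + a) ⊆ S.D x) : C.deck^[a.val] x = x := by
  obtain ⟨B, hB⟩ := S.isDiscFamily_of_mem hx
  obtain ⟨z, hz⟩ := hne
  have h1 := hB.iterate_mem a.val rfl (h ⟨z, hz, rfl⟩)
  have h2 := h' ⟨z, hz, rfl⟩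
  simp only [add_comm k a, C.shift_add (finite_vertices q) a] at h2
  exact hB.unique _ _ _ (C.proj_iterate _ _) rfl h1 h2

theorem iterate_mem_sheetOver {O : Fin N → Set ℂ} {i : Fin N} {k : ZMod d} {p : X}
    (hp : p ∈ S.sheetOver O (i, k)) (m : ℕ) : C.deck^[m] p ∈ S.sheetOver O (i, k + m) := by
  obtain ⟨z, hz, rfl⟩ := hp
  refine ⟨z, hz, ?_⟩
  simp only [add_comm k, C.shift_add (finite_vertices q), C.shift_natCast (finite_vertices q)]

variable [NeZero N]

/-- The fibre has as many points as the period `m` of `x`. If the jump `c i` is odd, `m` divides it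
and is odd. If it is even, the parity of the sheet is constant on the disc at `x`; as the `m`-th
deck power takes sheet `0` to sheet `m` within that disc, `m` is even. -/
theorem card_fibre_coe (h : 2 ∣ d) (i : Fin N) :
    (Nat.card (C.proj ⁻¹' {(q i : OnePoint ℂ)}) : ZMod 2) = ZMod.castHom h (ZMod 2) (S.c i) := by
  obtain ⟨x, hx, hsub⟩ := S.exists_inner_subset (i, 0)
  have hxv : C.proj x ∈ vertices q := by rw [hx]; exact coe_mem_vertices.2 ⟨i, rfl⟩
  obtain ⟨z, hz⟩ := S.left_inter_ball_nonempty i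
  have hz' : z ∈ upSlitPlane q ∩ ballAt q ε i :=
    ⟨S.params.upBandLeft_subset_slitPlane _ hz.1, hz.2⟩
  rw [show (q i : OnePoint ℂ) = C.proj x from hx.symm,
    C.card_fibre (finite_vertices q) (NeZero.pos d)]
  by_cases hc : ZMod.castHom h (ZMod 2) (S.c i) = 0
  · rw [hc]
    let f : Fin N × ZMod d → ZMod 2 := fun e => if e.1 = i then ZMod.castHom h (ZMod 2) e.2 else 0
    have hf : ∀ e, f (S.permIn e) = f e := fun e => by
      rw [permIn_apply]
      by_cases he : e.1 = i
      · simp only [f, if_pos he, map_add]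
        rw [he, hc, add_zero]
      · simp only [f, if_neg he]
    have hp : C.shift 0 (S.s z) ∈ S.sheetOver (ballAt q ε) (i, 0) := ⟨z, hz', rfl⟩
    have hp' := S.iterate_mem_sheetOver hp (Function.minimalPeriod C.deck x)
    have hmem := (S.disc_coe i).iterate_mem (Function.minimalPeriod C.deck x) hx (hsub hp)
    rw [Function.iterate_minimalPeriod] at hmem
    have hne := (S.sheetOver_subset_diff hxv hsub hp).2
    have key := S.eq_of_inner_subset hf hx ⟨hsub hp, hne⟩ (y' := C.deck^[_] _) ⟨hmem, ?_⟩ hp hp'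
    · simpa [f, -ZMod.castHom_apply] using key.symm
    · intro h0
      have := congrArg C.proj (Set.mem_singleton_iff.1 h0)
      rw [C.proj_iterate] at this
      have h1 := (S.isSection_s.shift 0).proj_notMem hz'.1
      rw [this] at h1
      exact h1 hxv
  · refine ZMod.cast_eq_castHom_of_dvd h (Function.IsPeriodicPt.minimalPeriod_dvd ?_) hc
    have h1 : S.sheetOver (ballAt q ε) (i, 0 + S.c i) ⊆ S.D x :=
      S.slitCover.inner_permIn_subset (e := (i, 0)) (y := ⟨x, hxv⟩) hsub
    exact S.iterate_eq_of_subset hxv ⟨z, hz'⟩ hsub h1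

/-- Going once around `∞` crosses all slits, with total jump `∑ i, S.c i`; the argument is then that
at a finite vertex. -/
theorem card_fibre_infty (h : 2 ∣ d) : (Nat.card (C.proj ⁻¹' {OnePoint.infty}) : ZMod 2) =
    ZMod.castHom h (ZMod 2) (∑ i, S.c i) := by
  let c' : ℕ → ZMod d := fun m => if hm : m < N then S.c ⟨m, hm⟩ else 0
  have hc' : ∀ i : Fin N, S.c i = c' i := fun i => by simp [c']
  have hsum : ∑ i, S.c i = ∑ m ∈ Finset.range N, c' m := by
    rw [← Fin.sum_univ_eq_sum_range]
    exact Finset.sum_congr rfl fun i _ => hc' i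
  have hval : ∀ i : Fin N, (i + 1).1 = if i.1 + 1 = N then 0 else i.1 + 1 := fun i => by
    have := i.2
    have h1 : (i + 1).1 = (i.1 + 1) % N := by simp [Fin.val_add]
    rw [h1]
    split_ifs with h2
    · rw [h2, Nat.mod_self]
    · exact Nat.mod_eq_of_lt (by omega)
  obtain ⟨x, hx, hsub⟩ := S.exists_outer_subset (0, 0)
  have hxv : C.proj x ∈ vertices q := Or.inl hx
  have hgap := S.slitGap_nonempty (0 : Fin N)
  obtain ⟨z, hz⟩ := hgap
  rw [← hx, C.card_fibre (finite_vertices q) (NeZero.pos d)]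
  by_cases hc : ZMod.castHom h (ZMod 2) (∑ i, S.c i) = 0
  · rw [hc]
    -- The sheet is corrected by the jumps crossed since gap `0`. Its parity is consistent when the
    -- last gap is followed by gap `0`, because the total jump is even.
    let f : Fin N × ZMod d → ZMod 2 := fun e =>
      ZMod.castHom h (ZMod 2) (e.2 - ∑ m ∈ Finset.range e.1, c' m)
    have hf : ∀ e, f (S.permOut e) = f e := fun e => by
      rw [permOut_apply]
      simp only [f, hval]
      split_ifs with h2
      · have h3 := hc
        rw [hsum, ← h2, Finset.sum_range_succ, map_add] at h3
        simp only [Finset.range_zero, Finset.sum_empty, sub_zero, map_add, map_sub, hc']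
        linear_combination h3
      · rw [Finset.sum_range_succ, hc']
        congr 1
        ring
    have hp : C.shift 0 (S.s z) ∈ S.sheetOver (slitGap q R) (0, 0) := ⟨z, hz, rfl⟩
    have hp' := S.iterate_mem_sheetOver hp (Function.minimalPeriod C.deck x)
    have hmem := S.disc_infty.iterate_mem (Function.minimalPeriod C.deck x) hx (hsub hp)
    rw [Function.iterate_minimalPeriod] at hmem
    have hne := (S.sheetOver_subset_diff hxv hsub hp).2
    have key := S.eq_of_outer_subset hf hx ⟨hsub hp, hne⟩ (y' := C.deck^[_] _) ⟨hmem, ?_⟩ hp hp'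
    · simpa [f, -ZMod.castHom_apply] using key.symm
    · intro h0
      have := congrArg C.proj (Set.mem_singleton_iff.1 h0)
      rw [C.proj_iterate] at this
      have h1 := (S.isSection_s.shift 0).proj_notMem hz.1
      rw [this] at h1
      exact h1 hxv
  · refine ZMod.cast_eq_castHom_of_dvd h (Function.IsPeriodicPt.minimalPeriod_dvd ?_) hc
    -- Walking around `∞` within one disc, from gap to gap, accumulates the partial sums of the
    -- jumps.
    have hstep : ∀ m (hm : m < N),
        S.sheetOver (slitGap q R) (⟨m, hm⟩, ∑ j ∈ Finset.range m, c' j) ⊆ S.D x := by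
      intro m
      induction m with
      | zero => exact fun _ => hsub
      | succ m ih =>
        intro hm
        have h1 := S.slitCover.outer_permOut_subset (y := ⟨x, hxv⟩) (ih (by omega))
        have h2 : S.slitCover.permOut (⟨m, by omega⟩, ∑ j ∈ Finset.range m, c' j) =
            (⟨m + 1, hm⟩, ∑ j ∈ Finset.range (m + 1), c' j) := by
          refine Prod.ext (Fin.ext ?_) ?_
          · exact (hval _).trans (if_neg (by simp; omega))
          · rw [Finset.sum_range_succ]
            change _ + S.c _ = _
            rw [hc']
        rw [h2] at h1
        exact h1
    have hN := NeZero.pos N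
    have h1 := S.slitCover.outer_permOut_subset (y := ⟨x, hxv⟩) (hstep (N - 1) (by omega))
    have h2 : S.slitCover.permOut (⟨N - 1, by omega⟩, ∑ j ∈ Finset.range (N - 1), c' j) =
        (0, 0 + ∑ i, S.c i) := by
      refine Prod.ext (Fin.ext ?_) ?_
      · exact (hval _).trans (if_pos (by simp; omega))
      · change _ + S.c _ = 0 + ∑ i, S.c i
        rw [hsum, zero_add, hc', ← Finset.sum_range_succ, Nat.sub_add_cancel hN]
    rw [h2] at h1
    exact S.iterate_eq_of_subset hxv ⟨z, hz⟩ hsub h1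

end SlitSections

theorem exists_finset_vertices {N : ℕ} {q : Fin N → ℂ} (hq : Function.Injective q) :
    ∃ W : Finset (OnePoint ℂ), (W : Set (OnePoint ℂ)) = vertices q ∧
      ∀ {M : Type} [AddCommMonoid M] (f : OnePoint ℂ → M),
        ∑ v ∈ W, f v = f OnePoint.infty + ∑ i, f (q i) := by
  classical
  refine ⟨insert OnePoint.infty (Finset.univ.image fun i => (q i : OnePoint ℂ)), ?_, ?_⟩
  · simp [vertices]
  · intro M _ f
    rw [Finset.sum_insert (by simp), Finset.sum_image]
    exact fun i _ j _ h => hq (OnePoint.coe_injective h)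

/-- The content beyond the rank formula is the evenness of `r`. For even `d` each jump contributes
twice to the total number of points over the vertices, once over its own vertex and once over `∞`.
For odd `d` all `N + 1` fibres have sizes dividing `d`, hence odd. -/
theorem exists_rank_homology_eq {d : ℕ} [NeZero d] {X : Type*} [TopologicalSpace X] [T2Space X]
    [CompactSpace X] [ConnectedSpace X] {N : ℕ} [NeZero N] {q : Fin N → ℂ}
    (hq : StrictMono fun i => (q i).re) (C : BranchedCover d (vertices q) X) :
    ∃ g : ℕ, (∀ x : X, Module.rank ℤ (FirstHomology X x) = ((2 * g : ℕ) : Cardinal)) ∧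
      2 * g + d + Nat.card (C.proj ⁻¹' vertices q) = N * d + 2 := by
  obtain ⟨ε, R, ⟨S⟩⟩ := exists_slitSections hq C
  have hd := NeZero.pos d
  obtain ⟨W, hW, hsum⟩ := exists_finset_vertices fun i j h => hq.injective (congrArg Complex.re h)
  have hcard : Nat.card (C.proj ⁻¹' vertices q) = Nat.card (C.proj ⁻¹' {OnePoint.infty}) +
      ∑ i, Nat.card (C.proj ⁻¹' {(q i : OnePoint ℂ)}) := by
    rw [← hsum fun v => Nat.card (C.proj ⁻¹' {v}), ← C.card_preimage (finite_vertices q) hd]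
    exact congrArg (fun U => Nat.card (C.proj ⁻¹' U)) hW.symm
  have heven : ∀ r, r + d + Nat.card (C.proj ⁻¹' vertices q) = N * d + 2 → 2 ∣ r := by
    intro r hr
    have h2 := congrArg (Nat.cast : ℕ → ZMod 2) (hcard ▸ hr)
    have htwo : (2 : ZMod 2) = 0 := rfl
    rw [← ZMod.natCast_eq_zero_iff]
    push_cast at h2
    by_cases h : 2 ∣ d
    · rw [(ZMod.natCast_eq_zero_iff _ _).2 h, S.card_fibre_infty h, map_sum] at h2
      simp only [S.card_fibre_coe h] at h2
      linear_combination h2 - (∑ i, ZMod.castHom h (ZMod 2) (S.c i) - 1) * htwo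
    · have key : ∀ m, m ∣ d → (m : ZMod 2) = 1 := fun m hm => by
        have h0 : ∀ u : ZMod 2, u ≠ 0 → u = 1 := by decide
        exact h0 _ fun h0 => h (((ZMod.natCast_eq_zero_iff _ _).1 h0).trans hm)
      have hfib : ∀ v, (Nat.card (C.proj ⁻¹' {v}) : ZMod 2) = 1 := fun v => by
        obtain ⟨x, rfl⟩ := C.surjective_proj v
        rw [C.card_fibre (finite_vertices q) hd]
        exact key _ (C.minimalPeriod_dvd (finite_vertices q) x)
      simp only [hfib, key d dvd_rfl, Finset.sum_const, Finset.card_univ, Fintype.card_fin,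
        nsmul_eq_mul, mul_one] at h2
      linear_combination h2
  obtain ⟨x₀⟩ := (inferInstance : Nonempty X)
  obtain ⟨r, -, h2⟩ := S.rank_homology x₀
  obtain ⟨g, rfl⟩ := heven r h2
  refine ⟨g, fun x => ?_, h2⟩
  obtain ⟨r', h3, h4⟩ := S.rank_homology x
  rw [h3]
  congr 1
  omega

/-! ### Monodromy and the number of points over a branch point -/

theorem tendsto_ofReal_mul_nhdsNE {c : ℂ} (hc : c ≠ 0) :
    Filter.Tendsto (fun ζ : ℝ => (ζ : ℂ) * c) (𝓝[>] 0) (𝓝[≠] 0) := by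
  refine tendsto_nhdsWithin_iff.2 ⟨?_, ?_⟩
  · have : Continuous fun ζ : ℝ => (ζ : ℂ) * c := by fun_prop
    simpa using (this.tendsto 0).mono_left nhdsWithin_le_nhds
  · filter_upwards [self_mem_nhdsWithin] with ζ hζ
    exact mul_ne_zero (by exact_mod_cast (Set.mem_Ioi.1 hζ).ne') hc

namespace CyclicBranchedCover

variable {d n : ℕ} {p : Fin n → OnePoint ℂ} {b : Fin n → ℕ} {X : Type*} [TopologicalSpace X]

/-- In the chart, the circle of radius `ζ ^ k` lifts to the arc of angle `2π / k` and radius `ζ`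
from `ζ * ω ^ a` to `ζ * ω ^ (a + 1)`, where `ω` is the standard `k`-th root of unity; the monodromy
relates its ends. -/
theorem eventually_iterate_symm_chart (C : CyclicBranchedCover d p b X) {i : Fin n} {x : X}
    (hx : C.proj x = p i) {k : ℕ} (hk : 0 < k) {φ : OpenPartialHomeomorph X ℂ}
    (hφ : x ∈ φ.source) (h0 : φ x = 0)
    (h : ∀ y ∈ φ.source, C.proj y = sphereParam (C.proj x) (φ y ^ k)) :
    ∀ᶠ ζ : ℝ in 𝓝[>] 0, ∀ a : ℕ,
      φ.symm (ζ * Complex.exp (2 * Real.pi * Complex.I / k) ^ (a + 1)) =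
        C.deck^[b i] (φ.symm (ζ * Complex.exp (2 * Real.pi * Complex.I / k) ^ a)) := by
  have h0t : (0 : ℂ) ∈ φ.target := h0 ▸ φ.map_source hφ
  obtain ⟨ρ, hρ, hρt⟩ := Metric.isOpen_iff.1 φ.open_target 0 h0t
  have hpow : Filter.Tendsto (fun ζ : ℝ => ζ ^ k) (𝓝[>] 0) (𝓝[>] 0) := by
    refine tendsto_nhdsWithin_iff.2 ⟨?_, ?_⟩
    · simpa [hk.ne'] using ((continuous_pow k).tendsto (0 : ℝ)).mono_left nhdsWithin_le_nhds
    · filter_upwards [self_mem_nhdsWithin] with ζ hζ using pow_pos (Set.mem_Ioi.1 hζ) k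
  filter_upwards [hpow.eventually (C.monodromy i), Ioo_mem_nhdsGT hρ] with ζ hmon hζ a
  have hkC : (k : ℂ) ≠ 0 := by exact_mod_cast hk.ne'
  let ω := Complex.exp (2 * Real.pi * Complex.I / k)
  have hωn : ‖ω‖ = 1 := by
    have : 2 * Real.pi * Complex.I / k = ((2 * Real.pi / k : ℝ) : ℂ) * Complex.I := by
      push_cast; ring
    simp only [ω, this, Complex.norm_exp_ofReal_mul_I]
  let u : I → ℂ := fun t => ζ * ω ^ a * Complex.exp (((2 * Real.pi * t / k : ℝ) : ℂ) * Complex.I)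
  have hu : ∀ t, u t ∈ φ.target := fun t => hρt <| by
    rw [mem_ball_zero_iff, norm_mul, norm_mul, Complex.norm_exp_ofReal_mul_I, norm_pow, hωn,
      one_pow, mul_one, mul_one, Complex.norm_real, Real.norm_of_nonneg hζ.1.le]
    exact hζ.2
  have huc : Continuous u := by fun_prop
  have huk : ∀ t : I, u t ^ k = (ζ ^ k : ℝ) * Complex.exp (2 * Real.pi * Complex.I * (t : ℝ)) := by
    intro t
    have h1 : ω ^ k = 1 := by
      rw [← Complex.exp_nat_mul, mul_div_cancel₀ _ hkC, Complex.exp_two_pi_mul_I]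
    simp only [u]
    rw [mul_pow, mul_pow, ← pow_mul, mul_comm a k, pow_mul, h1, one_pow, mul_one,
      ← Complex.exp_nat_mul]
    push_cast
    congr 2
    field_simp
  let γ : C(I, X) := ⟨fun t => φ.symm (u t),
    φ.continuousOn_symm.comp_continuous huc hu⟩
  have hγ := hmon γ fun t => by
    change C.proj (φ.symm (u t)) = _
    rw [h _ (φ.map_target (hu t)), φ.right_inv (hu t), hx, huk]
    rfl
  have hu0 : u 0 = ζ * ω ^ a := by simp [u]
  have hu1 : u 1 = ζ * ω ^ (a + 1) := by
    have : (((2 * Real.pi * ((1 : I) : ℝ) / k : ℝ) : ℂ) * Complex.I) =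
        2 * Real.pi * Complex.I / k := by
      rw [Set.Icc.coe_one]; push_cast; ring
    change ζ * ω ^ a * Complex.exp _ = _
    rw [this, pow_succ, mul_assoc]
  change φ.symm (u 1) = C.deck^[b i] (φ.symm (u 0)) at hγ
  rwa [hu0, hu1] at hγ

/-- The period `m` divides `d`, and it divides `b i` because the monodromy relation tends to
`deck^[b i] x = x`. Conversely the `m`-th deck power moves a point near `x` to another point of its
fibre near `x`, reached by some number `a` of turns. Freeness gives `m ≡ b i * a` modulo `d`, so
`gcd d (b i)` divides `m`. -/
theorem minimalPeriod_eq_gcd [T2Space X] (hd : 0 < d) (C : CyclicBranchedCover d p b X) {i : Fin n}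
    {x : X} (hx : C.proj x = p i) : Function.minimalPeriod C.deck x = Nat.gcd d (b i) := by
  have : NeZero d := ⟨hd.ne'⟩
  have hV : (Set.range p).Finite := Set.finite_range p
  let C' := BranchedCover.ofCyclic C
  obtain ⟨k, hk, φ, hφ, h0, h⟩ := C.local_form x ⟨i, hx.symm⟩
  let ω := Complex.exp (2 * Real.pi * Complex.I / k)
  have hω : ω ≠ 0 := Complex.exp_ne_zero _
  have hmon : ∀ᶠ ζ : ℝ in 𝓝[>] 0, ∀ a : ℕ,
      φ.symm (ζ * ω ^ (a + 1)) = C.deck^[b i] (φ.symm (ζ * ω ^ a)) :=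
    C.eventually_iterate_symm_chart hx hk hφ h0 h
  have hlim : ∀ a : ℕ, Filter.Tendsto (fun ζ : ℝ => φ.symm (ζ * ω ^ a)) (𝓝[>] 0) (𝓝[≠] x) :=
    fun a => (BranchedCover.tendsto_symm_chart hφ h0).comp
      (tendsto_ofReal_mul_nhdsNE (pow_ne_zero a hω))
  have hlim' := fun a => (hlim a).mono_right nhdsWithin_le_nhds
  have hfix : C.deck^[b i] x = x := by
    refine tendsto_nhds_unique_of_eventuallyEq
      (((C'.continuous_iterate (b i)).tendsto x).comp (hlim' 0)) (hlim' 1) ?_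
    filter_upwards [hmon] with ζ hζ
    exact (hζ 0).symm
  refine Nat.dvd_antisymm (Nat.dvd_gcd (C'.minimalPeriod_dvd hV x)
    (Function.IsPeriodicPt.minimalPeriod_dvd hfix)) ?_
  set m := Function.minimalPeriod C.deck x
  have hm : C.deck^[m] x = x := Function.iterate_minimalPeriod
  have hsrc : ∀ᶠ ζ : ℝ in 𝓝[>] 0, C.deck^[m] (φ.symm (ζ * ω ^ 0)) ∈ φ.source := by
    have := ((C'.continuous_iterate m).tendsto x).comp (hlim' 0)
    refine this.eventually ?_
    change φ.source ∈ 𝓝 (C.deck^[m] x)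
    rw [hm]
    exact φ.open_source.mem_nhds hφ
  have htgt : ∀ᶠ ζ : ℝ in 𝓝[>] 0, (ζ : ℂ) * ω ^ 0 ∈ φ.target :=
    ((tendsto_ofReal_mul_nhdsNE (pow_ne_zero 0 hω)).mono_right nhdsWithin_le_nhds).eventually
      (φ.open_target.mem_nhds (h0 ▸ φ.map_source hφ))
  obtain ⟨ζ, hζ, h1, h2, h3, h4⟩ := (((hlim 0).eventually (C'.eventually_proj_notMem hV x)).and
    (hmon.and (hsrc.and (htgt.and self_mem_nhdsWithin)))).exists
  have hζ0 : (ζ : ℂ) ≠ 0 := by exact_mod_cast (Set.mem_Ioi.1 h4).ne'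
  have hpow : φ (C.deck^[m] (φ.symm (ζ * ω ^ 0))) ^ k = (ζ : ℂ) ^ k := by
    apply sphereParam_injective (C.proj x)
    rw [← h _ h2]
    refine (C'.proj_iterate m _).trans ((h _ (φ.map_target h3)).trans ?_)
    rw [φ.right_inv h3, pow_zero, mul_one]
  have : NeZero k := ⟨hk.ne'⟩
  -- Chart coordinates of points in the same fibre have equal `k`-th powers, so they differ by a
  -- power of `ω`.
  obtain ⟨a, -, ha⟩ := (Complex.isPrimitiveRoot_exp k hk.ne').eq_pow_of_pow_eq_one
    (ξ := φ (C.deck^[m] (φ.symm (ζ * ω ^ 0))) / ζ) (by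
      rw [div_pow, hpow, div_self (pow_ne_zero _ hζ0)])
  have hya : C.deck^[m] (φ.symm (ζ * ω ^ 0)) = φ.symm (ζ * ω ^ a) := by
    rw [show ω ^ a = _ from ha, mul_div_cancel₀ _ hζ0, φ.left_inv h2]
  have hiter : ∀ a, φ.symm (ζ * ω ^ a) = C.deck^[b i * a] (φ.symm (ζ * ω ^ 0)) := by
    intro a
    induction a with
    | zero => rfl
    | succ a ih => rw [h1, ih, ← Function.iterate_add_apply, mul_add, mul_one, add_comm]
  rw [hiter a] at hya
  have hmod : (m : ZMod d) = ((b i * a : ℕ) : ZMod d) := by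
    apply C'.shift_injective_left hV hζ
    rw [C'.shift_natCast hV, C'.shift_natCast hV]
    exact hya
  rw [ZMod.natCast_eq_natCast_iff] at hmod
  exact (hmod.dvd_iff (Nat.gcd_dvd_left _ _)).2 ((Nat.gcd_dvd_right _ _).mul_right a)

end CyclicBranchedCover

/-! ### General position and the genus formula -/

/-- Multiplication by a nonzero number, on the Riemann sphere. -/
noncomputable def sphereMul {ω : ℂ} (hω : ω ≠ 0) : OnePoint ℂ ≃ₜ OnePoint ℂ :=
  (Homeomorph.mulLeft₀ ω hω).onePointCongr

theorem sphereMul_coe {ω : ℂ} (hω : ω ≠ 0) (z : ℂ) :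
    sphereMul hω (z : OnePoint ℂ) = ((ω * z : ℂ) : OnePoint ℂ) := rfl

theorem sphereMul_infty {ω : ℂ} (hω : ω ≠ 0) : sphereMul hω OnePoint.infty = OnePoint.infty := rfl

theorem exists_sphereMul_sphereParam {ω : ℂ} (hω : ω ≠ 0) (v : OnePoint ℂ) :
    ∃ c : ℂ, c ≠ 0 ∧ ∀ w, sphereMul hω (sphereParam v w) = sphereParam (sphereMul hω v) (c * w) := by
  induction v using OnePoint.rec with
  | infty =>
    refine ⟨ω⁻¹, inv_ne_zero hω, fun w => ?_⟩
    rw [sphereMul_infty]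
    by_cases hw : w = 0
    · rw [hw, mul_zero, sphereParam_infty_zero, sphereMul_infty]
    · rw [sphereParam_infty_of_ne hw, sphereParam_infty_of_ne (mul_ne_zero (inv_ne_zero hω) hw),
        sphereMul_coe, mul_inv, inv_inv]
  | coe a =>
    exact ⟨ω, hω, fun w => by rw [sphereParam_coe, sphereMul_coe, sphereMul_coe, sphereParam_coe,
      mul_add]⟩

/-- The composition of a branched cover with the multiplication by a nonzero number. -/
noncomputable def BranchedCover.mul {d : ℕ} {V : Set (OnePoint ℂ)} {X : Type*} [TopologicalSpace X]
    (C : BranchedCover d V X) {ω : ℂ} (hω : ω ≠ 0) : BranchedCover d (sphereMul hω '' V) X where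
  proj := sphereMul hω ∘ C.proj
  deck := C.deck
  continuous_proj := (sphereMul hω).continuous.comp C.continuous_proj
  surjective_proj := (sphereMul hω).surjective.comp C.surjective_proj
  proj_eq_iff x y := (sphereMul hω).injective.eq_iff.trans (C.proj_eq_iff x y)
  deck_free x hx := C.deck_free x fun h => hx ⟨_, h, rfl⟩
  isCoveringMapOn := by
    have := C.isCoveringMapOn.homeomorph_comp (sphereMul hω)
    rwa [← Homeomorph.image_eq_preimage_symm, Set.image_compl_eq (sphereMul hω).bijective] at this
  exists_chart x := by
    obtain ⟨k, hk, φ, hx, h0, h⟩ := C.exists_chart x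
    obtain ⟨c, hc, hcw⟩ := exists_sphereMul_sphereParam hω (C.proj x)
    -- Multiplication rescales the coordinate of the sphere by `c`; rescaling the chart by a `k`-th
    -- root of `c` restores the form `ζ ↦ ζ ^ k`.
    obtain ⟨l, hl⟩ := IsAlgClosed.exists_pow_nat_eq c hk
    have hl0 : l ≠ 0 := by
      rintro rfl
      exact hc (by rw [← hl, zero_pow hk.ne'])
    refine ⟨k, hk, φ.transHomeomorph (Homeomorph.mulLeft₀ l hl0), hx, ?_, fun y hy => ?_⟩
    · change l * φ x = 0
      rw [h0, mul_zero]
    · change sphereMul hω (C.proj y) = sphereParam (sphereMul hω (C.proj x)) ((l * φ y) ^ k)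
      rw [h y hy, hcw, mul_pow, hl]

/-- For `ω = 1 + t * I` two points acquire equal real parts for at most one `t`, so all but finitely
many `t` work. Distinct real parts are what make the vertical slits disjoint. -/
theorem exists_injOn_re_mul (A : Finset ℂ) :
    ∃ ω : ℂ, ω ≠ 0 ∧ Set.InjOn (fun z => (ω * z).re) A := by
  obtain ⟨t, ht⟩ := ((A ×ˢ A).image fun c => (c.1 - c.2).re / (c.1 - c.2).im).exists_notMem
  refine ⟨⟨1, t⟩, fun h => by simpa using congrArg Complex.re h, fun a ha b hb hab => ?_⟩
  by_contra hne
  have h1 : (a - b).re = t * (a - b).im := by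
    simp only [Complex.mul_re, one_mul] at hab
    rw [Complex.sub_re, Complex.sub_im]
    linarith
  by_cases h0 : (a - b).im = 0
  · exact hne (sub_eq_zero.1 (Complex.ext (by rw [h1, h0, mul_zero]; rfl) h0))
  · refine ht (Finset.mem_image.2 ⟨(a, b), Finset.mk_mem_product ha hb, ?_⟩)
    rw [h1, mul_div_cancel_right₀ _ h0]

theorem exists_strictMono_re (A : Finset ℂ) (hA : Set.InjOn Complex.re A) :
    ∃ q : Fin A.card → ℂ, (StrictMono fun i => (q i).re) ∧ Set.range q = A := by
  classical
  have hcard : (A.image Complex.re).card = A.card := Finset.card_image_of_injOn hA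
  let e := (A.image Complex.re).orderEmbOfFin hcard
  have he : ∀ i, ∃ z ∈ A, z.re = e i := fun i =>
    Finset.mem_image.1 (Finset.orderEmbOfFin_mem _ hcard i)
  choose q hq hqe using he
  refine ⟨q, fun i j hij => ?_, Set.Subset.antisymm ?_ fun z hz => ?_⟩
  · simp only [hqe]
    exact e.strictMono hij
  · rintro _ ⟨i, rfl⟩
    exact hq i
  · have : z.re ∈ Set.range e := by
      rw [Finset.range_orderEmbOfFin]
      exact Finset.mem_image_of_mem _ hz
    obtain ⟨i, hi⟩ := this
    exact ⟨i, hA (hq i) hz ((hqe i).trans hi)⟩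

/-- The Riemann–Hurwitz formula for a cyclic branched cover: its Betti number is determined by the
number of points over a finite set containing the branch points. -/
theorem BranchedCover.exists_rank_homology_eq {d : ℕ} [NeZero d] {V : Set (OnePoint ℂ)}
    (hV : V.Finite) {X : Type*} [TopologicalSpace X] [T2Space X] [CompactSpace X]
    [ConnectedSpace X] (C : BranchedCover d V X) :
    ∃ (g : ℕ) (W : Finset (OnePoint ℂ)), V ⊆ W ∧
      (∀ x : X, Module.rank ℤ (FirstHomology X x) = ((2 * g : ℕ) : Cardinal)) ∧
      2 * g + 2 * d + Nat.card (C.proj ⁻¹' W) = W.card * d + 2 := by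
  classical
  -- The point `0` is adjoined so that there is at least one slit.
  have hfin : (insert (0 : ℂ) ((↑) ⁻¹' V)).Finite :=
    (hV.preimage OnePoint.coe_injective.injOn).insert _
  let A : Finset ℂ := hfin.toFinset
  have hA0 : (0 : ℂ) ∈ A := by simp [A]
  obtain ⟨ω, hω, hinj⟩ := exists_injOn_re_mul A
  have hmul : Function.Injective fun z : ℂ => ω * z := mul_right_injective₀ hω
  obtain ⟨q, hq, hqr⟩ := exists_strictMono_re (A.image fun z => ω * z) (by
    rw [Finset.coe_image]
    exact hinj.image_of_comp)
  have : NeZero (A.image fun z => ω * z).card :=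
    ⟨(Finset.card_pos.2 ⟨_, Finset.mem_image_of_mem _ hA0⟩).ne'⟩
  let W : Finset (OnePoint ℂ) := insert OnePoint.infty (A.image (↑))
  have hVW : V ⊆ W := by
    intro v hv
    induction v using OnePoint.rec with
    | infty => simp [W]
    | coe z => simp [W, A, hv]
  have hWq : sphereMul hω '' W = vertices q := by
    have h1 : vertices q = insert OnePoint.infty ((↑) '' Set.range q) := by
      rw [vertices, ← Set.range_comp]; rfl
    rw [h1, hqr]
    simp only [W, Finset.coe_insert, Finset.coe_image, Set.image_insert_eq, sphereMul_infty,
      Set.image_image, sphereMul_coe]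
  have hWc : W.card = (A.image fun z => ω * z).card + 1 := by
    rw [Finset.card_insert_of_notMem (by simp), Finset.card_image_of_injective _ hmul,
      Finset.card_image_of_injective _ OnePoint.coe_injective]
  obtain ⟨C', hC'⟩ : ∃ C' : BranchedCover d (vertices q) X, C'.proj = sphereMul hω ∘ C.proj := by
    rw [← hWq]
    exact ⟨(C.enlarge hVW).mul hω, rfl⟩
  obtain ⟨g, h1, h2⟩ := _root_.exists_rank_homology_eq hq C'
  refine ⟨g, W, hVW, h1, ?_⟩
  have h3 : C'.proj ⁻¹' vertices q = C.proj ⁻¹' W := by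
    rw [hC', ← hWq, Set.preimage_comp, Set.preimage_image_eq _ (sphereMul hω).injective]
  rw [h3] at h2
  -- `W` consists of the `N` finite vertices and `∞`, which accounts for the second `d` on the left.
  rw [hWc, add_mul, one_mul]
  omega

/-- The fibre over `p i` has `gcd d (b i)` points, and each of the remaining `W.card - n` fibres has
`d`. -/
theorem CyclicBranchedCover.sum_card_fibre {d n : ℕ} (hd : 0 < d) {p : Fin n → OnePoint ℂ}
    (hp : Function.Injective p) {b : Fin n → ℕ} {X : Type*} [TopologicalSpace X] [T2Space X]
    (C : CyclicBranchedCover d p b X) {W : Finset (OnePoint ℂ)} (hW : Set.range p ⊆ W) :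
    Nat.card (C.proj ⁻¹' W) + n * d = ∑ i, Nat.gcd d (b i) + W.card * d := by
  classical
  have hV := Set.finite_range p
  let C' := BranchedCover.ofCyclic C
  have hP : Finset.univ.image p ⊆ W := fun v hv => by
    obtain ⟨i, -, rfl⟩ := Finset.mem_image.1 hv
    exact hW ⟨i, rfl⟩
  have h1 : Nat.card (C.proj ⁻¹' W) = ∑ v ∈ W, Nat.card (C.proj ⁻¹' {v}) :=
    C'.card_preimage hV hd W
  have h2 : ∑ v ∈ Finset.univ.image p, Nat.card (C.proj ⁻¹' {v}) = ∑ i, Nat.gcd d (b i) := by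
    rw [Finset.sum_image fun i _ j _ h => hp h]
    refine Finset.sum_congr rfl fun i _ => ?_
    obtain ⟨x, hx⟩ := C.surjective_proj (p i)
    rw [← C.minimalPeriod_eq_gcd hd hx, ← hx]
    exact C'.card_fibre hV hd x
  have h3 : ∑ v ∈ W \ Finset.univ.image p, Nat.card (C.proj ⁻¹' {v}) =
      (W \ Finset.univ.image p).card * d := by
    refine Finset.sum_const_nat fun v hv => ?_
    obtain ⟨x, rfl⟩ := C.surjective_proj v
    have hx : C'.proj x ∉ Set.range p := fun ⟨i, hi⟩ =>
      (Finset.mem_sdiff.1 hv).2 (Finset.mem_image.2 ⟨i, Finset.mem_univ _, hi⟩)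
    exact (C'.card_fibre hV hd x).trans (C'.minimalPeriod_of_notMem hV hx)
  have h4 := Finset.card_sdiff_add_card_eq_card hP
  rw [Finset.card_image_of_injective _ hp, Finset.card_univ, Fintype.card_fin] at h4
  rw [h1, ← Finset.sum_sdiff hP, h2, h3, ← h4]
  ring

theorem mainTheorem2 {d n : ℕ} (hd : 0 < d) (p : Fin n → OnePoint ℂ) (hp : Function.Injective p)
    (b : Fin n → ℕ) {X : Type*} [TopologicalSpace X] [T2Space X] [CompactSpace X]
    [ConnectedSpace X] (C : CyclicBranchedCover d p b X) :
    ∃ g : ℕ, HasGenus X g ∧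
      (g : ℚ) = (d : ℚ) * ((n : ℚ) - 2) / 2 + 1 - 1 / 2 * ∑ i, (Nat.gcd d (b i) : ℚ) ∧
      ((∀ i, Nat.gcd d (b i) = 1) → (g : ℚ) = ((n : ℚ) / 2 - 1) * ((d : ℚ) - 1)) := by
  have : NeZero d := ⟨hd.ne'⟩
  let C' := BranchedCover.ofCyclic C
  have := C'.locallyPathConnectedSpace
  obtain ⟨g, W, hW, hrank, hg⟩ := C'.exists_rank_homology_eq (Set.finite_range p)
  -- Both counts contain the number of points over `W` and the term `W.card * d`; eliminating them
  -- removes the auxiliary set.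
  have hsum : Nat.card (C'.proj ⁻¹' W) + n * d = _ := C.sum_card_fibre hd hp hW
  have hformula : (g : ℚ) =
      (d : ℚ) * ((n : ℚ) - 2) / 2 + 1 - 1 / 2 * ∑ i, (Nat.gcd d (b i) : ℚ) := by
    have h1 := congrArg (Nat.cast : ℕ → ℚ) hg
    have h2 := congrArg (Nat.cast : ℕ → ℚ) hsum
    push_cast at h1 h2
    linarith
  refine ⟨g, ⟨PathConnectedSpace.of_locallyPathConnectedSpace, hrank⟩, hformula, fun h => ?_⟩
  rw [hformula]
  simp only [h, Nat.cast_one, Finset.sum_const, Finset.card_univ, Fintype.card_fin, nsmul_eq_mul,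
    mul_one]
  ring
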